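/- **Setting.** A game $\Gamma=(p^{(1)},p^{(2)},A)$ is a finite two-player normal-form game with integer payoffs $p^{(i)}:A=A^{(1)}\times A^{(2)}\to\mathbb Z$; put $n=|A|$. Let $\gamma=(\gamma_1,\dots,\gamma_r)\in A^r$, $r\ge 1$, be a *goal sequence* all of whose entries have maximum social welfare, i.e. maximize $p^{(1)}+p^{(2)}$ over $A$. Let $v^{(i)}=\frac1r\sum_{j}p^{(i)}(\gamma_j)$, let $d^{(i)}_a$ be the best payoff of player $i$ against the opponent's action in $a$, and put $$h^{(i)}_a=v^{(i)}-p^{(i)}(a),\qquad t^{(i)}_a=d^{(i)}_a-v^{(i)},\qquad \theta^{(i)}=\max_{1\le k\le r}\Big(t^{(i)}_{\gamma_k}-\sum_{j<k}h^{(i)}_{\gamma_j}\Big).$$ **Decision problem.** Given $(\Gamma,\gamma,B)$ with $B\in\mathbb Q$ (all numbers in binary), is there a finite sequence $w\in A^\ell$, $\ell\ge0$, such that $\sum_{t<\ell}\big(h^{(1)}_{w_t}+h^{(2)}_{w_t}\big)\le B$ and, for $i=1,2$, $\sum_{t<\ell}h^{(i)}_{w_t}>\theta^{(i)}$ and $\sum_{t<k}h^{(i)}_{w_t}>t^{(i)}_{w_k}$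 for all $0\le k<\ell$? **Stable sequences.** A sequence $\sigma\in A^{\mathbb N}$ is *stable* (in the limit $\beta\to1$) if for every player $i$, time $k$ and action $b$ of player $i$ the following difference has a positive limit as $\beta\to1^-$: the discounted utility $\sum_t\beta^tp^{(i)}(\sigma_t)$ minus the discounted utility that player $i$ obtains by following $\sigma$ before time $k$, playing $b$ at time $k$ (possibly $b=\sigma_k^{(i)}$), and then restarting $\sigma$. A *stable sequence with goal sequence $\gamma$* is a stable sequence $w\gamma\gamma\gamma\cdots$ with a finite *hazing period* $w$; its *total hazing* is $\sum_{t<|w|}(h^{(1)}_{w_t}+h^{(2)}_{w_t})$. **Theorem.** Let $p$ be a polynomial and let $\mathcal C$ be a class of instances $(\Gamma,\gamma,B)$ as above with $r\le p(n)$. Suppose that each yes-instance in $\mathcal C$ satisfies at least one of the following conditions (nothing is required of no-instances): 1. some stable sequence with goal sequence $\gamma$ has total hazing at most $p(n)$; 2. some stable sequence with goal sequence $\gamma$ and total hazing at most $B$ has at most $p(n)$ entries $a$ in its hazing period, counted with multiplicity, with $h^{(1)}_a<0$ or $h^{(2)}_a<0$. (For instance, condition 1 holds for every yes-instance with $B\le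 p(n)$, and condition 2 holds for every yes-instance for which some minimum-hazing stable sequence with goal sequence $\gamma$ has at most $p(n)$ such entries.) Then the decision problem restricted to $\mathcal C$ is in $\mathsf{NP}$: there is a polynomial-time verifier for which an instance in $\mathcal C$ is a yes-instance if and only if it has an accepted certificate of polynomial length. Moreover, if every yes-instance in $\mathcal C$ satisfies condition 2, then run-length witnesses suffice: the relation "the string $c$ is the run-length code (a list of pairs of an action pair and a multiplicity, written in binary) of a sequence $w$ that solves the instance" is decidable in polynomial time, and an instance in $\mathcal C$ is a yes-instance if and only if it has such a witness $c$ of length polynomial in the size of the instance. -/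

import Mathlib

open Filter Topology

/-! ### Games with restarts, goal sequences, hazing -/

/-- A finite two-player normal-form game with integer payoffs. Player `0` chooses a row, player `1`
a column. -/
structure RestartGame where
  rows : ℕ
  cols : ℕ
  payoff : Fin 2 → Fin rows × Fin cols → ℤ

namespace RestartGame

/-- The set `A` of action pairs. -/
abbrev Pair (G : RestartGame) : Type := Fin G.rows × Fin G.cols

/-- The actions of player `i`. -/
abbrev Action (G : RestartGame) (i : Fin 2) : Type := Fin (if i = 0 then G.rows else G.cols)

/-- The action pair in which player `i` plays `b` and the opponent plays as in `a`. -/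
def deviate (G : RestartGame) : (i : Fin 2) → G.Action i → G.Pair → G.Pair
  | 0, b, a => (b, a.2)
  | 1, b, a => (a.1, b)

/-- The number `n = |A|` of action pairs. -/
def numPairs (G : RestartGame) : ℕ := G.rows * G.cols

/-- Some action of player `i` exists as soon as there is an action pair. -/
theorem action_nonempty (G : RestartGame) (i : Fin 2) (a : G.Pair) :
    (Finset.univ : Finset (G.Action i)).Nonempty := by
  match i with
  | 0 => exact ⟨a.1, Finset.mem_univ _⟩
  | 1 => exact ⟨a.2, Finset.mem_univ _⟩

/-- The deviation payoff `d_a^{(i)}`: the best payoff of player `i` against the opponent's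
action in `a`. -/
def deviationPayoff (G : RestartGame) (i : Fin 2) (a : G.Pair) : ℤ :=
  Finset.univ.sup' (G.action_nonempty i a) fun b => G.payoff i (G.deviate i b a)

/-- The utility of player `i` with discount factor `β` from the sequence `σ`. -/
noncomputable def utility (G : RestartGame) (β : ℝ) (i : Fin 2) (σ : ℕ → G.Pair) : ℝ :=
  ∑' t, β ^ t * (G.payoff i (σ t) : ℝ)

/-- The utility of player `i` who follows `σ` up to time `k`, plays `b` at time `k` (possibly the
action that `σ` prescribes) and then restarts the sequence. -/
noncomputable def restartUtility (G : RestartGame) (β : ℝ) (i : Fin 2) (σ : ℕ → G.Pair)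
    (k : ℕ) (b : G.Action i) : ℝ :=
  (∑ t ∈ Finset.range k, β ^ t * (G.payoff i (σ t) : ℝ))
    + β ^ k * (G.payoff i (G.deviate i b (σ k)) : ℝ)
    + ∑' t, β ^ (k + 1 + t) * (G.payoff i (σ t) : ℝ)

/-- `σ` is stable in the limit `β → 1`: deviating and/or restarting at any time is strictly worse,
in the limit, than following `σ` (ties are broken in favour of deviating). -/
def StableInLimit (G : RestartGame) (σ : ℕ → G.Pair) : Prop :=
  ∀ (i : Fin 2) (k : ℕ) (b : G.Action i), ∃ L : ℝ, 0 < L ∧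
    Tendsto (fun β : ℝ => G.utility β i σ - G.restartUtility β i σ k b) (𝓝[<] 1) (𝓝 L)

end RestartGame

/-- The minimum-hazing problem on hazing costs `h`, action thresholds `t`, goal thresholds `θ` and
total hazing bound `Δ`: the finite sequence `w` is a solution. -/
def IsMinHazingSolution {A : Type*} (h t : Fin 2 → A → ℚ) (θ : Fin 2 → ℚ) (Δ : ℚ)
    (w : List A) : Prop :=
  (w.map fun a => h 0 a + h 1 a).sum ≤ Δ ∧
  (∀ i, θ i < (w.map (h i)).sum) ∧
  ∀ (k : ℕ) (hk : k < w.length) (i : Fin 2), t i w[k] < ((w.take k).map (h i)).sum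

/-- A game, a goal sequence of positive length `r`, and a rational bound on the total hazing. -/
structure HazingInstance where
  game : RestartGame
  r : ℕ
  r_pos : 0 < r
  goal : Fin r → game.Pair
  bound : ℚ

namespace HazingInstance

variable (I : HazingInstance)

/-- The number `n = |A|` of action pairs. -/
def n : ℕ := I.game.numPairs

/-- The goal value `v_γ^{(i)}`. -/
def goalValue (i : Fin 2) : ℚ := (∑ j, (I.game.payoff i (I.goal j) : ℚ)) / I.r

/-- The hazing cost `h_a^{(i)}`. -/
def hazing (i : Fin 2) (a : I.game.Pair) : ℚ := I.goalValue i - I.game.payoff i a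

/-- The threshold `t_a^{(i)}`. -/
def threshold (i : Fin 2) (a : I.game.Pair) : ℚ := I.game.deviationPayoff i a - I.goalValue i

/-- The threshold `θ_γ^{(i)}` of the goal sequence. -/
def goalThreshold (i : Fin 2) : ℚ :=
  (Finset.univ : Finset (Fin I.r)).sup' ⟨⟨0, I.r_pos⟩, Finset.mem_univ _⟩ fun k =>
    I.threshold i (I.goal k) - ∑ j ∈ Finset.Iio k, I.hazing i (I.goal j)

/-- The sum of both players' hazing costs over a finite hazing period. -/
def totalHazing (w : List I.game.Pair) : ℚ := (w.map fun a => I.hazing 0 a + I.hazing 1 a).sum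

/-- The number of entries of a finite sequence that have negative hazing cost for some player. -/
def negativeCount (w : List I.game.Pair) : ℕ :=
  w.countP fun a => decide (I.hazing 0 a < 0 ∨ I.hazing 1 a < 0)

/-- The infinite sequence with hazing period `w`, followed by repeating the goal sequence. -/
def sequence (w : List I.game.Pair) : ℕ → I.game.Pair := fun t =>
  if ht : t < w.length then w[t] else I.goal ⟨(t - w.length) % I.r, Nat.mod_lt _ I.r_pos⟩

/-- The sequence with hazing period `w` and the goal sequence of `I` is stable as `β → 1`. -/
def IsStableHazing (w : List I.game.Pair) : Prop := I.game.StableInLimit (I.sequence w)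

/-- Every action pair of the goal sequence has maximum social welfare. -/
def IsWelfareMaximal : Prop :=
  ∀ (j : Fin I.r) (a : I.game.Pair),
    I.game.payoff 0 a + I.game.payoff 1 a
      ≤ I.game.payoff 0 (I.goal j) + I.game.payoff 1 (I.goal j)

/-- `w` solves the instance of the minimum-hazing problem that `I` induces. -/
def IsSolution (w : List I.game.Pair) : Prop :=
  IsMinHazingSolution I.hazing I.threshold I.goalThreshold I.bound w

/-- The answer to the decision problem is yes. -/
def IsYes : Prop := ∃ w, I.IsSolution w

/-- Some stable sequence with the given goal sequence has total hazing at most `q`. -/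
def HasStableOfHazingLE (q : ℕ) : Prop :=
  ∃ w, I.IsStableHazing w ∧ I.totalHazing w ≤ q

/-- Some stable sequence with the given goal sequence, within the hazing bound of the instance,
has at most `q` action pairs (with multiplicity) in its hazing period that have negative hazing
cost for some player. -/
def HasStableOfNegativesLE (q : ℕ) : Prop :=
  ∃ w, I.IsStableHazing w ∧ I.totalHazing w ≤ I.bound ∧ I.negativeCount w ≤ q

end HazingInstance

/-! ### Binary encodings -/

/-- The alphabet in which instances and certificates are written. -/
inductive HazingSymbol
  | bit (b : Bool)
  | minus
  | sep

/-- An integer in signed binary (least significant bit first), followed by a separator. -/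
def encodeInteger (z : ℤ) : List HazingSymbol :=
  (if z < 0 then [HazingSymbol.minus] else []) ++ z.natAbs.bits.map HazingSymbol.bit
    ++ [HazingSymbol.sep]

/-- A list of integers, one after the other. -/
def encodeIntegers (l : List ℤ) : List HazingSymbol := l.flatMap encodeInteger

/-- The number of an action pair in row-major order. -/
def RestartGame.pairIndex (G : RestartGame) (a : G.Pair) : ℤ :=
  ((finProdFinEquiv a : Fin (G.rows * G.cols)) : ℕ)

/-- The integers that describe an instance: the format of the game, both payoff tables in row-major
order, the goal sequence, and the numerator and the denominator of the bound. -/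
def HazingInstance.toIntegers (I : HazingInstance) : List ℤ :=
  [(I.game.rows : ℤ), (I.game.cols : ℤ)]
    ++ List.ofFn (fun j : Fin (I.game.rows * I.game.cols) =>
        I.game.payoff 0 (finProdFinEquiv.symm j))
    ++ List.ofFn (fun j : Fin (I.game.rows * I.game.cols) =>
        I.game.payoff 1 (finProdFinEquiv.symm j))
    ++ [(I.r : ℤ)]
    ++ List.ofFn (fun j : Fin I.r => I.game.pairIndex (I.goal j))
    ++ [I.bound.num, (I.bound.den : ℤ)]

/-- The binary encoding of an instance. -/
def HazingInstance.encode (I : HazingInstance) : List HazingSymbol := encodeIntegers I.toIntegers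

/-- The sequence described by a list of runs `(a, m)`: `m` consecutive copies of `a`. -/
def expandRuns {A : Type*} (u : List (A × ℕ)) : List A :=
  u.flatMap fun x => List.replicate x.2 x.1

/-- The run-length code of a sequence: action pairs with their multiplicities in binary. -/
def RestartGame.encodeRuns (G : RestartGame) (u : List (G.Pair × ℕ)) : List HazingSymbol :=
  encodeIntegers (u.flatMap fun x => [G.pairIndex x.1, (x.2 : ℤ)])

/-- The string `c` is the run-length code of a sequence that solves `I`. -/
def HazingInstance.IsRunLengthWitness (I : HazingInstance) (c : List HazingSymbol) : Prop :=
  ∃ u : List (I.game.Pair × ℕ), c = I.game.encodeRuns u ∧ I.IsSolution (expandRuns u)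

/-! ### NP -/

/-- The input of a verifier: an encoded instance and a certificate string, marked apart. -/
def verifierInput {α Γ : Type} (enc : α → List Γ) (x : α × List Γ) : List (Γ ⊕ Γ) :=
  (enc x.1).map Sum.inl ++ x.2.map Sum.inr

/-- The relation `R` between instances and certificate strings is decided by a Turing machine that
runs in polynomial time on every instance and every certificate string. -/
def PolyTimeDecidable {α Γ : Type} (enc : α → List Γ) (R : α → List Γ → Prop) : Prop :=
  ∃ V : α × List Γ → Bool, (∀ x c, V (x, c) = true ↔ R x c) ∧
    Nonempty (Turing.TM2ComputableInPolyTime (verifierInput enc) Computability.encodeBool V)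

/-- On the class `C` of instances, the problem `yes` is the NP problem with certificate relation
`R`: `R` is decidable in polynomial time, and an instance in `C` is a yes-instance if and only if it
has a certificate of polynomial length. -/
def IsNPRelationOn {α Γ : Type} (enc : α → List Γ) (C yes : Set α) (R : α → List Γ → Prop) :
    Prop :=
  PolyTimeDecidable enc R ∧
    ∃ s : Polynomial ℕ, ∀ x ∈ C,
      x ∈ yes ↔ ∃ c : List Γ, c.length ≤ s.eval (enc x).length ∧ R x c

/-- The problem `yes`, restricted to the class `C` of instances, is in NP. -/
def InNPOn {α Γ : Type} (enc : α → List Γ) (C yes : Set α) : Prop :=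
  ∃ R : α → List Γ → Prop, IsNPRelationOn enc C yes R

/-! Follow a sequence and record, for both players, the hazing accumulated so far. Since `(1 - β)`
times the utility tends to the goal value `v`, the gain from not restarting at time `k` tends to `(k
+ 1) v` minus the first `k` payoffs minus the deviation payoff (`tendsto_utility_sub`). It is
positive for every deviation exactly if the accumulated hazing exceeds the threshold of the next
action pair. So a stable sequence makes `w` followed by one pass of the goal sequence safe
(`safe_of_isStableHazing`). The inequality with `θ` says that the goal sequence is safe after `w`
(`safe_goal`). Only the passage from stability to inequalities is needed, because yes-instances are
defined by the inequalities.

Maximum welfare of the goal entries makes the sum of both hazing costs of any pair a natural number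
(`exists_hazing_add_eq`). Short witnesses then come from two arguments. Small total hazing `q`:
along a safe sequence both accumulated hazings are nonnegative multiples of `1 / r` with sum at most
`q`. There are at most `(r q + 1) ^ 2` states, and the part between two visits to a state can be cut
out (`exists_safe_length_le`). Few entries with a negative cost: once a pair with nonnegative costs
has been played safely, its later copies can be moved up to it, since this only raises the
accumulated hazing in between. Copies with total cost zero can be dropped, and the number of other
copies is at most the total hazing. This leaves one run for each negative entry and each other pair,
with multiplicities at most `1 + B` (`IsSafe.exists_runs`). Both give run-length codes of polynomial
length, so one certificate relation serves both conditions.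

A run is checked at its first and last copy only, because hazing is linear along it
(`isSafe_replicate_succ`). Scaling by `r` leaves integer arithmetic. Polynomial time is proved for
an actual machine: structured programs compile to stack machines (`Exec.evalsTo`), data are
serialized binary trees, and `PolyFun` is closed under composition, branching and folds with
controlled growth. The verifier is assembled from these operations. -/

/-! ### Structured programs for stack machines -/

namespace StackProgram

open Turing Turing.TM2 Function

/-- Structured programs over the stacks of a TM2 machine with local variables in `σ`. -/
inductive Prog {K : Type} (Γ : K → Type) (σ : Type)
  | push (k : K) (f : σ → Γ k)
  | pop (k : K) (f : σ → Option (Γ k) → σ)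
  | load (f : σ → σ)
  | seq (P Q : Prog Γ σ)
  | ite (p : σ → Bool) (P Q : Prog Γ σ)
  | loop (p : σ → Bool) (P : Prog Γ σ)

variable {K : Type} {Γ : K → Type} {σ : Type}

/-- The labels of the machine that runs a program. -/
def Label : Prog Γ σ → Type
  | .push _ _ => Unit
  | .pop _ _ => Unit
  | .load _ => Unit
  | .seq P Q => Label P ⊕ Label Q
  | .ite _ P Q => Option (Label P ⊕ Label Q)
  | .loop _ P => Option (Label P)

/-- The label at which a program starts. -/
def entry : (P : Prog Γ σ) → Label P
  | .push _ _ => ()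
  | .pop _ _ => ()
  | .load _ => ()
  | .seq P _ => Sum.inl (entry P)
  | .ite _ _ _ => none
  | .loop _ _ => none

theorem finite_label (P : Prog Γ σ) : Finite (Label P) := by
  induction P with
  | push | pop | load => exact inferInstanceAs (Finite Unit)
  | seq P Q _ _ => exact inferInstanceAs (Finite (Label P ⊕ Label Q))
  | ite _ P Q _ _ => exact inferInstanceAs (Finite (Option (Label P ⊕ Label Q)))
  | loop _ P _ => exact inferInstanceAs (Finite (Option (Label P)))

/-- The machine code of a program whose labels are embedded by `e` and which exits to `x`. -/
def code {Λ : Type} : (P : Prog Γ σ) → (Label P → Λ) → Λ → Label P → Stmt Γ Λ σ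
  | .push k f, _, x, _ => .push k f (.goto fun _ => x)
  | .pop k f, _, x, _ => .pop k f (.goto fun _ => x)
  | .load f, _, x, _ => .load f (.goto fun _ => x)
  | .seq P Q, e, x, l => match l with
      | Sum.inl l => code P (fun l => e (Sum.inl l)) (e (Sum.inr (entry Q))) l
      | Sum.inr l => code Q (fun l => e (Sum.inr l)) x l
  | .ite p P Q, e, x, l => match l with
      | none => .branch p (.goto fun _ => e (some (Sum.inl (entry P))))
          (.goto fun _ => e (some (Sum.inr (entry Q))))
      | some (Sum.inl l) => code P (fun l => e (some (Sum.inl l))) x l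
      | some (Sum.inr l) => code Q (fun l => e (some (Sum.inr l))) x l
  | .loop p P, e, x, l => match l with
      | none => .branch p (.goto fun _ => e (some (entry P))) (.goto fun _ => x)
      | some l => code P (fun l => e (some l)) (e none) l

variable [DecidableEq K]

/-- `Exec P v S n v' S'`: the program `P` takes the variables `v` and the stacks `S` to `v'` and
`S'` in exactly `n` steps. -/
inductive Exec : Prog Γ σ → σ → (∀ k, List (Γ k)) → ℕ → σ → (∀ k, List (Γ k)) → Prop
  | push (k : K) (f : σ → Γ k) (v : σ) (S : ∀ k, List (Γ k)) :
      Exec (.push k f) v S 1 v (update S k (f v :: S k))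
  | pop (k : K) (f : σ → Option (Γ k) → σ) (v : σ) (S : ∀ k, List (Γ k)) :
      Exec (.pop k f) v S 1 (f v (S k).head?) (update S k (S k).tail)
  | load (f : σ → σ) (v : σ) (S : ∀ k, List (Γ k)) : Exec (.load f) v S 1 (f v) S
  | seq {P Q : Prog Γ σ} {v v' v'' : σ} {S S' S'' : ∀ k, List (Γ k)} {m n : ℕ} :
      Exec P v S m v' S' → Exec Q v' S' n v'' S'' → Exec (.seq P Q) v S (n + m) v'' S''
  | ite_true {p : σ → Bool} {P Q : Prog Γ σ} {v v' : σ} {S S' : ∀ k, List (Γ k)} {n : ℕ} :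
      p v = true → Exec P v S n v' S' → Exec (.ite p P Q) v S (n + 1) v' S'
  | ite_false {p : σ → Bool} {P Q : Prog Γ σ} {v v' : σ} {S S' : ∀ k, List (Γ k)} {n : ℕ} :
      p v = false → Exec Q v S n v' S' → Exec (.ite p P Q) v S (n + 1) v' S'
  | loop_done {p : σ → Bool} {P : Prog Γ σ} {v : σ} {S : ∀ k, List (Γ k)} :
      p v = false → Exec (.loop p P) v S 1 v S
  | loop_step {p : σ → Bool} {P : Prog Γ σ} {v v' v'' : σ} {S S' S'' : ∀ k, List (Γ k)}
      {m n : ℕ} : p v = true → Exec P v S m v' S' → Exec (.loop p P) v' S' n v'' S'' →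
      Exec (.loop p P) v S (n + m + 1) v'' S''

/-- Compiler correctness. The embedding `e` and the exit label `x` are arbitrary so that the
induction can place each subprogram inside a larger machine and let it exit to the entry of what
follows. -/
theorem Exec.evalsTo {Λ : Type} {M : Λ → Stmt Γ Λ σ} {P : Prog Γ σ} {v v' : σ}
    {S S' : ∀ k, List (Γ k)} {n : ℕ} (h : Exec P v S n v' S') :
    ∀ (e : Label P → Λ) (x : Λ), (∀ l, M (e l) = code P e x l) →
      (flip Bind.bind (step M))^[n] (some (⟨some (e (entry P)), v, S⟩ : Cfg Γ Λ σ))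
        = some ⟨some x, v', S'⟩ := by
  induction h with
  | push k f v S =>
      intro e x hM
      change some (stepAux (M (e (entry _))) v S) = _
      rw [hM]; rfl
  | pop k f v S =>
      intro e x hM
      change some (stepAux (M (e (entry _))) v S) = _
      rw [hM]; rfl
  | load f v S =>
      intro e x hM
      change some (stepAux (M (e (entry _))) v S) = _
      rw [hM]; rfl
  | @seq P Q v v' v'' S S' S'' m n _ _ ih₁ ih₂ =>
      intro e x hM
      rw [iterate_add_apply]
      have h₁ := ih₁ (fun l => e (Sum.inl l)) (e (Sum.inr (entry Q)))
        fun l => by rw [hM (Sum.inl l)]; rfl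
      have h₂ := ih₂ (fun l => e (Sum.inr l)) x fun l => by rw [hM (Sum.inr l)]; rfl
      exact (congrArg _ h₁).trans h₂
  | @ite_true p P Q v v' S S' n hp _ ih =>
      intro e x hM
      have h := ih (fun l => e (some (Sum.inl l))) x fun l => by rw [hM (some (Sum.inl l))]; rfl
      rw [iterate_add_apply, ← h]
      congr 1
      simp [flip, entry, hM none, code, hp]
  | @ite_false p P Q v v' S S' n hp _ ih =>
      intro e x hM
      have h := ih (fun l => e (some (Sum.inr l))) x fun l => by rw [hM (some (Sum.inr l))]; rfl
      rw [iterate_add_apply, ← h]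
      congr 1
      simp [flip, entry, hM none, code, hp]
  | @loop_done p P v S hp =>
      intro e x hM
      simp [flip, entry, hM none, code, hp]
  | @loop_step p P v v' v'' S S' S'' m n hp _ _ ih₁ ih₂ =>
      intro e x hM
      have h₁ := ih₁ (fun l => e (some l)) (e none) fun l => by rw [hM (some l)]; rfl
      have h₂ := ih₂ e x hM
      rw [iterate_add_apply, iterate_add_apply, ← h₂]
      refine congrArg _ (Eq.trans ?_ h₁)
      congr 1
      simp [flip, entry, hM none, code, hp]

/-- Each step pushes at most one symbol, so running time bounds growth; output sizes are estimated
from this. -/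
theorem Exec.length_le {P : Prog Γ σ} {v v' : σ} {S S' : ∀ k, List (Γ k)} {n : ℕ}
    (h : Exec P v S n v' S') (k : K) : (S' k).length ≤ (S k).length + n := by
  induction h with
  | push j f v S =>
      by_cases hk : k = j
      · subst hk; simp
      · simp [hk]
  | pop j f v S =>
      by_cases hk : k = j
      · subst hk; simp; omega
      · simp [hk]
  | load f v S => simp
  | seq => omega
  | ite_true => omega
  | ite_false => omega
  | loop_done => omega
  | loop_step => omega

/-- `Runs P S n S'`: whatever its variables are, `P` takes the stacks `S` to `S'` in at most `n`
steps. -/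
def Runs (P : Prog Γ σ) (S : ∀ k, List (Γ k)) (n : ℕ) (S' : ∀ k, List (Γ k)) : Prop :=
  ∀ v, ∃ v' m, m ≤ n ∧ Exec P v S m v' S'

theorem Runs.mono {P : Prog Γ σ} {S S' : ∀ k, List (Γ k)} {m n : ℕ} (h : Runs P S m S')
    (hmn : m ≤ n) : Runs P S n S' := fun v =>
  let ⟨v', t, ht, he⟩ := h v
  ⟨v', t, ht.trans hmn, he⟩

theorem Runs.seq {P Q : Prog Γ σ} {S S' S'' : ∀ k, List (Γ k)} {m n : ℕ} (h₁ : Runs P S m S')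
    (h₂ : Runs Q S' n S'') : Runs (.seq P Q) S (m + n) S'' := fun v =>
  let ⟨v', t, ht, he⟩ := h₁ v
  let ⟨v'', t', ht', he'⟩ := h₂ v'
  ⟨v'', t' + t, by omega, he.seq he'⟩

theorem Runs.length_le [Nonempty σ] {P : Prog Γ σ} {S S' : ∀ k, List (Γ k)} {n : ℕ}
    (h : Runs P S n S') (k : K) : (S' k).length ≤ (S k).length + n := by
  obtain ⟨v', m, hm, he⟩ := h (Classical.arbitrary σ)
  have := he.length_le k
  omega

end StackProgram

/-! ### Programs on serialized binary trees -/

/-- Binary trees, the data type of the polynomial-time functions below. -/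
inductive BTree
  | leaf
  | node (l r : BTree)
  deriving DecidableEq

namespace BTree

/-- The number of nodes and leaves. -/
def size : BTree → ℕ
  | leaf => 1
  | node l r => l.size + r.size + 1

/-- The preorder serialization. -/
def ser : BTree → List Bool
  | leaf => [false]
  | node l r => true :: (l.ser ++ r.ser)

@[simp] theorem length_ser (t : BTree) : t.ser.length = t.size := by
  induction t with
  | leaf => rfl
  | node l r hl hr => simp [ser, size, hl, hr]

theorem size_pos (t : BTree) : 0 < t.size := by cases t <;> simp [size]

end BTree

namespace StackProgram

open Turing Turing.TM2 Function

/-- The symbols on the input stack. -/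
abbrev InputSymbol : Type := HazingSymbol ⊕ HazingSymbol

/-- The stacks besides the input stack. -/
inductive Work
  | main
  | cnt
  | aux (j : Bool)
  deriving DecidableEq, Fintype

/-- The stack alphabets. -/
abbrev Alphabet : Option Work → Type
  | none => InputSymbol
  | some _ => Bool

/-- The local variables: the last symbol popped from a work stack and from the input stack. -/
abbrev Var : Type := Option Bool × Option InputSymbol

/-- Programs of the tree machine. -/
abbrev TProg : Type := Prog Alphabet Var

/-- The stacks with input stack `i`, main stack `m`, auxiliary stacks `x` and counter stack `c`. -/
def stk (i : List InputSymbol) (m : List Bool) (x : Bool → List Bool) (c : List Bool) :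
    ∀ k, List (Alphabet k)
  | none => i
  | some .main => m
  | some .cnt => c
  | some (.aux j) => x j

section Stacks

variable (i i' : List InputSymbol) (m l : List Bool) (x : Bool → List Bool) (c : List Bool)
  (j : Bool)

@[simp] theorem stk_none : stk i m x c none = i := rfl
@[simp] theorem stk_main : stk i m x c (some .main) = m := rfl
@[simp] theorem stk_cnt : stk i m x c (some .cnt) = c := rfl
@[simp] theorem stk_aux : stk i m x c (some (.aux j)) = x j := rfl

@[simp] theorem update_stk_none : update (stk i m x c) none i' = stk i' m x c := by
  funext k; rcases k with _ | _ | _ | _ <;> simp [stk]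

@[simp] theorem update_stk_main :
    update (stk i m x c) (some .main) l = stk i l x c := by
  funext k; rcases k with _ | _ | _ | _ <;> simp [stk]

@[simp] theorem update_stk_cnt :
    update (stk i m x c) (some .cnt) l = stk i m x l := by
  funext k; rcases k with _ | _ | _ | _ <;> simp [stk]

@[simp] theorem update_stk_aux :
    update (stk i m x c) (some (.aux j)) l = stk i m (update x j l) c := by
  funext k
  rcases k with _ | _ | _ | j' <;> simp [stk]
  by_cases h : j' = j
  · subst h; simp
  · simp [h, stk]

end Stacks

/-! ### Basic instructions and loops that consume a stack -/

/-- Push a bit. -/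
def push (k : Work) (b : Bool) : TProg := .push (some k) fun _ => b

/-- Pop a bit into the local variable. -/
def pop (k : Work) : TProg := .pop (some k) fun v s => (s, v.2)

/-- Do nothing. -/
def skip : TProg := .load id

/-- Pop a bit and branch on it. -/
def popCase (k : Work) (P Q : TProg) : TProg :=
  .seq (pop k) (.ite (fun v => v.1 == some true) Q P)

/-- Pop bits from `k` while `c` holds of the popped bit, and run `P` or `Q` after each pop,
according to the popped bit. -/
def popLoop (c : Option Bool → Bool) (k : Work) (P Q : TProg) : TProg :=
  .seq (pop k) (.loop (fun v => c v.1) (.seq (.ite (fun v => v.1 == some true) Q P) (pop k)))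

theorem runs_push (k : Work) (b : Bool) (S : ∀ k, List (Alphabet k)) :
    Runs (push k b) S 1 (update S (some k) (b :: S (some k))) := fun v =>
  ⟨v, 1, le_rfl, Exec.push (Γ := Alphabet) (some k) (fun _ => b) v S⟩

theorem runs_pop (k : Work) (S : ∀ k, List (Alphabet k)) :
    Runs (pop k) S 1 (update S (some k) (S (some k)).tail) := fun v =>
  ⟨_, 1, le_rfl, .pop (some k) _ v S⟩

theorem runs_skip (S : ∀ k, List (Alphabet k)) : Runs skip S 1 S := fun v =>
  ⟨v, 1, le_rfl, .load id v S⟩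

theorem runs_popCase {k : Work} {P Q : TProg} {S S' : ∀ k, List (Alphabet k)} {b : Bool}
    {l : List Bool} {n : ℕ} (hS : S (some k) = b :: l)
    (h : Runs (if b then Q else P) (update S (some k) l) n S') :
    Runs (popCase k P Q) S (n + 2) S' := by
  intro v
  obtain ⟨v', m, hm, he⟩ := h (some b, v.2)
  refine ⟨v', (m + 1) + 1, by omega, .seq (.pop (some k) _ v S) ?_⟩
  rw [hS]
  cases b
  · exact .ite_false rfl he
  · exact .ite_true rfl he

theorem runs_popLoop_done {c : Option Bool → Bool} {k : Work} {P Q : TProg}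
    {S : ∀ k, List (Alphabet k)} (hS : c (S (some k)).head? = false) :
    Runs (popLoop c k P Q) S 2 (update S (some k) (S (some k)).tail) := fun v =>
  ⟨_, _, le_rfl, .seq (.pop (some k) _ v S) (.loop_done hS)⟩

/-- The pop that ends the loop body is the pop that opens the next `popLoop`. Unfolding that pop
from `h₂` and regrouping gives an induction rule in which every round starts from unpopped stacks.
-/
theorem runs_popLoop_step {c : Option Bool → Bool} {k : Work} {P Q : TProg}
    {S S' S'' : ∀ k, List (Alphabet k)} {b : Bool} {l : List Bool} {m n : ℕ}
    (hS : S (some k) = b :: l) (hc : c (some b) = true)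
    (h₁ : Runs (if b then Q else P) (update S (some k) l) m S')
    (h₂ : Runs (popLoop c k P Q) S' n S'') :
    Runs (popLoop c k P Q) S (m + n + 3) S'' := by
  intro v
  obtain ⟨v', m', hm, he⟩ := h₁ (some b, v.2)
  obtain ⟨v'', n', hn, he'⟩ := h₂ v'
  have he'' : Exec (.ite (fun v => v.1 == some true) Q P) (some b, v.2)
      (update S (some k) l) (m' + 1) v' S' := by
    cases b
    · exact .ite_false rfl he
    · exact .ite_true rfl he
  cases he' with
  | seq ha hb =>
    cases ha with
    | pop =>
      refine ⟨v'', _, ?_, Exec.seq (n := _ + (1 + (m' + 1)) + 1) (.pop (some k) _ v S)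
        (by rw [hS]; exact .loop_step hc (he''.seq (.pop (some k) _ v' S')) hb)⟩
      omega

/-! ### Moving words and trees between stacks -/

/-- Move everything from an auxiliary stack to the main stack. -/
def unmove (j : Bool) : TProg :=
  popLoop Option.isSome (.aux j) (push .main false) (push .main true)

/-- Empty an auxiliary stack. -/
def clear (j : Bool) : TProg := popLoop Option.isSome (.aux j) skip skip

/-- Move everything from one auxiliary stack to another. -/
def shift (j j' : Bool) : TProg :=
  popLoop Option.isSome (.aux j) (push (.aux j') false) (push (.aux j') true)

/-- Move everything from one auxiliary stack to another and to the main stack. -/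
def unmoveCopy (j j' : Bool) : TProg :=
  popLoop Option.isSome (.aux j) (.seq (push .main false) (push (.aux j') false))
    (.seq (push .main true) (push (.aux j') true))

/-- Move a tree from the main stack to an auxiliary stack. -/
def moveTree (j : Bool) : TProg :=
  .seq (push .cnt true) (popLoop Option.isSome .cnt
    (popCase .main (push (.aux j) false)
      (.seq (push (.aux j) true) (.seq (push .cnt true) (push .cnt true))))
    (popCase .main (push (.aux j) false)
      (.seq (push (.aux j) true) (.seq (push .cnt true) (push .cnt true)))))

theorem runs_unmove (j : Bool) (i : List InputSymbol) (l m : List Bool) (x : Bool → List Bool)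
    (c : List Bool) (hx : x j = l) : Runs (unmove j) (stk i m x c) (4 * l.length + 2)
      (stk i (l.reverse ++ m) (update x j []) c) := by
  induction l generalizing m x with
  | nil =>
      have := runs_popLoop_done (c := Option.isSome) (k := .aux j)
        (P := push .main false) (Q := push .main true) (S := stk i m x c) (by simp [hx])
      simpa [hx, unmove] using this
  | cons b l ih =>
      have h₁ := runs_push .main b (stk i m (update x j l) c)
      have h₂ := ih (b :: m) (update x j l) (by simp)
      refine (runs_popLoop_step (b := b) (l := l) (m := 1) (n := 4 * l.length + 2)
        (S' := stk i (b :: m) (update x j l) c) (by simp [hx]) rfl ?_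
        (by simpa [unmove] using h₂)).mono (by simp; omega)
      cases b <;> simpa using h₁

theorem runs_clear (j : Bool) (i : List InputSymbol) (l m : List Bool) (x : Bool → List Bool)
    (c : List Bool) (hx : x j = l) : Runs (clear j) (stk i m x c) (4 * l.length + 2)
      (stk i m (update x j []) c) := by
  induction l generalizing x with
  | nil =>
      have := runs_popLoop_done (c := Option.isSome) (k := .aux j)
        (P := skip) (Q := skip) (S := stk i m x c) (by simp [hx])
      simpa [hx, clear] using this
  | cons b l ih =>
      have h₁ := runs_skip (stk i m (update x j l) c)
      have h₂ := ih (update x j l) (by simp)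
      refine (runs_popLoop_step (b := b) (l := l) (m := 1) (n := 4 * l.length + 2)
        (S' := stk i m (update x j l) c) (by simp [hx]) rfl ?_
        (by simpa [clear] using h₂)).mono (by simp; omega)
      cases b <;> simpa using h₁

theorem runs_shift (j j' : Bool) (hj : j' ≠ j) (i : List InputSymbol) (l l' m : List Bool)
    (x : Bool → List Bool) (c : List Bool) (hx : x j = l) (hx' : x j' = l') :
    Runs (shift j j') (stk i m x c) (4 * l.length + 2)
      (stk i m (update (update x j []) j' (l.reverse ++ l')) c) := by
  induction l generalizing x l' with
  | nil =>
      have := runs_popLoop_done (c := Option.isSome) (k := .aux j)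
        (P := push (.aux j') false) (Q := push (.aux j') true) (S := stk i m x c) (by simp [hx])
      have h : update (update x j []) j' l' = update x j [] := by
        rw [update_eq_self_iff]; simp [hj, hx']
      simpa [hx, h, shift] using this
  | cons b l ih =>
      have h₁ := runs_push (.aux j') b (stk i m (update x j l) c)
      have h₂ := ih (b :: l') (update (update x j l) j' (b :: l')) (by simp [hj.symm]) (by simp)
      have e : ∀ u, update (update (update (update x j l) j' (b :: l')) j []) j' u
          = update (update x j []) j' u := fun u => by
        rw [update_comm hj, update_idem, update_idem]
      rw [e] at h₂
      refine (runs_popLoop_step (b := b) (l := l) (m := 1) (n := 4 * l.length + 2)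
        (S' := stk i m (update (update x j l) j' (b :: l')) c) (by simp [hx]) rfl ?_
        (by simpa [shift] using h₂)).mono (by simp; omega)
      cases b <;> simpa [hj, hx'] using h₁

theorem runs_unmoveCopy (j j' : Bool) (hj : j' ≠ j) (i : List InputSymbol) (l l' m : List Bool)
    (x : Bool → List Bool) (c : List Bool) (hx : x j = l) (hx' : x j' = l') :
    Runs (unmoveCopy j j') (stk i m x c) (5 * l.length + 2)
      (stk i (l.reverse ++ m) (update (update x j []) j' (l.reverse ++ l')) c) := by
  induction l generalizing x l' m with
  | nil =>
      have := runs_popLoop_done (c := Option.isSome) (k := .aux j)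
        (P := .seq (push .main false) (push (.aux j') false))
        (Q := .seq (push .main true) (push (.aux j') true)) (S := stk i m x c) (by simp [hx])
      have h : update (update x j []) j' l' = update x j [] := by
        rw [update_eq_self_iff]; simp [hj, hx']
      simpa [hx, h, unmoveCopy] using this
  | cons b l ih =>
      have h₁ := (runs_push .main b (stk i m (update x j l) c)).seq (runs_push (.aux j') b _)
      have h₂ := ih (b :: l') (b :: m) (update (update x j l) j' (b :: l')) (by simp [hj.symm])
        (by simp)
      have e : ∀ u, update (update (update (update x j l) j' (b :: l')) j []) j' u
          = update (update x j []) j' u := fun u => by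
        rw [update_comm hj, update_idem, update_idem]
      rw [e] at h₂
      refine (runs_popLoop_step (b := b) (l := l) (m := 2) (n := 5 * l.length + 2)
        (S' := stk i (b :: m) (update (update x j l) j' (b :: l')) c) (by simp [hx]) rfl ?_
        (by simpa [unmoveCopy] using h₂)).mono (by simp; omega)
      cases b <;> simpa [hj, hx'] using h₁

/-- Preorder is self-delimiting: the counter stack holds one mark for each subtree still to be read.
A leaf uses up a mark, a node replaces its mark by two, and the tree ends when no mark is left. -/
theorem runs_moveTree (j : Bool) (i : List InputSymbol) (t : BTree) (m : List Bool)
    (x : Bool → List Bool) (c : List Bool) (hc : c = []) :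
    Runs (moveTree j) (stk i (t.ser ++ m) x c) (8 * t.size + 3)
      (stk i m (update x j (t.ser.reverse ++ x j)) c) := by
  subst hc
  -- Continuation form: one mark pays for reading one tree, and `h` describes whatever the loop does
  -- afterwards. Hence the two children of a node can be chained.
  have key : ∀ (t : BTree) (m : List Bool) (x : Bool → List Bool) (c : List Bool) (n : ℕ)
      (S : ∀ k, List (Alphabet k)) (P : TProg), P = (popCase .main (push (.aux j) false)
      (.seq (push (.aux j) true) (.seq (push .cnt true) (push .cnt true)))) →
      Runs (popLoop Option.isSome .cnt P P)
        (stk i m (update x j (t.ser.reverse ++ x j)) c) n S →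
      Runs (popLoop Option.isSome .cnt P P) (stk i (t.ser ++ m) x (true :: c))
        (n + 8 * t.size) S := by
    intro t
    induction t with
    | leaf =>
        intro m x c n S P hP h
        refine (runs_popLoop_step (b := true) (l := c) rfl rfl (m := 3) ?_ h).mono
          (by simp [BTree.size]; omega)
        rw [hP]
        refine runs_popCase (b := false) (l := m) (by simp [BTree.ser]) (n := 1) ?_
        simpa [BTree.ser] using runs_push (.aux j) false (stk i m x c)
    | node l r hl hr =>
        intro m x c n S P hP h
        have h₁ := hl (r.ser ++ m) (update x j (true :: x j)) (true :: c) _ S P hP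
          (hr m _ c n S P hP (by simpa [BTree.ser] using h))
        refine (runs_popLoop_step (b := true) (l := c) rfl rfl (m := 5) ?_ h₁).mono
          (by simp [BTree.size]; omega)
        rw [hP]
        refine runs_popCase (b := true) (l := l.ser ++ r.ser ++ m) (by simp [BTree.ser])
          (n := 3) ?_
        have := ((runs_push (.aux j) true (stk i (l.ser ++ r.ser ++ m) x c)).seq
          ((runs_push .cnt true _).seq (runs_push .cnt true _)))
        simpa [BTree.ser] using this
  refine ((runs_push .cnt true _).seq (n := 2 + 8 * t.size) (S'' := stk i m
    (update x j (t.ser.reverse ++ x j)) []) ?_).mono (by omega)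
  have := key t m x [] 2 (stk i m (update x j (t.ser.reverse ++ x j)) []) _ rfl
    (by simpa using runs_popLoop_done (c := Option.isSome) (k := .cnt)
          (S := stk i m (update x j (t.ser.reverse ++ x j)) []) rfl)
  simpa using this

/-- The stacks when only the main stack is in use. -/
def mainOnly (m : List Bool) : ∀ k, List (Alphabet k) := stk [] m (fun _ => []) []

theorem Runs.conv {P : TProg} {m m' k k' : List Bool} {n n' : ℕ}
    (h : Runs P (mainOnly m) n (mainOnly m')) (hm : m = k) (hm' : m' = k') (hn : n ≤ n') :
    Runs P (mainOnly k) n' (mainOnly k') := by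
  subst hm hm'
  exact h.mono hn

theorem runs_pushOnly (b : Bool) (m : List Bool) :
    Runs (push .main b) (mainOnly m) 1 (mainOnly (b :: m)) := by
  simpa [mainOnly] using runs_push .main b (mainOnly m)

theorem runs_popOnly (b : Bool) (m : List Bool) :
    Runs (pop .main) (mainOnly (b :: m)) 1 (mainOnly m) := by
  simpa [mainOnly] using runs_pop .main (mainOnly (b :: m))

theorem runs_popCaseOnly {P Q : TProg} (b : Bool) {m m' : List Bool} {n : ℕ}
    (h : Runs (if b then Q else P) (mainOnly m) n (mainOnly m')) :
    Runs (popCase .main P Q) (mainOnly (b :: m)) (n + 2) (mainOnly m') :=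
  runs_popCase (l := m) rfl (by simpa [mainOnly] using h)

/-- Delete the tree on top of the main stack. -/
def drop : TProg := .seq (moveTree false) (clear false)

/-- Duplicate the tree on top of the main stack. -/
def dup : TProg :=
  .seq (moveTree false) (.seq (unmoveCopy false true) (.seq (shift true false) (unmove false)))

/-- Swap the two trees on top of the main stack. -/
def swap : TProg :=
  .seq (moveTree false) (.seq (moveTree true) (.seq (unmove false) (unmove true)))

theorem update_const_nil (j : Bool) : update (fun _ : Bool => ([] : List Bool)) j [] = fun _ => [] :=
  update_eq_self j _

theorem runs_drop (t : BTree) (m : List Bool) :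
    Runs drop (mainOnly (t.ser ++ m)) (12 * t.size + 5) (mainOnly m) := by
  have h := (runs_moveTree false [] t m (fun _ => []) [] rfl).seq
    (runs_clear false [] t.ser.reverse m _ [] (by simp))
  simp only [update_idem, update_const_nil, List.length_reverse, BTree.length_ser] at h
  exact h.mono (by omega)

theorem runs_dup (t : BTree) (m : List Bool) :
    Runs dup (mainOnly (t.ser ++ m)) (21 * t.size + 9) (mainOnly (t.ser ++ (t.ser ++ m))) := by
  have h := (runs_moveTree false [] t m (fun _ => []) [] rfl).seq
    ((runs_unmoveCopy false true (by simp) [] t.ser.reverse [] m _ [] (by simp) (by simp)).seq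
    ((runs_shift true false (by simp) [] t.ser [] _ _ [] (by simp) (by simp)).seq
    (runs_unmove false [] t.ser.reverse _ _ [] (by simp))))
  simp [update_idem] at h
  exact h.mono (by omega)

theorem runs_swap (t u : BTree) (m : List Bool) :
    Runs swap (mainOnly (t.ser ++ (u.ser ++ m))) (12 * (t.size + u.size) + 10)
      (mainOnly (u.ser ++ (t.ser ++ m))) := by
  have h := (runs_moveTree false [] t (u.ser ++ m) (fun _ => []) [] rfl).seq
    ((runs_moveTree true [] u m _ [] rfl).seq
    ((runs_unmove false [] t.ser.reverse _ _ [] (by simp)).seq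
    (runs_unmove true [] u.ser.reverse _ _ [] (by simp))))
  simp [update_idem, update_comm (show true ≠ false by simp)] at h
  exact h.mono (by omega)

/-- Pair the first and the third tree on the main stack, and put the second one below. -/
def pairOver : TProg := .seq swap (.seq (.seq (moveTree false)
  (.seq (push .main true) (unmove false))) swap)

theorem runs_pushMain (b : Bool) (i : List InputSymbol) (m : List Bool) (x : Bool → List Bool)
    (c : List Bool) : Runs (push .main b) (stk i m x c) 1 (stk i (b :: m) x c) := by
  simpa using runs_push .main b (stk i m x c)

theorem runs_pairOver (t u v : BTree) (m : List Bool) :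
    Runs pairOver (mainOnly (t.ser ++ (u.ser ++ (v.ser ++ m))))
      (40 * (t.size + u.size + v.size) + 80)
      (mainOnly ((BTree.node t v).ser ++ (u.ser ++ m))) := by
  have h := (runs_moveTree false [] u (t.ser ++ (v.ser ++ m)) (fun _ => []) [] rfl).seq
    ((runs_pushMain true _ _ _ _).seq (runs_unmove false [] u.ser.reverse _ _ [] (by simp)))
  simp only [update_idem, update_const_nil, List.length_reverse, BTree.length_ser,
    List.reverse_reverse, List.append_nil] at h
  refine ((runs_swap t u (v.ser ++ m)).seq (Runs.seq h
    (by simpa [mainOnly, BTree.ser] using runs_swap u (.node t v) m))).mono ?_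
  simp [BTree.size]
  omega

end StackProgram

/-! ### Polynomial-time functions between tree-encoded types -/

/-- An encoding of a type by binary trees. -/
class TreeEnc (α : Type) where
  /-- The tree that encodes an element. -/
  enc : α → BTree

namespace TreeEnc

instance : TreeEnc BTree := ⟨id⟩

instance : TreeEnc Unit := ⟨fun _ => .leaf⟩

/-- Both values have five symbols, so changing a Boolean never changes a size; folds with growth
bound zero rely on this. The second symbol of the serialization tells the values apart. -/
instance : TreeEnc Bool :=
  ⟨fun b => bif b then .node (.node .leaf .leaf) .leaf else .node .leaf (.node .leaf .leaf)⟩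

instance {α β : Type} [TreeEnc α] [TreeEnc β] : TreeEnc (α × β) :=
  ⟨fun p => .node (enc p.1) (enc p.2)⟩

instance {α : Type} [TreeEnc α] : TreeEnc (List α) :=
  ⟨fun l => l.foldr (fun a t => .node (enc a) t) .leaf⟩

section

variable {α β : Type} [TreeEnc α] [TreeEnc β]

@[simp] theorem enc_btree (t : BTree) : enc t = t := rfl
@[simp] theorem enc_true : enc true = .node (.node .leaf .leaf) .leaf := rfl
@[simp] theorem enc_false : enc false = .node .leaf (.node .leaf .leaf) := rfl
@[simp] theorem enc_pair (p : α × β) : enc p = .node (enc p.1) (enc p.2) := rfl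
@[simp] theorem enc_nil : enc ([] : List α) = .leaf := rfl
@[simp] theorem enc_cons (a : α) (l : List α) : enc (a :: l) = .node (enc a) (enc l) := rfl

/-- The size of the encoding of an element. -/
def sz (a : α) : ℕ := (enc a).size

theorem sz_pos (a : α) : 0 < sz a := BTree.size_pos _

@[simp] theorem sz_pair (p : α × β) : sz p = sz p.1 + sz p.2 + 1 := rfl
@[simp] theorem sz_nil : sz ([] : List α) = 1 := rfl
@[simp] theorem sz_cons (a : α) (l : List α) : sz (a :: l) = sz a + sz l + 1 := rfl
@[simp] theorem sz_unit (u : Unit) : sz u = 1 := rfl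
@[simp] theorem sz_bool (b : Bool) : sz b = 5 := by cases b <;> simp [sz, BTree.size]

theorem sz_append (l l' : List α) : sz (l ++ l') + 1 = sz l + sz l' := by
  induction l with
  | nil => simp; omega
  | cons a l ih => simp; omega

theorem length_lt_sz (l : List α) : l.length < sz l := by
  induction l with
  | nil => simp
  | cons a l ih => simp; omega

theorem sz_le_of_mem {l : List α} {a : α} (h : a ∈ l) : sz a < sz l := by
  induction l with
  | nil => simp at h
  | cons b l ih =>
      rcases List.mem_cons.1 h with rfl | h
      · simp only [sz_cons]; omega
      · have := ih h; simp; omega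

theorem sz_le_of_forall {l : List α} {k : ℕ} (h : ∀ a ∈ l, sz a ≤ k) :
    sz l ≤ l.length * (k + 1) + 1 := by
  induction l with
  | nil => simp
  | cons b l ih =>
      have h₁ := h b (by simp)
      have h₂ := ih fun a ha => h a (by simp [ha])
      simp only [sz_cons, List.length_cons, Nat.add_mul]
      omega

end

end TreeEnc

theorem Polynomial.eval_mono_nat (q : Polynomial ℕ) {m n : ℕ} (h : m ≤ n) :
    q.eval m ≤ q.eval n := by
  rw [Polynomial.eval_eq_sum_range, Polynomial.eval_eq_sum_range]
  gcongr

open TreeEnc StackProgram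

/-- `f` is computed in polynomial time by a program that replaces the encoding of its argument on
top of the main stack by the encoding of its value. -/
def PolyFun {α β : Type} [TreeEnc α] [TreeEnc β] (f : α → β) : Prop :=
  ∃ (P : TProg) (q : Polynomial ℕ), ∀ (x : α) (m : List Bool),
    Runs P (mainOnly ((enc x).ser ++ m)) (q.eval (sz x)) (mainOnly ((enc (f x)).ser ++ m))

namespace PolyFun

variable {α β γ δ : Type} [TreeEnc α] [TreeEnc β] [TreeEnc γ] [TreeEnc δ]

/-- The value is left on the stack after polynomially many steps, each of which pushes at most one
symbol. -/
theorem exists_size_le {f : α → β} (hf : PolyFun f) :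
    ∃ q : Polynomial ℕ, ∀ x, sz (f x) ≤ q.eval (sz x) := by
  obtain ⟨P, q, h⟩ := hf
  refine ⟨Polynomial.X + q, fun x => ?_⟩
  have := (h x []).length_le (some .main)
  simpa [mainOnly, sz] using this

/-- Programs see encodings only, so a function may be replaced by any other that acts in the same
way on the encoding trees. This turns tree operations into list and number operations without new
programs. -/
theorem congr_enc {α' β' : Type} [TreeEnc α'] [TreeEnc β'] {f : α → β} (hf : PolyFun f)
    {g : α' → β'} (e : α' → α) (he : ∀ y, enc (e y) = enc y)
    (hg : ∀ y, enc (f (e y)) = enc (g y)) : PolyFun g := by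
  obtain ⟨P, q, h⟩ := hf
  refine ⟨P, q, fun x m => ?_⟩
  have := h (e x) m
  rwa [hg, he, sz, he] at this

theorem id : PolyFun (fun x : α => x) := ⟨skip, 1, fun _ _ => by simpa using runs_skip _⟩

theorem comp {g : β → γ} {f : α → β} (hg : PolyFun g) (hf : PolyFun f) :
    PolyFun fun x => g (f x) := by
  obtain ⟨s, hs⟩ := hf.exists_size_le
  obtain ⟨P, q, h⟩ := hf
  obtain ⟨P', q', h'⟩ := hg
  refine ⟨.seq P P', q + q'.comp s, fun x m => ((h x m).seq (h' (f x) m)).mono ?_⟩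
  simp only [Polynomial.eval_add, Polynomial.eval_comp]
  exact Nat.add_le_add_left (q'.eval_mono_nat (hs x)) _

theorem pair {f : α → β} {g : α → γ} (hf : PolyFun f) (hg : PolyFun g) :
    PolyFun fun x => (f x, g x) := by
  obtain ⟨s, hs⟩ := hf.exists_size_le
  obtain ⟨s', hs'⟩ := hg.exists_size_le
  obtain ⟨P, q, h⟩ := hf
  obtain ⟨P', q', h'⟩ := hg
  refine ⟨.seq dup (.seq P (.seq swap (.seq P' (.seq swap (push .main true))))),
    21 * Polynomial.X + 9 + q + (12 * (s + Polynomial.X) + 10) + q' + (12 * (s' + s) + 10) + 1,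
    fun x m => ((runs_dup (enc x) m).seq ((h x _).seq ((runs_swap _ _ _).seq ((h' x _).seq
      ((runs_swap _ _ _).seq (runs_pushOnly true _)))))).conv rfl (by simp [BTree.ser]) ?_⟩
  have h₁ := hs x
  have h₂ := hs' x
  simp only [sz] at h₁ h₂ ⊢
  simp
  omega

theorem fst : PolyFun (Prod.fst : α × β → α) := by
  refine ⟨popCase .main skip (.seq swap drop), 24 * Polynomial.X + 20, fun x m =>
    (runs_popCaseOnly true ((runs_swap (enc x.1) (enc x.2) m).seq (runs_drop _ _))).conv
      (by simp [BTree.ser]) rfl ?_⟩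
  simp [sz, BTree.size]
  omega

theorem snd : PolyFun (Prod.snd : α × β → β) := by
  refine ⟨popCase .main skip drop, 24 * Polynomial.X + 20, fun x m =>
    (runs_popCaseOnly true (runs_drop (enc x.1) ((enc x.2).ser ++ m))).conv
      (by simp [BTree.ser]) rfl ?_⟩
  simp [sz, BTree.size]
  omega

/-- Remove the encoding of a Boolean from the main stack and branch on it. -/
def boolCase (P Q : TProg) : TProg :=
  .seq (pop .main) (popCase .main (.seq (pop .main) (.seq (pop .main) (.seq (pop .main) P)))
    (.seq (pop .main) (.seq (pop .main) (.seq (pop .main) Q))))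

theorem runs_boolCase {P Q : TProg} (b : Bool) {m m' : List Bool} {n : ℕ}
    (h : Runs (bif b then Q else P) (mainOnly m) n (mainOnly m')) :
    Runs (boolCase P Q) (mainOnly ((enc b).ser ++ m)) (n + 6) (mainOnly m') := by
  cases b with
  | false =>
      exact ((runs_popOnly true _).seq (runs_popCaseOnly false ((runs_popOnly true _).seq
        ((runs_popOnly false _).seq ((runs_popOnly false _).seq h))))).conv rfl rfl (by omega)
  | true =>
      exact ((runs_popOnly true _).seq (runs_popCaseOnly true ((runs_popOnly false _).seq
        ((runs_popOnly false _).seq ((runs_popOnly false _).seq h))))).conv rfl rfl (by omega)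

/-- Push a word on the main stack. -/
def pushMain (w : List Bool) : TProg :=
  w.foldr (fun b P => .seq P (push .main b)) skip

theorem runs_pushMain (w m : List Bool) :
    Runs (pushMain w) (mainOnly m) (w.length + 1) (mainOnly (w ++ m)) := by
  induction w with
  | nil => exact runs_skip _
  | cons b w ih => exact ih.seq (runs_pushOnly b _)

theorem const (b : β) : PolyFun fun _ : α => b := by
  refine ⟨.seq drop (pushMain (enc b).ser), 12 * Polynomial.X + Polynomial.C (6 + (enc b).size),
    fun x m => ?_⟩
  refine ((runs_drop (enc x) m).seq (runs_pushMain _ m)).mono ?_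
  simp [sz]
  omega

theorem cond {c : α → Bool} {f g : α → β} (hc : PolyFun c) (hf : PolyFun f) (hg : PolyFun g) :
    PolyFun fun x => bif c x then f x else g x := by
  obtain ⟨P, q, h⟩ := hc
  obtain ⟨P', q', h'⟩ := hf
  obtain ⟨P'', q'', h''⟩ := hg
  refine ⟨.seq (.seq dup P) (boolCase P'' P'), 21 * Polynomial.X + 9 + q + q' + q'' + 6,
    fun x m => ?_⟩
  refine (((runs_dup (enc x) m).seq (h x _)).seq (runs_boolCase (n := q'.eval (sz x)
    + q''.eval (sz x)) (m' := (enc (bif c x then f x else g x)).ser ++ m) (c x) ?_)).mono ?_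
  · cases c x with
    | false => exact (h'' x m).mono (by omega)
    | true => exact (h' x m).mono (by omega)
  · simp [sz]
    omega

theorem ite {p : α → Prop} [DecidablePred p] {f g : α → β} (hp : PolyFun fun x => decide (p x))
    (hf : PolyFun f) (hg : PolyFun g) : PolyFun fun x => if p x then f x else g x := by
  have := hp.cond hf hg
  simpa only [Bool.cond_decide] using this

theorem isNode : PolyFun fun t : BTree => (match t with | .leaf => false | .node _ _ => true) := by
  refine ⟨popCase .main (pushMain (enc false).ser) (.seq drop (.seq drop
    (pushMain (enc true).ser))), 24 * Polynomial.X + 20, fun t m => ?_⟩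
  cases t with
  | leaf =>
      refine (runs_popCaseOnly false (runs_pushMain (enc false).ser m)).conv rfl rfl ?_
      simp [BTree.size]
  | node l r =>
      refine (runs_popCaseOnly true ((runs_drop l _).seq ((runs_drop r m).seq
        (runs_pushMain (enc true).ser m)))).conv (by simp [BTree.ser]) rfl ?_
      simp [sz, BTree.size]
      omega

/-- The left subtree. -/
def left : BTree → BTree
  | .leaf => .leaf
  | .node l _ => l

/-- The right subtree. -/
def right : BTree → BTree
  | .leaf => .leaf
  | .node _ r => r

theorem polyFun_left : PolyFun left := by
  refine ⟨popCase .main (push .main false) (.seq swap drop), 24 * Polynomial.X + 20,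
    fun t m => ?_⟩
  cases t with
  | leaf =>
      refine (runs_popCaseOnly false (runs_pushOnly false m)).conv rfl rfl ?_
      simp
  | node l r =>
      refine (runs_popCaseOnly true ((runs_swap l r m).seq (runs_drop _ _))).conv
        (by simp [BTree.ser]) rfl ?_
      simp [sz, BTree.size]
      omega

theorem polyFun_right : PolyFun right := by
  refine ⟨popCase .main (push .main false) drop, 24 * Polynomial.X + 20, fun t m => ?_⟩
  cases t with
  | leaf =>
      refine (runs_popCaseOnly false (runs_pushOnly false m)).conv rfl rfl ?_
      simp
  | node l r =>
      refine (runs_popCaseOnly true (runs_drop l (r.ser ++ m))).conv (by simp [BTree.ser]) (by simp [right]) ?_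
      simp [sz, BTree.size]
      omega

theorem toTree {f : α → β} (hf : PolyFun f) : PolyFun fun x => enc (f x) :=
  hf.congr_enc (fun x => x) (fun _ => rfl) fun _ => rfl

theorem cons {f : α → β} {g : α → List β} (hf : PolyFun f) (hg : PolyFun g) :
    PolyFun fun x => f x :: g x :=
  (hf.pair hg).congr_enc (fun x => x) (fun _ => rfl) fun _ => rfl

theorem tail {f : α → List β} (hf : PolyFun f) : PolyFun fun x => (f x).tail :=
  (polyFun_right.comp hf.toTree).congr_enc (fun x => x) (fun _ => rfl) fun x => by
    cases f x <;> rfl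

theorem isEmpty {f : α → List β} (hf : PolyFun f) : PolyFun fun x => (f x).isEmpty :=
  ((isNode.comp hf.toTree).cond (const false) (const true)).congr_enc (fun x => x)
    (fun _ => rfl) fun x => by cases f x <;> rfl

theorem headD {f : α → List β} {d : α → β} (hf : PolyFun f) (hd : PolyFun d) :
    PolyFun fun x => (f x).headD (d x) :=
  (hf.isEmpty.cond hd.toTree (polyFun_left.comp hf.toTree)).congr_enc (fun x => x)
    (fun _ => rfl) fun x => by cases f x <;> rfl

/-! ### Folds with polynomially bounded intermediate results -/

/-- A left fold over a list whose intermediate results stay polynomially bounded. -/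
theorem foldl_of_bounded {f : β → γ → β} {l : α → List γ} {b : α → β}
    (hf : PolyFun fun p : γ × β => f p.2 p.1) (hl : PolyFun l) (hb : PolyFun b)
    (B : Polynomial ℕ)
    (hB : ∀ x l', l' <+: l x → sz (l'.foldl f (b x)) ≤ B.eval (sz x)) :
    PolyFun fun x => (l x).foldl f (b x) := by
  obtain ⟨s, hs⟩ := hl.exists_size_le
  obtain ⟨P, q, h⟩ := hf
  obtain ⟨P', q', h'⟩ := hl.pair hb
  -- Loop invariant: the remaining list lies above the current value. The loop pops the first symbol
  -- of the list, which is `true` for a cons cell and `false` for the end. `pairOver` brings the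
  -- head next to the value, and `swap` restores the order.
  have key : ∀ (W : ℕ) (l : List γ) (b : β) (m : List Bool), sz l ≤ W →
      (∀ l', l' <+: l → sz (l'.foldl f b) ≤ W) →
      Runs (popLoop (fun o => o == some true) .main skip (.seq pairOver (.seq P swap)))
        (mainOnly ((enc l).ser ++ ((enc b).ser ++ m)))
        (l.length * (200 * W + 200 + q.eval (2 * W + 1)) + 2)
        (mainOnly ((enc (l.foldl f b)).ser ++ m)) := by
    intro W l
    induction l with
    | nil =>
        intro b m _ _
        simpa [mainOnly, BTree.ser] using runs_popLoop_done (c := fun o => o == some true)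
          (k := .main) (P := skip) (Q := .seq pairOver (.seq P swap))
          (S := mainOnly (false :: ((enc b).ser ++ m))) rfl
    | cons a l ih =>
        intro b m hW hl
        have h₀ := hl [] (by simp)
        have h₁ := hl [a] (by simp)
        simp only [List.foldl_nil, List.foldl_cons, sz_cons] at h₀ h₁ hW
        have h₂ := ih (f b a) m (by omega) fun l' hl' =>
          hl (a :: l') ((List.prefix_cons_inj a).2 hl')
        have h₁' := (runs_pairOver (enc a) (enc l) (enc b) m).seq
            ((h (a, b) _).seq (runs_swap (enc (f b a)) (enc l) m))
        refine (runs_popLoop_step (b := true) (S := mainOnly ((enc (a :: l)).ser ++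
            ((enc b).ser ++ m)))
          (l := (enc a).ser ++ ((enc l).ser ++ ((enc b).ser ++ m)))
          (by simp [mainOnly, BTree.ser]) rfl
          (by simpa [mainOnly] using h₁') h₂).mono ?_
        have h₃ : q.eval (sz a + sz b + 1) ≤ q.eval (2 * W + 1) := q.eval_mono_nat (by omega)
        simp only [List.length_cons, Nat.add_mul, one_mul]
        simp only [sz] at *
        omega
  refine ⟨.seq P' (.seq (pop .main)
    (popLoop (fun o => o == some true) .main skip (.seq pairOver (.seq P swap)))),
    q' + 1 + (s * (200 * (B + s) + 200 + q.comp (2 * (B + s) + 1)) + 2), fun x m => ?_⟩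
  have h₁ := runs_popOnly true ((enc (l x)).ser ++ ((enc (b x)).ser ++ m))
  refine ((h' x m).seq (Runs.seq (by simpa [BTree.ser] using h₁)
    (key (B.eval (sz x) + s.eval (sz x)) (l x) (b x) m ?_ ?_))).mono ?_
  · exact (hs x).trans (Nat.le_add_left _ _)
  · exact fun l' hl' => (hB x l' hl').trans (Nat.le_add_right _ _)
  · have := (length_lt_sz (l x)).le.trans (hs x)
    simp only [Polynomial.eval_add, Polynomial.eval_mul, Polynomial.eval_comp, Polynomial.eval_one,
      Polynomial.eval_ofNat]
    have := Nat.mul_le_mul_right (200 * (B.eval (sz x) + s.eval (sz x)) + 200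
      + q.eval (2 * (B.eval (sz x) + s.eval (sz x)) + 1)) this
    omega

/-- A left fold with parameters over a list, where each step adds to the size of the intermediate
result an amount that does not depend on the intermediate result. -/
theorem foldl {f : α → β → γ → β} {l : α → List γ} {b : α → β}
    (hf : PolyFun fun p : α × β × γ => f p.1 p.2.1 p.2.2) (hl : PolyFun l) (hb : PolyFun b)
    (q : Polynomial ℕ) (hq : ∀ x b c, sz (f x b c) ≤ sz b + q.eval (sz x + sz c)) :
    PolyFun fun x => (l x).foldl (f x) (b x) := by
  obtain ⟨s, hs⟩ := hl.exists_size_le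
  obtain ⟨s', hs'⟩ := hb.exists_size_le
  -- The parameter travels with the accumulator, which reduces the claim to a fold without
  -- parameters.
  have e : ∀ (x : α) (l : List γ) (b : β),
      l.foldl (fun (y : α × β) c => (y.1, f y.1 y.2 c)) (x, b) = (x, l.foldl (f x) b) := by
    intro x l
    induction l with
    | nil => intro b; rfl
    | cons a l ih => intro b; simp [ih]
  have hstep : PolyFun fun p : γ × (α × β) => (p.2.1, f p.2.1 p.2.2 p.1) :=
    (fst.comp snd).pair (hf.comp ((fst.comp snd).pair ((snd.comp snd).pair fst)))
  have := foldl_of_bounded (f := fun (y : α × β) c => (y.1, f y.1 y.2 c)) hstep hl (id.pair hb)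
    (Polynomial.X + 1 + s' + s * q.comp (Polynomial.X + s)) ?_
  · refine (snd.comp this).congr_enc (fun x => x) (fun _ => rfl) fun x => ?_
    simp only [e]
  · intro x l' hl'
    -- The growth of a step does not depend on the accumulator, so growths add up over the list. A
    -- factor in each step could compound to exponential size.
    have h₁ : ∀ (l' : List γ) (b : β) (k : ℕ), (∀ c ∈ l', sz c ≤ k) →
        sz (l'.foldl (f x) b) ≤ sz b + l'.length * q.eval (sz x + k) := by
      intro l'
      induction l' with
      | nil => intro b k _; simp
      | cons a l ih =>
          intro b k hk
          have h₁ := ih (f x b a) k fun c hc => hk c (by simp [hc])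
          have h₂ := hq x b a
          have h₃ : q.eval (sz x + sz a) ≤ q.eval (sz x + k) :=
            q.eval_mono_nat (Nat.add_le_add_left (hk a (by simp)) _)
          simp only [List.foldl_cons, List.length_cons, Nat.add_mul, one_mul]
          omega
    have h₂ := h₁ l' (b x) (s.eval (sz x)) fun c hc =>
      (sz_le_of_mem (hl'.subset hc)).le.trans (hs x)
    have h₃ : l'.length ≤ s.eval (sz x) :=
      hl'.length_le.trans ((length_lt_sz (l x)).le.trans (hs x))
    have h₄ := Nat.mul_le_mul_right (q.eval (sz x + s.eval (sz x))) h₃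
    have h₅ := hs' x
    rw [e]
    simp only [Polynomial.eval_add, Polynomial.eval_mul, Polynomial.eval_comp, Polynomial.eval_one,
      Polynomial.eval_X, sz_pair]
    omega

theorem eq_tree (t : BTree) : PolyFun fun u : BTree => decide (u = t) := by
  induction t with
  | leaf =>
      exact (isNode.cond (const (β := Bool) false) (const true)).congr_enc (fun x => x)
        (fun _ => rfl) fun x => by cases x <;> rfl
  | node l r hl hr =>
      refine (isNode.cond ((hl.comp polyFun_left).cond (hr.comp polyFun_right)
        (const false)) (const false)).congr_enc (fun x => x) (fun _ => rfl) fun x => ?_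
      cases x with
      | leaf => rfl
      | node l' r' =>
          congr 1
          by_cases h : l' = l <;> by_cases h' : r' = r <;> simp [left, right, h, h']

/-- Every function on a finite type is computable in polynomial time. -/
theorem of_finite [Finite α] (hα : Function.Injective (enc : α → BTree)) (f : α → β) :
    PolyFun f := by
  classical
  rcases isEmpty_or_nonempty α with h | ⟨⟨a₀⟩⟩
  · exact ⟨skip, 0, fun x => h.elim x⟩
  cases nonempty_fintype α
  -- Table lookup: the listed arguments are compared with the input one after the other.
  have key : ∀ l : List α, ∃ g : α → β, PolyFun g ∧ ∀ a ∈ l, g a = f a := by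
    intro l
    induction l with
    | nil => exact ⟨_, const (f a₀), by simp⟩
    | cons a l ih =>
        obtain ⟨g, hg, hgl⟩ := ih
        refine ⟨_, ((eq_tree (enc a)).comp id.toTree).ite (const (f a)) hg, fun b hb => ?_⟩
        by_cases h : b = a
        · simp [h]
        · have : enc b ≠ enc a := fun h' => h (hα h')
          simp [this, hgl b (by simpa [h] using hb)]
  obtain ⟨g, hg, hgl⟩ := key Finset.univ.toList
  have : g = f := funext fun a => hgl a (by simp)
  exact this ▸ hg

end PolyFun

/-! ### From polynomial-time functions to Turing machines -/

open TreeEnc StackProgram Function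

instance : TreeEnc HazingSymbol :=
  ⟨fun s => match s with
    | .bit b => .node .leaf (enc b)
    | .minus => .leaf
    | .sep => .node (.node .leaf .leaf) .leaf⟩

instance {α β : Type} [TreeEnc α] [TreeEnc β] : TreeEnc (α ⊕ β) :=
  ⟨Sum.elim (fun a => .node .leaf (enc a)) fun b => .node (.node .leaf .leaf) (enc b)⟩

theorem enc_hazingSymbol_injective : Injective (enc : HazingSymbol → BTree) := by
  rintro (⟨_ | _⟩ | _ | _) (⟨_ | _⟩ | _ | _) h <;> first | rfl | simp [enc] at h

theorem enc_sum_injective {α β : Type} [TreeEnc α] [TreeEnc β] (hα : Injective (enc : α → BTree))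
    (hβ : Injective (enc : β → BTree)) : Injective (enc : α ⊕ β → BTree) := by
  rintro (a | a) (b | b) h
  · simp only [enc, Sum.elim_inl, BTree.node.injEq, true_and] at h
    rw [hα h]
  · simp [enc] at h
  · simp [enc] at h
  · simp only [enc, Sum.elim_inr, BTree.node.injEq, true_and] at h
    rw [hβ h]

/-- All symbols. -/
def hazingSymbols : List HazingSymbol := [.bit false, .bit true, .minus, .sep]

theorem mem_hazingSymbols (s : HazingSymbol) : s ∈ hazingSymbols := by
  rcases s with (_ | _) | _ | _ <;> simp [hazingSymbols]

instance : Finite HazingSymbol :=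
  Set.finite_univ_iff.1 ((hazingSymbols.finite_toSet).subset fun s _ => mem_hazingSymbols s)

namespace StackProgram

open Turing Turing.TM2

/-- All input symbols. -/
def inputSymbols : List InputSymbol := hazingSymbols.map Sum.inl ++ hazingSymbols.map Sum.inr

theorem mem_inputSymbols (s : InputSymbol) : s ∈ inputSymbols := by
  rcases s with s | s <;> simp [inputSymbols, mem_hazingSymbols]

theorem sz_inputSymbol_le (s : InputSymbol) : sz s ≤ 11 := by
  rcases s with ((_ | _) | _ | _) | ((_ | _) | _ | _) <;> simp [sz, enc, BTree.size]

/-- Push a word on the first auxiliary stack. -/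
def pushWord (w : List Bool) : TProg :=
  w.foldr (fun b P => .seq (push (.aux false) b) P) skip

theorem exec_pushWord (w : List Bool) (v : Var) (i : List InputSymbol) (m : List Bool)
    (x : Bool → List Bool) (c : List Bool) : Exec (pushWord w) v (stk i m x c) (w.length + 1) v
      (stk i m (update x false (w.reverse ++ x false)) c) := by
  induction w generalizing x with
  | nil => simpa [pushWord, skip] using Exec.load (Γ := Alphabet) id v (stk i m x c)
  | cons b w ih =>
      have h := Exec.push (Γ := Alphabet) (some (.aux false)) (fun _ : Var => b) v (stk i m x c)
      simp only [update_stk_aux, stk_aux] at h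
      have := h.seq (ih _)
      simpa [pushWord, push] using this

open Classical in
/-- Push the serialization of the last input symbol, preceded by a list node. -/
noncomputable def pushSymbol (l : List InputSymbol) : TProg :=
  l.foldr (fun s P => .ite (fun v => decide (v.2 = some s)) (pushWord (true :: (enc s).ser)) P) skip

theorem exec_pushSymbol (l : List InputSymbol) (s : InputSymbol) (hs : s ∈ l) (v : Var)
    (hv : v.2 = some s) (i : List InputSymbol) (m : List Bool) (x : Bool → List Bool)
    (c : List Bool) : ∃ n, n ≤ l.length + 13 ∧ Exec (pushSymbol l) v (stk i m x c) n v
      (stk i m (update x false ((true :: (enc s).ser).reverse ++ x false)) c) := by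
  induction l with
  | nil => simp at hs
  | cons s' l ih =>
      by_cases h : s = s'
      · subst h
        refine ⟨_, ?_, .ite_true (by simp [hv]) (exec_pushWord _ v i m x c)⟩
        have := sz_inputSymbol_le s
        simp only [sz] at this
        simp
        omega
      · obtain ⟨n, hn, he⟩ := ih (by simpa [h] using hs)
        exact ⟨n + 1, by simp; omega, .ite_false (by simp [hv, h]) he⟩

/-- Pop an input symbol. -/
def popInput : TProg := .pop none fun v s => (v.1, s)

/-- Put the tree encoding of the input on the main stack. -/
noncomputable def readInput : TProg :=
  .seq (.seq popInput (.loop (fun v => v.2.isSome) (.seq (pushSymbol inputSymbols) popInput)))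
    (.seq (push (.aux false) false) (unmove false))

/-- The head of the remaining input already sits in the local variable. The word `w` lacks the final
`false`, the empty list at the end of the serialization, which `readInput` pushes after the loop. -/
theorem exec_readLoop (l : List InputSymbol) (v : Var) (m : List Bool) (x : Bool → List Bool)
    (c : List Bool) : ∃ v' n w, n ≤ 23 * l.length + 1 ∧ false :: w = (enc l).ser.reverse ∧
      Exec (.loop (fun v => v.2.isSome) (.seq (pushSymbol inputSymbols) popInput))
      (v.1, l.head?) (stk l.tail m x c) n v' (stk [] m (update x false (w ++ x false)) c) := by
  induction l generalizing v x with
  | nil => exact ⟨_, 1, [], by simp, rfl, by simpa using Exec.loop_done rfl⟩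
  | cons s l ih =>
      obtain ⟨n, hn, he⟩ := exec_pushSymbol inputSymbols s (mem_inputSymbols s)
        (v.1, some s) rfl l m x c
      obtain ⟨v', n', w, hn', hw, he'⟩ := ih (v.1, some s)
        (update x false ((true :: (enc s).ser).reverse ++ x false))
      have hp := Exec.pop (Γ := Alphabet) none (fun (v : Var) s => (v.1, s)) (v.1, some s)
        (stk l m (update x false ((true :: (enc s).ser).reverse ++ x false)) c)
      simp only [stk_none, update_stk_none] at hp
      refine ⟨v', n' + (1 + n) + 1, w ++ (true :: (enc s).ser).reverse, ?_, ?_, ?_⟩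
      rotate_left 2
      · have := Exec.loop_step (p := fun v : Var => v.2.isSome) (v := (v.1, some s)) rfl
          (he.seq hp) he'
        simpa [popInput] using this
      · simp [inputSymbols, hazingSymbols] at hn ⊢
        omega
      · simp only [enc_cons, BTree.ser, List.reverse_cons, List.reverse_append, ← hw]
        simp

theorem runs_readInput (l : List InputSymbol) :
    Runs readInput (stk l [] (fun _ => []) []) (40 * sz l + 40) (mainOnly (enc l).ser) := by
  have h₁ : Runs (.seq popInput (.loop (fun v => v.2.isSome)
      (.seq (pushSymbol inputSymbols) popInput))) (stk l [] (fun _ => []) [])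
      (23 * l.length + 2) (stk [] [] (update (fun _ => []) false (enc l).ser.reverse.tail) []) := by
    intro v
    obtain ⟨v', n, w, hn, hw, he⟩ := exec_readLoop l v [] (fun _ => []) []
    have hp := Exec.pop (Γ := Alphabet) none (fun (v : Var) s => (v.1, s)) v
      (stk l [] (fun _ => []) [])
    simp only [stk_none, update_stk_none] at hp
    have := hp.seq he
    rw [List.append_nil] at this
    refine ⟨v', _, ?_, by rw [← hw]; exact this⟩
    omega
  obtain ⟨v', n, w, hn, hw, he⟩ := exec_readLoop l (none, none) [] (fun _ => []) []
  rw [← hw] at h₁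
  have h₂ := runs_push (.aux false) false (stk [] [] (update (fun _ => []) false w) [])
  simp only [stk_aux, update_stk_aux, update_self, update_idem] at h₂
  have h₃ := runs_unmove false [] (false :: w) [] (update (fun _ => []) false (false :: w)) []
    (by simp)
  have e : (false :: w).reverse = (enc l).ser := by rw [hw, List.reverse_reverse]
  have e' : (false :: w).length = sz l := by rw [hw, List.length_reverse, BTree.length_ser, sz]
  rw [update_idem, update_const_nil, e, e', List.append_nil] at h₃
  have h₄ := length_lt_sz l
  refine (h₁.seq (h₂.seq h₃)).mono ?_
  omega

/-- Leave a single bit on the main stack. -/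
def writeOutput : TProg :=
  .seq (PolyFun.boolCase (push .main false) (push .main true)) (.load fun _ => (none, none))

theorem exec_writeOutput (b : Bool) (v : Var) : ∃ n, n ≤ 8 ∧
    Exec writeOutput v (mainOnly (enc b).ser) n (none, none) (mainOnly [b]) := by
  have h : Runs (PolyFun.boolCase (push .main false) (push .main true)) (mainOnly (enc b).ser) 7
      (mainOnly [b]) := by
    refine (PolyFun.runs_boolCase b (n := 1) (m' := [b]) (m := []) ?_).conv (by simp) rfl le_rfl
    cases b with
    | false => exact runs_pushOnly false []
    | true => exact runs_pushOnly true []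
  obtain ⟨v', n, hn, he⟩ := h v
  exact ⟨1 + n, by omega, he.seq (.load _ _ _)⟩

end StackProgram

open StackProgram Turing in
/-- A Boolean function of the input that is computed in polynomial time in the sense of `PolyFun` is
computed by a Turing machine in polynomial time. -/
theorem PolyFun.tm2ComputableInPolyTime {α : Type} {f : List InputSymbol → Bool} (hf : PolyFun f)
    (e : α → List InputSymbol) :
    Nonempty (TM2ComputableInPolyTime e Computability.encodeBool fun a => f (e a)) := by
  obtain ⟨P, q, h⟩ := hf
  let Q : TProg := .seq (.seq readInput P) writeOutput
  have : Fintype InputSymbol := Fintype.ofFinite _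
  have : Fintype (Label Q) := @Fintype.ofFinite _ (finite_label Q)
  let tm : FinTM2 :=
    { K := Option Work
      k₀ := none
      k₁ := some .main
      Γ := Alphabet
      -- The extra label `none` is the exit of the program and halts the machine.
      Λ := Option (Label Q)
      main := some (entry Q)
      σ := Var
      initialState := (none, none)
      Γk₀Fin := inferInstanceAs (Fintype InputSymbol)
      m := fun l => match l with
        | none => .halt
        | some l => code Q some none l }
  have hsz : ∀ l : List InputSymbol, sz l ≤ 12 * l.length + 1 := fun l =>
    (sz_le_of_forall fun s _ => sz_inputSymbol_le s).trans (by omega)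
  refine ⟨{ tm := tm
            inputAlphabet := Equiv.refl _
            outputAlphabet := Equiv.refl _
            time := 500 * Polynomial.X + 100 + q.comp (12 * Polynomial.X + 1)
            outputsFun := fun a => ?_ }⟩
  have hrun : ∃ n, n ≤ 500 * (e a).length + 90 + q.eval (12 * (e a).length + 1) ∧
      Exec Q (none, none) (stk (e a) [] (fun _ => []) []) n (none, none) (mainOnly [f (e a)]) := by
    obtain ⟨v, n, hn, he⟩ := ((runs_readInput (e a)).seq
      (by simpa using h (e a) [])) (none, none)
    obtain ⟨n', hn', he'⟩ := exec_writeOutput (f (e a)) v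
    refine ⟨n' + n, ?_, he.seq he'⟩
    have h₁ := hsz (e a)
    have h₂ := q.eval_mono_nat h₁
    omega
  choose n hn he using hrun
  have hinit : initList tm ((e a).map (Equiv.refl InputSymbol).invFun)
      = ⟨some (some (entry Q)), (none, none), stk (e a) [] (fun _ => []) []⟩ := by
    have : ((e a).map (Equiv.refl InputSymbol).invFun) = e a := List.map_id _
    rw [this]
    simp only [initList]
    congr 1
    funext k
    rcases k with _ | _ | _ | _ <;> rfl
  have hhalt : haltList tm ((Computability.encodeBool (f (e a))).map (Equiv.refl Bool).invFun)
      = ⟨none, (none, none), mainOnly [f (e a)]⟩ := by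
    simp only [haltList]
    congr 1
    funext k
    rcases k with _ | _ | _ | _ <;> rfl
  -- One step more than the program takes, for the halting statement.
  refine ⟨⟨1 + n, ?_⟩, ?_⟩
  · have h₁ := he.evalsTo (M := tm.m) some none fun l => rfl
    change (flip Bind.bind tm.step)^[1 + n] (some (initList tm _)) = some (haltList tm _)
    rw [Function.iterate_add_apply]
    refine (congrArg _ ((congrArg _ (congrArg some hinit)).trans h₁)).trans ?_
    exact (congrArg some hhalt).symm
  · simp only [Polynomial.eval_add, Polynomial.eval_mul, Polynomial.eval_comp,
      Polynomial.eval_one, Polynomial.eval_ofNat, Polynomial.eval_X]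
    omega

/-! ### Polynomial-time list functions and small numbers -/

open TreeEnc StackProgram

/-- Natural numbers are encoded in unary. -/
instance : TreeEnc ℕ := ⟨fun n => enc (List.replicate n ())⟩

@[simp] theorem TreeEnc.sz_nat (n : ℕ) : sz n = 2 * n + 1 := by
  change sz (List.replicate n ()) = _
  induction n with
  | zero => rfl
  | succ n ih => rw [List.replicate_succ, sz_cons, ih, sz_unit]; omega

/-- Compare an element with the head of a list of remaining elements. -/
def matchHead {β : Type} [DecidableEq β] (s : Bool × List β) (b : β) : Bool × List β :=
  (s.1 && !s.2.isEmpty && decide (b = s.2.headD b), s.2.tail)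

theorem fst_foldl_matchHead {β : Type} [DecidableEq β] (l l' : List β) :
    (l.foldl matchHead (false, l')).1 = false := by
  induction l generalizing l' with
  | nil => rfl
  | cons a l ih => exact ih _

/-- A fold compares two lists by consuming the second while it runs through the first. Equality
requires that no mismatch occurred and that nothing is left over. -/
theorem foldl_matchHead {β : Type} [DecidableEq β] (l l' : List β) :
    ((l.foldl matchHead (true, l')).1 && (l.foldl matchHead (true, l')).2.isEmpty)
      = decide (l = l') := by
  induction l generalizing l' with
  | nil => cases l' <;> rfl
  | cons a l ih =>
      rw [List.foldl_cons]
      rcases l' with _ | ⟨b, l'⟩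
      · have : matchHead (true, []) a = (false, []) := rfl
        rw [this, fst_foldl_matchHead]; simp
      · by_cases h : a = b
        · subst h
          have : matchHead (true, a :: l') a = (true, l') := by simp [matchHead]
          rw [this, ih]; simp
        · have : matchHead (true, b :: l') a = (false, l') := by simp [matchHead, h]
          rw [this, fst_foldl_matchHead]; simp [h]

namespace PolyFun

variable {α β γ δ : Type} [TreeEnc α] [TreeEnc β] [TreeEnc γ] [TreeEnc δ]

theorem of_eq {f g : α → β} (hf : PolyFun f) (h : ∀ x, f x = g x) : PolyFun g :=
  (funext h : f = g) ▸ hf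

theorem proj₁ {f : α → β × γ} (hf : PolyFun f) : PolyFun fun x => (f x).1 := fst.comp hf

theorem proj₂ {f : α → β × γ} (hf : PolyFun f) : PolyFun fun x => (f x).2 := snd.comp hf

theorem and {f g : α → Bool} (hf : PolyFun f) (hg : PolyFun g) : PolyFun fun x => f x && g x :=
  (hf.cond hg (const false)).of_eq fun x => by cases f x <;> rfl

theorem or {f g : α → Bool} (hf : PolyFun f) (hg : PolyFun g) : PolyFun fun x => f x || g x :=
  (hf.cond (const true) hg).of_eq fun x => by cases f x <;> rfl

theorem not {f : α → Bool} (hf : PolyFun f) : PolyFun fun x => !f x :=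
  (hf.cond (const false) (const true)).of_eq fun x => by cases f x <;> rfl

/-! #### Lists -/

theorem reverse {l : α → List β} (hl : PolyFun l) : PolyFun fun x => (l x).reverse := by
  have := foldl (f := fun (_ : α) acc (b : β) => b :: acc) (b := fun _ => [])
    ((snd.comp snd).cons (fst.comp snd)) hl (const []) (Polynomial.X + 1) fun x b c => by
      simp; omega
  exact this.of_eq fun x => by simp [List.foldl_flip_cons_eq_append]

theorem foldr {f : α → γ → β → β} {l : α → List γ} {b : α → β}
    (hf : PolyFun fun p : α × γ × β => f p.1 p.2.1 p.2.2) (hl : PolyFun l) (hb : PolyFun b)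
    (q : Polynomial ℕ) (hq : ∀ x b c, sz (f x c b) ≤ sz b + q.eval (sz x + sz c)) :
    PolyFun fun x => (l x).foldr (f x) (b x) := by
  have := foldl (f := fun x b c => f x c b) (l := fun x => (l x).reverse)
    (hf.comp (fst.pair ((snd.comp snd).pair (fst.comp snd)))) hl.reverse hb q hq
  exact this.of_eq fun x => by rw [List.foldl_reverse]

theorem append {l l' : α → List β} (hl : PolyFun l) (hl' : PolyFun l') :
    PolyFun fun x => l x ++ l' x := by
  have := foldr (f := fun (_ : α) (b : β) acc => b :: acc)
    ((fst.comp snd).cons (snd.comp snd)) hl hl' (Polynomial.X + 1) fun x b c => by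
      simp; omega
  exact this.of_eq fun x => by simp

theorem map {f : α → β → γ} {l : α → List β} (hf : PolyFun fun p : α × β => f p.1 p.2)
    (hl : PolyFun l) : PolyFun fun x => (l x).map (f x) := by
  obtain ⟨s, hs⟩ := hf.exists_size_le
  have := foldr (f := fun x b acc => f x b :: acc) (b := fun _ => [])
    ((hf.comp (fst.pair (fst.comp snd))).cons (snd.comp snd)) hl (const [])
    (s.comp (Polynomial.X + 1) + 1) fun x b c => by
      have := hs (x, c)
      simp only [sz_pair, sz_cons, Polynomial.eval_add, Polynomial.eval_comp, Polynomial.eval_X,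
        Polynomial.eval_one] at this ⊢
      omega
  exact this.of_eq fun x => by simp

theorem flatMap {f : α → β → List γ} {l : α → List β} (hf : PolyFun fun p : α × β => f p.1 p.2)
    (hl : PolyFun l) : PolyFun fun x => (l x).flatMap (f x) := by
  obtain ⟨s, hs⟩ := hf.exists_size_le
  have := foldr (f := fun x b acc => f x b ++ acc) (b := fun _ => [])
    ((hf.comp (fst.pair (fst.comp snd))).append (snd.comp snd)) hl (const [])
    (s.comp (Polynomial.X + 1)) fun x b c => by
      have := hs (x, c)
      have := sz_append (f x c) b
      simp only [sz_pair, Polynomial.eval_add, Polynomial.eval_comp, Polynomial.eval_X,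
        Polynomial.eval_one] at *
      omega
  exact this.of_eq fun x => by
    induction l x with
    | nil => rfl
    | cons a l ih => simp [ih]

theorem all {p : α → β → Bool} {l : α → List β} (hp : PolyFun fun y : α × β => p y.1 y.2)
    (hl : PolyFun l) : PolyFun fun x => (l x).all (p x) := by
  have := foldr (f := fun x b acc => p x b && acc) (b := fun _ => true)
    ((hp.comp (fst.pair (fst.comp snd))).and (snd.comp snd)) hl (const true) 0
    fun x b c => by simp
  exact this.of_eq fun x => by
    induction l x with
    | nil => rfl
    | cons a l ih => simp [ih]

/-! #### Natural numbers in unary -/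

theorem replicate {n : α → ℕ} (hn : PolyFun n) : PolyFun fun x => List.replicate (n x) () :=
  hn.congr_enc (fun x => x) (fun _ => rfl) fun _ => rfl

theorem of_replicate {n : α → ℕ} (hn : PolyFun fun x => List.replicate (n x) ()) : PolyFun n :=
  hn.congr_enc (fun x => x) (fun _ => rfl) fun _ => rfl

theorem length {l : α → List β} (hl : PolyFun l) : PolyFun fun x => (l x).length :=
  of_replicate ((map (f := fun _ _ => ()) (const ()) hl).of_eq fun x => by simp)

theorem add {m n : α → ℕ} (hm : PolyFun m) (hn : PolyFun n) : PolyFun fun x => m x + n x :=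
  of_replicate ((hm.replicate.append hn.replicate).of_eq fun x => by simp)

theorem succ {n : α → ℕ} (hn : PolyFun n) : PolyFun fun x => n x + 1 := hn.add (const 1)

theorem drop {l : α → List β} {n : α → ℕ} (hl : PolyFun l) (hn : PolyFun n) :
    PolyFun fun x => (l x).drop (n x) := by
  have := foldl (f := fun (_ : α) (l : List β) (_ : Unit) => l.tail)
    (tail (fst.comp snd)) hn.replicate hl 0 fun x b c => by
      cases b <;> simp; omega
  refine this.of_eq fun x => ?_
  generalize l x = l
  induction n x generalizing l with
  | zero => rfl
  | succ n ih => rw [List.replicate_succ, List.foldl_cons, ih]; cases l <;> simp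

theorem sub {m n : α → ℕ} (hm : PolyFun m) (hn : PolyFun n) : PolyFun fun x => m x - n x :=
  of_replicate ((hm.replicate.drop hn).of_eq fun x => by simp)

theorem getD {l : α → List β} {n : α → ℕ} {d : α → β} (hl : PolyFun l) (hn : PolyFun n)
    (hd : PolyFun d) : PolyFun fun x => (l x).getD (n x) (d x) :=
  ((hl.drop hn).headD hd).of_eq fun x => by
    generalize l x = l
    induction n x generalizing l with
    | zero => cases l <;> rfl
    | succ n ih => cases l <;> simp_all

theorem decide_eq_zero {n : α → ℕ} (hn : PolyFun n) : PolyFun fun x => decide (n x = 0) :=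
  hn.replicate.isEmpty.of_eq fun x => by cases n x <;> simp [List.replicate_succ]

theorem decide_le {m n : α → ℕ} (hm : PolyFun m) (hn : PolyFun n) :
    PolyFun fun x => decide (m x ≤ n x) :=
  (hm.sub hn).decide_eq_zero.of_eq fun x => by simp [Nat.sub_eq_zero_iff_le]

theorem decide_lt {m n : α → ℕ} (hm : PolyFun m) (hn : PolyFun n) :
    PolyFun fun x => decide (m x < n x) := hm.succ.decide_le hn

theorem decide_eq_nat {m n : α → ℕ} (hm : PolyFun m) (hn : PolyFun n) :
    PolyFun fun x => decide (m x = n x) :=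
  ((hm.decide_le hn).and (hn.decide_le hm)).of_eq fun x => by
    simp [← Bool.decide_and, Nat.le_antisymm_iff]

theorem range {n : α → ℕ} (hn : PolyFun n) : PolyFun fun x => List.range (n x) := by
  have e : ∀ (l : List Unit), l.foldl (fun (acc : List ℕ) _ => acc ++ [acc.length]) []
      = List.range l.length := fun l => by
    induction l using List.reverseRecOn with
    | nil => rfl
    | append_singleton l a ih => simp [ih, List.range_succ]
  -- The appended entry is the length of the accumulator, so the growth of a step depends on the
  -- accumulator. All prefixes are therefore bounded directly.
  have h := foldl_of_bounded (f := fun (acc : List ℕ) (_ : Unit) => acc ++ [acc.length])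
    (b := fun _ => []) (snd.append (snd.length.cons (const []))) hn.replicate (const [])
  obtain ⟨s, hs⟩ := hn.exists_size_le
  refine (h (s * (2 * s + 2) + 1) fun x l' hl' => ?_).of_eq fun x => by rw [e]; simp
  rw [e]
  have h₁ : l'.length ≤ n x := by simpa using hl'.length_le
  have h₂ : sz (List.range l'.length) ≤ l'.length * (2 * n x + 1 + 1) + 1 := by
    have := sz_le_of_forall (l := List.range l'.length) (k := 2 * n x + 1) fun a ha => by
      have := List.mem_range.1 ha
      simp; omega
    simpa using this
  have h₃ := hs x
  rw [sz_nat] at h₃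
  refine h₂.trans ?_
  simp only [Polynomial.eval_add, Polynomial.eval_mul, Polynomial.eval_one,
    Polynomial.eval_ofNat]
  gcongr <;> omega

theorem mul {m n : α → ℕ} (hm : PolyFun m) (hn : PolyFun n) : PolyFun fun x => m x * n x :=
  (flatMap (f := fun x _ => List.range (n x)) (hn.comp fst).range hm.range).length.of_eq
    fun x => by simp

/-- A counter that wraps around at `n x`. For `n x = 0` it never wraps, in agreement with `m % 0 =
m`. -/
theorem mod {m n : α → ℕ} (hm : PolyFun m) (hn : PolyFun n) : PolyFun fun x => m x % n x := by
  have := foldl (f := fun (x : α) (s : ℕ) (_ : Unit) => if s + 1 = n x then 0 else s + 1)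
    (b := fun _ => 0) (((fst.comp snd).succ.decide_eq_nat (hn.comp fst)).ite (const 0)
      (fst.comp snd).succ) hm.replicate (const 0) 2 fun x b c => by
      by_cases h : b + 1 = n x <;> simp [h]; omega
  refine this.of_eq fun x => ?_
  induction m x with
  | zero => simp
  | succ k ih =>
      rw [List.replicate_succ', List.foldl_append, ih]
      simp only [List.foldl_cons, List.foldl_nil]
      rcases Nat.eq_zero_or_pos (n x) with h | h
      · simp [h]
      · have h₁ := Nat.mod_lt k h
        rw [← Nat.mod_add_mod]
        split_ifs with h₂
        · rw [h₂, Nat.mod_self]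
        · exact (Nat.mod_eq_of_lt (by omega)).symm

/-- The quotient counts the multiples of `n x` among `1, …, m x`. -/
theorem div {m n : α → ℕ} (hm : PolyFun m) (hn : PolyFun n) : PolyFun fun x => m x / n x := by
  have := foldl (f := fun (x : α) (s : ℕ) (j : ℕ) => if (j + 1) % n x = 0 then s + 1 else s)
    (b := fun _ => 0) ((((snd.comp snd).succ.mod (hn.comp fst)).decide_eq_zero).ite
      (fst.comp snd).succ (fst.comp snd)) hm.range (const 0) 2 fun x b c => by
      by_cases h : (c + 1) % n x = 0 <;> simp [h]; omega
  refine this.of_eq fun x => ?_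
  induction m x with
  | zero => simp
  | succ k ih =>
      rw [List.range_succ, List.foldl_append, ih]
      simp only [List.foldl_cons, List.foldl_nil, Nat.succ_div, Nat.dvd_iff_mod_eq_zero]
      split_ifs <;> rfl

theorem decide_eq_list [DecidableEq β] (hβ : PolyFun fun p : β × β => decide (p.1 = p.2))
    {l l' : α → List β} (hl : PolyFun l) (hl' : PolyFun l') :
    PolyFun fun x => decide (l x = l' x) := by
  have := foldl (f := fun (_ : α) (s : Bool × List β) (b : β) => matchHead s b)
    (b := fun x => (true, l' x)) (((((fst.comp fst).comp snd).and ((snd.comp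
      (fst.comp snd)).isEmpty.not)).and (hβ.comp ((snd.comp snd).pair ((snd.comp
      (fst.comp snd)).headD (snd.comp snd))))).pair (snd.comp (fst.comp snd)).tail) hl
    ((const true).pair hl') 0 fun x b c => by
      rcases b with ⟨_, _ | _⟩ <;> simp [matchHead]; omega
  exact ((fst.comp this).and (snd.comp this).isEmpty).of_eq fun x => foldl_matchHead _ _

end PolyFun

/-! ### Binary arithmetic in polynomial time -/

open TreeEnc StackProgram

/-- The number with the given binary digits, least significant digit first. -/
def bitsVal : List Bool → ℕ
  | [] => 0
  | b :: l => b.toNat + 2 * bitsVal l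

theorem bitsVal_append (l l' : List Bool) :
    bitsVal (l ++ l') = bitsVal l + 2 ^ l.length * bitsVal l' := by
  induction l with
  | nil => simp [bitsVal]
  | cons b l ih => simp only [List.cons_append, bitsVal, ih, List.length_cons, pow_succ]; ring

theorem bitsVal_lt (l : List Bool) : bitsVal l < 2 ^ l.length := by
  induction l with
  | nil => simp [bitsVal]
  | cons b l ih =>
      have := b.toNat_le
      simp only [bitsVal, List.length_cons, pow_succ]
      omega

@[simp] theorem bitsVal_bits (n : ℕ) : bitsVal n.bits = n := by
  induction n using Nat.binaryRec' with
  | zero => simp [bitsVal]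
  | bit b n h ih => rw [Nat.bits_append_bit n b h, bitsVal, ih, Nat.bit_val]; omega

/-- Remove leading zeros. -/
def trimBits (l : List Bool) : List Bool :=
  l.foldr (fun b acc => bif acc.isEmpty && !b then [] else b :: acc) []

/-- The digitwise operations leave superfluous zeros; trimming yields the canonical digits that the
encoding of integers requires. -/
theorem trimBits_eq (l : List Bool) : trimBits l = (bitsVal l).bits := by
  induction l with
  | nil => simp [trimBits, bitsVal]
  | cons b l ih =>
      have e : trimBits (b :: l) = bif (trimBits l).isEmpty && !b then [] else b :: trimBits l :=
        rfl
      have e' : bitsVal (b :: l) = Nat.bit b (bitsVal l) := by rw [bitsVal, Nat.bit_val]; omega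
      rw [e, ih, e']
      by_cases h : bitsVal l = 0 ∧ b = false
      · simp [h.1, h.2]
      · have hb : bitsVal l = 0 → b = true := fun h' => by
          cases b
          · exact absurd ⟨h', rfl⟩ h
          · rfl
        have hne : (((bitsVal l).bits).isEmpty && !b) = false := by
          cases b with
          | true => simp
          | false =>
              have : bitsVal l ≠ 0 := fun h' => h ⟨h', rfl⟩
              have h'' : (bitsVal l).bits ≠ [] := fun h' => by
                have := bitsVal_bits (bitsVal l)
                rw [h'] at this
                simp [bitsVal] at this
                omega
              simpa using h''
        rw [Nat.bits_append_bit _ _ hb, hne]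
        rfl

/-- One step of a digitwise operation with carry. -/
def rippleStep (φ : Bool → Bool → Bool → Bool × Bool)
    (s : (List Bool × List Bool) × (Bool × List Bool)) :
    (List Bool × List Bool) × (Bool × List Bool) :=
  ((s.1.1.tail, s.1.2.tail),
    ((φ (s.1.1.headD false) (s.1.2.headD false) s.2.1).2,
      (φ (s.1.1.headD false) (s.1.2.headD false) s.2.1).1 :: s.2.2))

/-- A digitwise operation with carry: the last carry and the digits, most significant first. -/
def ripple (φ : Bool → Bool → Bool → Bool × Bool) (a b : List Bool) : Bool × List Bool :=
  ((a ++ b).foldl (fun s _ => rippleStep φ s) ((a, b), (false, []))).2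

theorem length_ripple (φ : Bool → Bool → Bool → Bool × Bool) (a b : List Bool) :
    (ripple φ a b).2.length = a.length + b.length := by
  have : ∀ (l : List Bool) (s : (List Bool × List Bool) × (Bool × List Bool)),
      (l.foldl (fun s _ => rippleStep φ s) s).2.2.length = l.length + s.2.2.length := by
    intro l
    induction l with
    | nil => intro s; simp
    | cons c l ih => intro s; rw [List.foldl_cons, ih]; simp [rippleStep]; omega
  rw [ripple, this]
  simp

/-- Addition (`u = 1`) and subtraction (`u = -1`) at once: `hφ` is the identity for a single digit,
with the carry or borrow weighted by `u`. -/
theorem ripple_spec (φ : Bool → Bool → Bool → Bool × Bool) (u : ℤ)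
    (hφ : ∀ a b c, (a.toNat : ℤ) + u * (b.toNat + c.toNat)
      = (φ a b c).1.toNat + 2 * u * (φ a b c).2.toNat) (a b : List Bool) :
    (bitsVal (ripple φ a b).2.reverse : ℤ)
        + 2 ^ (a.length + b.length) * u * (ripple φ a b).1.toNat
      = bitsVal a + u * bitsVal b := by
  have hval : ∀ l : List Bool,
      (bitsVal l : ℤ) = (l.headD false).toNat + 2 * (bitsVal l.tail : ℤ) := by
    rintro (_ | ⟨b, l⟩) <;> simp [bitsVal]
  -- The quantity that each step conserves: the digits already written plus, at their place value,
  -- the unread parts combined with the carry.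
  have key : ∀ (l : List Bool) (s : (List Bool × List Bool) × (Bool × List Bool)),
      (fun s : (List Bool × List Bool) × (Bool × List Bool) => (bitsVal s.2.2.reverse : ℤ)
        + 2 ^ s.2.2.length * (bitsVal s.1.1 + u * (bitsVal s.1.2 + s.2.1.toNat)))
        (l.foldl (fun s _ => rippleStep φ s) s)
      = (bitsVal s.2.2.reverse : ℤ)
        + 2 ^ s.2.2.length * (bitsVal s.1.1 + u * (bitsVal s.1.2 + s.2.1.toNat)) := by
    intro l
    induction l with
    | nil => intro s; rfl
    | cons c l ih =>
        intro s
        rw [List.foldl_cons, ih]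
        simp only [rippleStep, List.reverse_cons, bitsVal_append, List.length_reverse,
          List.length_cons, bitsVal, pow_succ]
        push_cast
        rw [hval s.1.1, hval s.1.2]
        have := hφ (s.1.1.headD false) (s.1.2.headD false) s.2.1
        linear_combination (-(2 : ℤ) ^ s.2.2.length) * this
  have hnil : ∀ (l : List Bool) (s : (List Bool × List Bool) × (Bool × List Bool)),
      (l.foldl (fun s _ => rippleStep φ s) s).1 = (s.1.1.drop l.length, s.1.2.drop l.length) := by
    intro l
    induction l with
    | nil => intro s; rfl
    | cons c l ih => intro s; rw [List.foldl_cons, ih]; simp [rippleStep]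
  have h := key (a ++ b) ((a, b), (false, []))
  have h' := hnil (a ++ b) ((a, b), (false, []))
  have hl := length_ripple φ a b
  simp only [ripple] at hl ⊢
  beta_reduce at h
  rw [h'] at h
  have d₁ : a.drop (a ++ b).length = [] := by simp
  have d₂ : b.drop (a ++ b).length = [] := by simp
  simp only [hl, d₁, d₂, bitsVal, List.reverse_nil, List.length_nil, Bool.toNat_false,
    Nat.cast_zero, pow_zero] at h
  linear_combination h

/-- The binary sum. -/
def addBits (a b : List Bool) : List Bool :=
  ((ripple (fun a b c => (a ^^ b ^^ c, a && b || a && c || b && c)) a b).1 ::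
    (ripple (fun a b c => (a ^^ b ^^ c, a && b || a && c || b && c)) a b).2).reverse

/-- The binary difference: the last borrow and the digits, most significant first. -/
def subBits (a b : List Bool) : Bool × List Bool :=
  ripple (fun a b c => (a ^^ b ^^ c, !a && b || !a && c || b && c)) a b

theorem length_addBits (a b : List Bool) : (addBits a b).length = a.length + b.length + 1 := by
  simp [addBits, length_ripple]

theorem bitsVal_addBits (a b : List Bool) : bitsVal (addBits a b) = bitsVal a + bitsVal b := by
  have := ripple_spec (fun a b c => (a ^^ b ^^ c, a && b || a && c || b && c)) 1
    (by decide) a b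
  rw [addBits, List.reverse_cons, bitsVal_append]
  simp only [List.length_reverse, length_ripple, bitsVal]
  zify
  linear_combination this

theorem bitsVal_subBits (a b : List Bool) : (bitsVal (subBits a b).2.reverse : ℤ)
    - 2 ^ (a.length + b.length) * (subBits a b).1.toNat = bitsVal a - bitsVal b := by
  have := ripple_spec (fun a b c => (a ^^ b ^^ c, !a && b || !a && c || b && c)) (-1)
    (by decide) a b
  rw [subBits]
  linear_combination this

theorem bitsVal_subBits_lt (a b : List Bool) :
    bitsVal (subBits a b).2.reverse < 2 ^ (a.length + b.length) := by
  have := bitsVal_lt (subBits a b).2.reverse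
  rwa [List.length_reverse, subBits, length_ripple] at this

theorem subBits_of_le {a b : List Bool} (h : bitsVal b ≤ bitsVal a) :
    (subBits a b).1 = false ∧ bitsVal (subBits a b).2.reverse = bitsVal a - bitsVal b := by
  have h₁ := bitsVal_subBits a b
  have h₂ := bitsVal_subBits_lt a b
  zify at h₂ h
  cases hc : (subBits a b).1 with
  | true => simp [hc] at h₁; omega
  | false => simp [hc] at h₁; simp; omega

theorem subBits_of_lt {a b : List Bool} (h : bitsVal a < bitsVal b) :
    (subBits a b).1 = true := by
  have h₁ := bitsVal_subBits a b
  zify at h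
  cases hc : (subBits a b).1 with
  | true => rfl
  | false => simp [hc] at h₁; omega

/-- The binary product. -/
def mulBits (a b : List Bool) : List Bool :=
  a.foldr (fun c acc => addBits (false :: acc) (bif c then b else [])) []

theorem bitsVal_mulBits (a b : List Bool) : bitsVal (mulBits a b) = bitsVal a * bitsVal b := by
  induction a with
  | nil => simp [mulBits, bitsVal]
  | cons c a ih =>
      have e : mulBits (c :: a) b = addBits (false :: mulBits a b) (bif c then b else []) := rfl
      rw [e, bitsVal_addBits, bitsVal, ih, bitsVal]
      cases c <;> simp [bitsVal] <;> ring

/-- Integers are encoded by the binary digits of their positive and negative parts. -/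
instance : TreeEnc ℤ := ⟨fun z => enc (z.toNat.bits, (-z).toNat.bits)⟩

namespace TreeEnc

theorem sz_bits (l : List Bool) : sz l = 6 * l.length + 1 := by
  induction l with
  | nil => rfl
  | cons b l ih => simp [ih]; omega

theorem sz_int (z : ℤ) : sz z = 6 * z.natAbs.size + 3 := by
  have e : sz z = sz z.toNat.bits + sz (-z).toNat.bits + 1 := rfl
  rw [e, sz_bits, sz_bits, Nat.size_eq_bits_len, Nat.size_eq_bits_len]
  rcases Int.natAbs_eq z with h | h
  · have h₁ : z.toNat = z.natAbs := by omega
    have h₂ : (-z).toNat = 0 := by omega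
    simp [h₁, h₂]
  · have h₁ : (-z).toNat = z.natAbs := by omega
    have h₂ : z.toNat = 0 := by omega
    simp [h₁, h₂]; omega

/-- A crude bound, but additive in the summands, as the fold rule demands of running sums. -/
theorem sz_add_int_le (x y : ℤ) : sz (x + y) ≤ sz x + sz y + 3 := by
  rw [sz_int, sz_int, sz_int]
  have h : (x + y).natAbs.size ≤ x.natAbs.size + y.natAbs.size + 1 := by
    rw [Nat.size_le]
    have h₁ := Nat.lt_size_self x.natAbs
    have h₂ := Nat.lt_size_self y.natAbs
    have h₃ := Int.natAbs_add_le x y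
    have h₄ := Nat.pow_le_pow_right (n := 2) (by omega)
      (Nat.le_add_right x.natAbs.size y.natAbs.size)
    have h₅ := Nat.pow_le_pow_right (n := 2) (by omega)
      (Nat.le_add_left y.natAbs.size x.natAbs.size)
    rw [pow_succ]
    omega
  omega

theorem enc_bool_injective : Function.Injective (enc : Bool → BTree) := by
  rintro (_ | _) (_ | _) h <;> first | rfl | simp at h

theorem enc_prod_injective {α β : Type} [TreeEnc α] [TreeEnc β]
    (hα : Function.Injective (enc : α → BTree)) (hβ : Function.Injective (enc : β → BTree)) :
    Function.Injective (enc : α × β → BTree) := fun x y h => by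
  simp only [enc_pair, BTree.node.injEq] at h
  exact Prod.ext (hα h.1) (hβ h.2)

end TreeEnc

namespace PolyFun

variable {α β γ δ : Type} [TreeEnc α] [TreeEnc β] [TreeEnc γ] [TreeEnc δ]

theorem polyFun_ripple (φ : Bool → Bool → Bool → Bool × Bool) {f g : α → List Bool}
    (hf : PolyFun f) (hg : PolyFun g) : PolyFun fun x => ripple φ (f x) (g x) := by
  have hφ : PolyFun fun p : Bool × Bool × Bool => φ p.1 p.2.1 p.2.2 :=
    of_finite (enc_prod_injective enc_bool_injective
      (enc_prod_injective enc_bool_injective enc_bool_injective)) _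
  have hstep : PolyFun (rippleStep φ) := by
    have h : PolyFun fun s : (List Bool × List Bool) × (Bool × List Bool) =>
        φ (s.1.1.headD false) (s.1.2.headD false) s.2.1 := hφ.comp (((fst.comp fst).headD (const false)).pair
      (((snd.comp fst).headD (const false)).pair (fst.comp snd)))
    exact ((tail (fst.comp fst)).pair (tail (snd.comp fst))).pair
      (h.proj₂.pair (h.proj₁.cons snd.proj₂))
  refine proj₂ (foldl (f := fun (_ : α) s (_ : Bool) => rippleStep φ s)
    (b := fun x => ((f x, g x), (false, []))) (hstep.comp snd.proj₁) (hf.append hg)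
    ((hf.pair hg).pair ((const false).pair (const []))) 6 fun x s _ => ?_)
  rcases s with ⟨⟨_ | _, _ | _⟩, _, _⟩ <;> simp [rippleStep] <;> omega

theorem polyFun_addBits {f g : α → List Bool} (hf : PolyFun f) (hg : PolyFun g) :
    PolyFun fun x => addBits (f x) (g x) :=
  ((polyFun_ripple _ hf hg).proj₁.cons (polyFun_ripple _ hf hg).proj₂).reverse

theorem polyFun_trimBits {f : α → List Bool} (hf : PolyFun f) :
    PolyFun fun x => trimBits (f x) := by
  refine foldr (f := fun (_ : α) b acc => bif acc.isEmpty && !b then [] else b :: acc)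
    (b := fun _ => []) (((snd.comp snd).isEmpty.and (fst.comp snd).not).cond (const [])
      ((fst.comp snd).cons (snd.comp snd))) hf (const []) 6 fun x b c => ?_
  have := sz_pos b
  cases b.isEmpty && !c <;> (simp; try omega)

theorem polyFun_mulBits {f g : α → List Bool} (hf : PolyFun f) (hg : PolyFun g) :
    PolyFun fun x => mulBits (f x) (g x) := by
  have hg' : PolyFun fun p : (List Bool × List Bool) × Bool × List Bool =>
      addBits (false :: p.2.2) (bif p.2.1 then p.1.2 else []) :=
    polyFun_addBits ((const false).cons snd.proj₂) (snd.proj₁.cond fst.proj₂ (const []))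
  -- Each Horner step lengthens the accumulator by the length of the second factor plus a constant,
  -- so lengths do not multiply.
  have h := foldr (f := fun (p : List Bool × List Bool) c acc =>
      addBits (false :: acc) (bif c then p.2 else [])) (l := Prod.fst) (b := fun _ => [])
    hg' fst (const []) (Polynomial.X + 11) fun x b c => by
      rw [sz_bits, length_addBits]
      cases c <;> simp [sz_bits] <;> omega
  exact (h.comp (hf.pair hg)).of_eq fun x => rfl

theorem parts {z : α → ℤ} (hz : PolyFun z) :
    PolyFun fun x => ((z x).toNat.bits, (-z x).toNat.bits) :=
  hz.congr_enc (fun x => x) (fun _ => rfl) fun _ => rfl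

theorem toNat_bits {z : α → ℤ} (hz : PolyFun z) : PolyFun fun x => (z x).toNat.bits :=
  hz.parts.proj₁

theorem neg_toNat_bits {z : α → ℤ} (hz : PolyFun z) : PolyFun fun x => (-z x).toNat.bits :=
  hz.parts.proj₂

/-- All integer operations reduce to this: each is written as a difference of two naturals computed
digitwise. The borrow of one subtraction shows the sign and thereby selects which of the two
differences is the absolute value. -/
theorem bitsDiff {f g : α → List Bool} (hf : PolyFun f) (hg : PolyFun g) :
    PolyFun fun x => (bitsVal (f x) : ℤ) - bitsVal (g x) := by
  have h₁ : PolyFun fun x => subBits (f x) (g x) := polyFun_ripple _ hf hg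
  have h₂ : PolyFun fun x => subBits (g x) (f x) := polyFun_ripple _ hg hf
  have h : PolyFun fun x => bif (subBits (f x) (g x)).1
      then (([] : List Bool), trimBits (subBits (g x) (f x)).2.reverse)
      else (trimBits (subBits (f x) (g x)).2.reverse, ([] : List Bool)) :=
    h₁.proj₁.cond ((const []).pair (polyFun_trimBits h₂.proj₂.reverse))
      ((polyFun_trimBits h₁.proj₂.reverse).pair (const []))
  refine h.congr_enc (fun x => x) (fun _ => rfl) fun x => ?_
  change _ = enc (((bitsVal (f x) : ℤ) - bitsVal (g x)).toNat.bits,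
    (-((bitsVal (f x) : ℤ) - bitsVal (g x))).toNat.bits)
  congr 1
  rcases le_or_gt (bitsVal (g x)) (bitsVal (f x)) with h | h
  · obtain ⟨h₁, h₂⟩ := subBits_of_le h
    rw [h₁, cond_false, trimBits_eq, h₂]
    have e₁ : ((bitsVal (f x) : ℤ) - bitsVal (g x)).toNat = bitsVal (f x) - bitsVal (g x) := by
      omega
    have e₂ : (-((bitsVal (f x) : ℤ) - bitsVal (g x))).toNat = 0 := by omega
    rw [e₁, e₂, Nat.zero_bits]
  · obtain ⟨_, h₂⟩ := subBits_of_le h.le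
    rw [subBits_of_lt h, cond_true, trimBits_eq, h₂]
    have e₁ : ((bitsVal (f x) : ℤ) - bitsVal (g x)).toNat = 0 := by omega
    have e₂ : (-((bitsVal (f x) : ℤ) - bitsVal (g x))).toNat = bitsVal (g x) - bitsVal (f x) := by
      omega
    rw [e₁, e₂, Nat.zero_bits]

theorem addInt {f g : α → ℤ} (hf : PolyFun f) (hg : PolyFun g) : PolyFun fun x => f x + g x :=
  ((polyFun_addBits hf.toNat_bits hg.toNat_bits).bitsDiff
    (polyFun_addBits hf.neg_toNat_bits hg.neg_toNat_bits)).of_eq fun x => by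
    simp only [bitsVal_addBits, bitsVal_bits]; omega

theorem subInt {f g : α → ℤ} (hf : PolyFun f) (hg : PolyFun g) : PolyFun fun x => f x - g x :=
  ((polyFun_addBits hf.toNat_bits hg.neg_toNat_bits).bitsDiff
    (polyFun_addBits hf.neg_toNat_bits hg.toNat_bits)).of_eq fun x => by
    simp only [bitsVal_addBits, bitsVal_bits]; omega

theorem mulInt {f g : α → ℤ} (hf : PolyFun f) (hg : PolyFun g) : PolyFun fun x => f x * g x :=
  ((polyFun_addBits (polyFun_mulBits hf.toNat_bits hg.toNat_bits)
      (polyFun_mulBits hf.neg_toNat_bits hg.neg_toNat_bits)).bitsDiff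
    (polyFun_addBits (polyFun_mulBits hf.toNat_bits hg.neg_toNat_bits)
      (polyFun_mulBits hf.neg_toNat_bits hg.toNat_bits))).of_eq fun x => by
    simp only [bitsVal_addBits, bitsVal_mulBits, bitsVal_bits]
    have h₁ : f x = (f x).toNat - (-f x).toNat := by omega
    have h₂ : g x = (g x).toNat - (-g x).toNat := by omega
    conv_rhs => rw [h₁, h₂]
    push_cast
    ring

theorem decide_neg {f : α → ℤ} (hf : PolyFun f) : PolyFun fun x => decide (f x < 0) :=
  hf.neg_toNat_bits.isEmpty.not.of_eq fun x => by
    by_cases h : f x < 0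
    · have h₁ : (-f x).toNat.bits ≠ [] := fun h' => by
        have := bitsVal_bits (-f x).toNat
        rw [h'] at this
        simp [bitsVal] at this
        omega
      simp [h, h₁]
    · have h₁ : (-f x).toNat = 0 := by omega
      simp [h, h₁]

theorem decide_ltInt {f g : α → ℤ} (hf : PolyFun f) (hg : PolyFun g) :
    PolyFun fun x => decide (f x < g x) :=
  (hf.subInt hg).decide_neg.of_eq fun x => by simp

theorem decide_leInt {f g : α → ℤ} (hf : PolyFun f) (hg : PolyFun g) :
    PolyFun fun x => decide (f x ≤ g x) :=
  (hg.decide_ltInt hf).not.of_eq fun x => Bool.eq_iff_iff.2 (by simp)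

theorem minNat {f g : α → ℕ} (hf : PolyFun f) (hg : PolyFun g) : PolyFun fun x => min (f x) (g x) :=
  (hf.sub (hf.sub hg)).of_eq fun _ => Nat.sub_sub_eq_min _ _

/-- A number in binary can be converted to unary as long as it is bounded. -/
theorem min_toNat {f : α → ℤ} {n : α → ℕ} (hf : PolyFun f) (hn : PolyFun n) :
    PolyFun fun x => min (f x).toNat (n x) := by
  -- Horner's scheme in unary, capped in every step. Capping early is harmless, since a value that
  -- reaches the cap stays at it.
  have h : PolyFun fun p : List Bool × ℕ => p.1.foldr (fun (c : Bool) (acc : ℕ) =>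
      min ((bif c then 1 else 0) + (acc + acc)) p.2) 0 := by
    refine foldr (f := fun (p : List Bool × ℕ) (c : Bool) (acc : ℕ) =>
      min ((bif c then 1 else 0) + (acc + acc)) p.2) (l := Prod.fst) (b := fun _ => 0)
      (((snd.proj₁.cond (const 1) (const 0)).add (snd.proj₂.add snd.proj₂)).minNat fst.proj₂)
      fst (const 0) (2 * Polynomial.X) fun _ b c => ?_
    simp
    omega
  refine (h.comp (hf.toNat_bits.pair hn)).of_eq fun x => ?_
  have e : ∀ l : List Bool, l.foldr (fun (c : Bool) (acc : ℕ) =>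
      min ((bif c then 1 else 0) + (acc + acc)) (n x)) 0 = min (bitsVal l) (n x) := by
    intro l
    induction l with
    | nil => simp [bitsVal]
    | cons c l ih =>
        rw [List.foldr_cons, ih, bitsVal]
        cases c <;> simp <;> omega
  rw [e, bitsVal_bits]

end PolyFun

/-! ### The verifier -/

open TreeEnc StackProgram

/-- One step of reading integers: the sign and the digits of the current integer, and the integers
read so far in reverse order. -/
def parseStep (s : (Bool × List Bool) × List ℤ) : HazingSymbol → (Bool × List Bool) × List ℤ
  | .bit b => ((s.1.1, b :: s.1.2), s.2)
  | .minus => ((true, s.1.2), s.2)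
  | .sep => ((false, []), (bif s.1.1 then (bitsVal [] : ℤ) - bitsVal s.1.2.reverse
      else (bitsVal s.1.2.reverse : ℤ) - bitsVal []) :: s.2)

/-- Read a list of integers. -/
def parseIntegers (l : List HazingSymbol) : List ℤ :=
  (l.foldl parseStep ((false, []), [])).2.reverse

theorem parseIntegers_encodeIntegers (l : List ℤ) : parseIntegers (encodeIntegers l) = l := by
  have h₁ : ∀ (bits : List Bool) (b : Bool) (acc : List Bool) (out : List ℤ),
      (bits.map HazingSymbol.bit).foldl parseStep ((b, acc), out)
        = ((b, bits.reverse ++ acc), out) := by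
    intro bits
    induction bits with
    | nil => intros; rfl
    | cons a bits ih => intros; simp [parseStep, ih]
  have h₂ : ∀ (z : ℤ) (out : List ℤ),
      (encodeInteger z).foldl parseStep ((false, []), out) = ((false, []), z :: out) := by
    intro z out
    by_cases hz : z < 0
    · have h : -(z.natAbs : ℤ) = z := by omega
      simpa [encodeInteger, hz, parseStep, h₁, bitsVal] using h
    · have h : (z.natAbs : ℤ) = z := by omega
      simpa [encodeInteger, hz, parseStep, h₁, bitsVal] using h
  have h₃ : ∀ (l out : List ℤ), (encodeIntegers l).foldl parseStep ((false, []), out)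
      = ((false, []), l.reverse ++ out) := by
    intro l
    induction l with
    | nil => intros; rfl
    | cons z l ih =>
        intro out
        rw [encodeIntegers, List.flatMap_cons, List.foldl_append, h₂]
        exact (ih (z :: out)).trans (by simp)
  rw [parseIntegers, h₃]
  simp

namespace PolyFun

variable {α : Type} [TreeEnc α]

theorem sz_bitsVal_le (l : List Bool) : sz (bitsVal l : ℤ) ≤ sz l + 2 := by
  rw [sz_int, sz_bits, Int.natAbs_natCast]
  have := Nat.size_le.2 (bitsVal_lt l)
  omega

theorem polyFun_parseIntegers {f : α → List HazingSymbol} (hf : PolyFun f) :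
    PolyFun fun x => parseIntegers (f x) := by
  have h₁ : PolyFun fun s : HazingSymbol => match s with
      | .sep => true | _ => false := of_finite enc_hazingSymbol_injective _
  have h₂ : PolyFun fun s : HazingSymbol => match s with
      | .minus => true | _ => false := of_finite enc_hazingSymbol_injective _
  have h₃ : PolyFun fun s : HazingSymbol => match s with
      | .bit b => b | _ => false := of_finite enc_hazingSymbol_injective _
  have hstep : PolyFun fun p : α × ((Bool × List Bool) × List ℤ) × HazingSymbol =>
      parseStep p.2.1 p.2.2 := by
    have hs : PolyFun fun p : α × ((Bool × List Bool) × List ℤ) × HazingSymbol => p.2.1 :=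
      snd.proj₁
    have hc : PolyFun fun p : α × ((Bool × List Bool) × List ℤ) × HazingSymbol => p.2.2 :=
      snd.proj₂
    have hr := hs.proj₁.proj₂.reverse
    refine ((h₁.comp hc).cond (((const false).pair (const [])).pair
      ((hs.proj₁.proj₁.cond (bitsDiff (const []) hr) (bitsDiff hr (const []))).cons hs.proj₂))
      ((h₂.comp hc).cond (((const true).pair hs.proj₁.proj₂).pair hs.proj₂)
        ((hs.proj₁.proj₁.pair ((h₃.comp hc).cons hs.proj₁.proj₂)).pair hs.proj₂))).of_eq
      fun x => ?_
    rcases x with ⟨_, _, _ | _ | _⟩ <;> rfl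
  have := foldl (f := fun (_ : α) s c => parseStep s c) (b := fun _ => ((false, []), []))
    hstep hf (((const false).pair (const [])).pair (const [])) 10 fun x s c => by
      rcases c with _ | _ | _
      · simp [parseStep]; omega
      · simp [parseStep]
      · have h := sz_bitsVal_le s.1.2.reverse
        have h' : sz (-(bitsVal s.1.2.reverse : ℤ)) = sz (bitsVal s.1.2.reverse : ℤ) := by
          rw [sz_int, sz_int, Int.natAbs_neg]
        rw [sz_bits, List.length_reverse, ← sz_bits] at h
        cases hb : s.1.1 <;> simp [parseStep, hb, bitsVal, h'] <;> omega
  exact this.proj₂.reverse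

theorem polyFun_encodeIntegers {f : α → List ℤ} (hf : PolyFun f) :
    PolyFun fun x => encodeIntegers (f x) := by
  have h : PolyFun encodeInteger := by
    have hbit : PolyFun HazingSymbol.bit := of_finite enc_bool_injective _
    have hz : PolyFun fun z : ℤ => z := PolyFun.id
    -- One of the positive and negative parts is zero and has no digits, so their digits concatenate
    -- to those of the absolute value.
    refine (((hz.decide_neg.cond (const [HazingSymbol.minus]) (const [])).append
      (map (f := fun (_ : ℤ) b => HazingSymbol.bit b) (hbit.comp snd)
        (hz.toNat_bits.append hz.neg_toNat_bits))).append (const [HazingSymbol.sep])).of_eq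
      fun z => ?_
    rw [encodeInteger, Bool.cond_decide]
    congr 3
    rcases le_or_gt 0 z with h | h
    · have h₁ : (-z).toNat = 0 := by omega
      have h₂ : z.toNat = z.natAbs := by omega
      rw [h₁, h₂, Nat.zero_bits, List.append_nil]
    · have h₁ : z.toNat = 0 := by omega
      have h₂ : (-z).toNat = z.natAbs := by omega
      rw [h₁, h₂, Nat.zero_bits, List.nil_append]
  exact flatMap (f := fun (_ : α) z => encodeInteger z) (h.comp snd) hf

end PolyFun

/-- The part of the input that encodes the instance. -/
def inputInstance (x : List InputSymbol) : List HazingSymbol :=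
  x.flatMap (Sum.elim (fun s => [s]) fun _ => [])

/-- The part of the input that is the certificate. -/
def inputCertificate (x : List InputSymbol) : List HazingSymbol :=
  x.flatMap (Sum.elim (fun _ => []) fun s => [s])

namespace Verifier

/-- A small entry of the list of integers that describes an instance. -/
def small (L : List ℤ) (k : ℕ) : ℕ := min (L.getD k 0).toNat L.length

/-- The number of columns. -/
def cols (L : List ℤ) : ℕ := small L 1

/-- The number of action pairs. -/
def pairs (L : List ℤ) : ℕ := small L 0 * cols L

/-- The payoff of player `i` from the action pair with number `k`. -/
def pay (L : List ℤ) (i k : ℕ) : ℤ := L.getD (2 + i * pairs L + k) 0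

/-- The position of the length of the goal sequence. -/
def goalPos (L : List ℤ) : ℕ := 2 + 2 * pairs L

/-- The length of the goal sequence. -/
def goalLen (L : List ℤ) : ℤ := L.getD (goalPos L) 0

/-- The numbers of the action pairs in the goal sequence. -/
def goals (L : List ℤ) : List ℕ :=
  (List.range (small L (goalPos L))).map fun j => small L (goalPos L + 1 + j)

/-- The sum of the payoffs of player `i` from the goal sequence. -/
def goalSum (L : List ℤ) (i : ℕ) : ℤ := (goals L).foldr (fun k s => pay L i k + s) 0

/-- The hazing cost of player `i` for the action pair with number `k`, times the length of the goal
sequence. -/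
def cost (L : List ℤ) (i k : ℕ) : ℤ := goalSum L i - goalLen L * pay L i k

/-- With accumulated scaled hazing `H` (for both players), no player wants to deviate from the
action pair with number `k`. -/
def check (L : List ℤ) (k : ℕ) (H : ℤ × ℤ) : Bool :=
  (List.range (pairs L)).all fun k' =>
    (!decide (k' % cols L = k % cols L) || decide (goalLen L * pay L 0 k' < H.1 + goalSum L 0)) &&
    (!decide (k' / cols L = k / cols L) || decide (goalLen L * pay L 1 k' < H.2 + goalSum L 1))

/-- Process `m` consecutive copies of the action pair with number `k`. -/
def step (L : List ℤ) (s : Bool × ℤ × ℤ) (a : ℕ × ℤ) : Bool × ℤ × ℤ :=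
  if a.2 ≤ 0 then s else
    (s.1 && check L a.1 s.2 &&
      check L a.1 (s.2.1 + (a.2 - 1) * cost L 0 a.1, s.2.2 + (a.2 - 1) * cost L 1 a.1),
      s.2.1 + a.2 * cost L 0 a.1, s.2.2 + a.2 * cost L 1 a.1)

/-- The runs described by a list of integers. -/
def runs (L M : List ℤ) : List (ℕ × ℤ) :=
  (List.range (M.length / 2)).map fun i =>
    (min (M.getD (2 * i) 0).toNat L.length, M.getD (2 * i + 1) 0)

/-- The list of integers consists of numbers of action pairs, followed by multiplicities. -/
def valid (L M : List ℤ) : Bool :=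
  decide (M.length % 2 = 0) && M.all (fun z => decide (0 ≤ z)) &&
    (runs L M).all fun a => decide (a.1 < pairs L)

/-- The sequence of runs is a solution. -/
def accept (L M : List ℤ) : Bool :=
  let s := (runs L M).foldl (step L) (true, 0, 0)
  decide ((s.2.1 + s.2.2) * L.getD (goalPos L + 2 + small L (goalPos L)) 0
      ≤ L.getD (goalPos L + 1 + small L (goalPos L)) 0 * goalLen L) &&
    (((goals L).map fun k => (k, (1 : ℤ))).foldl (step L) s).1

/-- The verifier. -/
noncomputable def verify (x : List InputSymbol) : Bool :=
  let L := parseIntegers (inputInstance x)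
  let c := inputCertificate x
  let M := parseIntegers c
  -- Parsing accepts every string; encoding the result again rejects those that are not canonical
  -- codes.
  (open Classical in decide (encodeIntegers M = c)) && valid L M && accept L M

end Verifier

/-! ### The verifier runs in polynomial time -/

namespace PolyFun

open Verifier

variable {α : Type} [TreeEnc α] {L M : α → List ℤ} {k i : α → ℕ}

theorem small (hL : PolyFun L) (hk : PolyFun k) : PolyFun fun x => small (L x) (k x) :=
  (hL.getD hk (const 0)).min_toNat hL.length

theorem cols (hL : PolyFun L) : PolyFun fun x => cols (L x) := hL.small (const 1)

theorem pairs (hL : PolyFun L) : PolyFun fun x => pairs (L x) := (hL.small (const 0)).mul hL.cols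

theorem pay (hL : PolyFun L) (hi : PolyFun i) (hk : PolyFun k) :
    PolyFun fun x => pay (L x) (i x) (k x) :=
  hL.getD (((const 2).add (hi.mul hL.pairs)).add hk) (const 0)

theorem goalPos (hL : PolyFun L) : PolyFun fun x => goalPos (L x) :=
  (const 2).add ((const 2).mul hL.pairs)

theorem goalLen (hL : PolyFun L) : PolyFun fun x => goalLen (L x) := hL.getD hL.goalPos (const 0)

theorem goals (hL : PolyFun L) : PolyFun fun x => goals (L x) :=
  map (f := fun x j => Verifier.small (L x) (Verifier.goalPos (L x) + 1 + j))
    ((hL.comp fst).small ((hL.comp fst).goalPos.succ.add snd)) (hL.small hL.goalPos).range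

theorem goalSum (hL : PolyFun L) (hi : PolyFun i) : PolyFun fun x => goalSum (L x) (i x) := by
  have h : PolyFun fun p : (List ℤ × ℕ) × ℕ => Verifier.pay p.1.1 p.1.2 p.2 :=
    fst.proj₁.pay fst.proj₂ snd
  obtain ⟨s, hs⟩ := h.exists_size_le
  have h' : PolyFun fun p : (List ℤ × ℕ) × ℕ × ℤ => Verifier.pay p.1.1 p.1.2 p.2.1 :=
    fst.proj₁.pay fst.proj₂ snd.proj₁
  have := foldr (f := fun (p : List ℤ × ℕ) k s => Verifier.pay p.1 p.2 k + s) (b := fun _ => 0)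
    (h'.addInt snd.proj₂) (fst.goals) (const 0) (s.comp (Polynomial.X + 1) + 3) fun x b c => by
      have h₁ := hs (x, c)
      have h₂ := sz_add_int_le (Verifier.pay x.1 x.2 c) b
      rw [sz_pair] at h₁
      simp only [Polynomial.eval_add, Polynomial.eval_comp, Polynomial.eval_X,
        Polynomial.eval_one, Polynomial.eval_ofNat]
      dsimp only at h₁
      omega
  exact (this.comp (hL.pair hi)).of_eq fun _ => rfl

theorem cost (hL : PolyFun L) (hi : PolyFun i) (hk : PolyFun k) :
    PolyFun fun x => cost (L x) (i x) (k x) :=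
  (hL.goalSum hi).subInt (hL.goalLen.mulInt (hL.pay hi hk))

theorem check {H : α → ℤ × ℤ} (hL : PolyFun L) (hk : PolyFun k) (hH : PolyFun H) :
    PolyFun fun x => check (L x) (k x) (H x) := by
  refine all (p := fun x k' =>
    (!decide (k' % Verifier.cols (L x) = k x % Verifier.cols (L x)) ||
      decide (Verifier.goalLen (L x) * Verifier.pay (L x) 0 k' <
        (H x).1 + Verifier.goalSum (L x) 0)) &&
    (!decide (k' / Verifier.cols (L x) = k x / Verifier.cols (L x)) ||
      decide (Verifier.goalLen (L x) * Verifier.pay (L x) 1 k' <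
        (H x).2 + Verifier.goalSum (L x) 1))) ?_ hL.pairs.range
  have hL' := hL.comp (fst (α := α) (β := ℕ))
  have hk' := hk.comp (fst (α := α) (β := ℕ))
  have hH' := hH.comp (fst (α := α) (β := ℕ))
  have hs := snd (α := α) (β := ℕ)
  exact (((hs.mod hL'.cols).decide_eq_nat (hk'.mod hL'.cols)).not.or
      ((hL'.goalLen.mulInt (hL'.pay (const 0) hs)).decide_ltInt
        (hH'.proj₁.addInt (hL'.goalSum (const 0))))).and
    (((hs.div hL'.cols).decide_eq_nat (hk'.div hL'.cols)).not.or
      ((hL'.goalLen.mulInt (hL'.pay (const 1) hs)).decide_ltInt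
        (hH'.proj₂.addInt (hL'.goalSum (const 1)))))

/-- The increments `m * cost` depend on the list `L` and the run but not on the sums so far, so the
fold rule applies even though multiplicities are binary. -/
theorem foldl_step {l : α → List (ℕ × ℤ)} {b : α → Bool × ℤ × ℤ} (hL : PolyFun L)
    (hl : PolyFun l) (hb : PolyFun b) : PolyFun fun x => (l x).foldl (step (L x)) (b x) := by
  have hL' := hL.comp (fst (α := α) (β := ℕ × ℤ))
  have hc : ∀ i : ℕ, PolyFun fun p : α × ℕ × ℤ => p.2.2 * Verifier.cost (L p.1) i p.2.1 :=
    fun i => snd.proj₂.mulInt (hL'.cost (const i) snd.proj₁)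
  obtain ⟨q₀, h₀⟩ := (hc 0).exists_size_le
  obtain ⟨q₁, h₁⟩ := (hc 1).exists_size_le
  have hstep : PolyFun fun p : α × (Bool × ℤ × ℤ) × (ℕ × ℤ) => step (L p.1) p.2.1 p.2.2 := by
    have hL := hL.comp (fst (α := α) (β := (Bool × ℤ × ℤ) × (ℕ × ℤ)))
    have hs := (snd (α := α) (β := (Bool × ℤ × ℤ) × (ℕ × ℤ))).proj₁
    have ha := (snd (α := α) (β := (Bool × ℤ × ℤ) × (ℕ × ℤ))).proj₂
    have hH : ∀ {m : α × (Bool × ℤ × ℤ) × (ℕ × ℤ) → ℤ}, PolyFun m →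
        PolyFun fun p : α × (Bool × ℤ × ℤ) × (ℕ × ℤ) =>
          (p.2.1.2.1 + m p * Verifier.cost (L p.1) 0 p.2.2.1,
            p.2.1.2.2 + m p * Verifier.cost (L p.1) 1 p.2.2.1) := fun hm =>
      (hs.proj₂.proj₁.addInt (hm.mulInt (hL.cost (const 0) ha.proj₁))).pair
        (hs.proj₂.proj₂.addInt (hm.mulInt (hL.cost (const 1) ha.proj₁)))
    exact (ha.proj₂.decide_leInt (const 0)).ite hs
      (((hs.proj₁.and (hL.check ha.proj₁ hs.proj₂)).and
        (hL.check ha.proj₁ (hH (ha.proj₂.subInt (const 1))))).pair (hH ha.proj₂))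
  refine foldl (f := fun x s a => step (L x) s a) hstep hl hb
    ((q₀ + q₁ + 6).comp (Polynomial.X + 1)) fun x b c => ?_
  have h₂ := h₀ (x, c)
  have h₃ := h₁ (x, c)
  have h₄ := sz_add_int_le b.2.1 (c.2 * Verifier.cost (L x) 0 c.1)
  have h₅ := sz_add_int_le b.2.2 (c.2 * Verifier.cost (L x) 1 c.1)
  rw [sz_pair] at h₂ h₃
  dsimp only at h₂ h₃
  simp only [Polynomial.eval_add, Polynomial.eval_comp, Polynomial.eval_X,
    Polynomial.eval_one, Polynomial.eval_ofNat]
  unfold step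
  split_ifs
  · omega
  · simp only [sz_pair (α := Bool), sz_pair (α := ℤ), sz_bool]
    omega

theorem runs (hL : PolyFun L) (hM : PolyFun M) : PolyFun fun x => runs (L x) (M x) := by
  have hL' := hL.comp (fst (α := α) (β := ℕ))
  have hM' := hM.comp (fst (α := α) (β := ℕ))
  have hs := (const 2).mul (snd (α := α) (β := ℕ))
  exact map (f := fun x i => (min ((M x).getD (2 * i) 0).toNat (L x).length,
      (M x).getD (2 * i + 1) 0)) (((hM'.getD hs (const 0)).min_toNat hL'.length).pair
    (hM'.getD hs.succ (const 0))) (hM.length.div (const 2)).range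

theorem valid (hL : PolyFun L) (hM : PolyFun M) : PolyFun fun x => valid (L x) (M x) := by
  have h₁ := ((hM.length.mod (const 2)).decide_eq_zero)
  have hz : PolyFun fun z : ℤ => !decide (z < 0) := PolyFun.id.decide_neg.not
  have h₂ := all (p := fun _ z => !decide (z < 0)) (hz.comp snd) hM
  have hp := (hL.comp (fst (α := α) (β := ℕ × ℤ))).pairs
  have hk := (snd (α := α) (β := ℕ × ℤ)).proj₁
  have h₃ := all (p := fun x a => decide (a.1 < Verifier.pairs (L x))) (hk.decide_lt hp)
    (hL.runs hM)
  refine ((h₁.and h₂).and h₃).of_eq fun x => ?_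
  simp only [Verifier.valid, ← decide_not, not_lt]

theorem accept (hL : PolyFun L) (hM : PolyFun M) : PolyFun fun x => accept (L x) (M x) := by
  have hs := hL.foldl_step (hL.runs hM) (const (true, 0, 0))
  have hg : PolyFun fun x => (Verifier.goals (L x)).map fun k => (k, (1 : ℤ)) :=
    map (f := fun _ k => (k, (1 : ℤ))) (snd.pair (const 1)) hL.goals
  have hp := hL.small hL.goalPos
  exact (((hs.proj₂.proj₁.addInt hs.proj₂.proj₂).mulInt
      (hL.getD ((hL.goalPos.add (const 2)).add hp) (const 0))).decide_leInt
    ((hL.getD (hL.goalPos.succ.add hp) (const 0)).mulInt hL.goalLen)).and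
    (hL.foldl_step hg hs).proj₁

theorem polyFun_verify : PolyFun verify := by
  classical
  have hi : Function.Injective (enc : InputSymbol → BTree) :=
    enc_sum_injective enc_hazingSymbol_injective enc_hazingSymbol_injective
  have hL : PolyFun inputInstance := flatMap (f := fun _ => Sum.elim (fun s => [s]) fun _ => [])
    ((of_finite hi _).comp snd) PolyFun.id
  have hc : PolyFun inputCertificate :=
    flatMap (f := fun _ => Sum.elim (fun _ => []) fun s => [s])
    ((of_finite hi _).comp snd) PolyFun.id
  have hL' := polyFun_parseIntegers hL
  have hM := polyFun_parseIntegers hc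
  have heq : PolyFun fun p : HazingSymbol × HazingSymbol => decide (p.1 = p.2) :=
    of_finite (enc_prod_injective enc_hazingSymbol_injective enc_hazingSymbol_injective) _
  exact ((decide_eq_list heq (polyFun_encodeIntegers hM) hc).and (hL'.valid hM)).and
    (hL'.accept hM) |>.of_eq fun x => by
      unfold verify
      congr

end PolyFun

/-! ### Safe sequences -/

/-- With accumulated hazing `x`, no player wants to deviate while `w` is played. -/
def IsSafe {A : Type*} (h t : Fin 2 → A → ℚ) : (Fin 2 → ℚ) → List A → Prop
  | _, [] => True
  | x, a :: w => (∀ i, t i a < x i) ∧ IsSafe h t (fun i => x i + h i a) w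

section IsSafe

variable {A : Type*} {h t : Fin 2 → A → ℚ} {x y : Fin 2 → ℚ} {v w : List A}

theorem isSafe_append :
    IsSafe h t x (v ++ w) ↔ IsSafe h t x v ∧ IsSafe h t (fun i => x i + (v.map (h i)).sum) w := by
  induction v generalizing x with
  | nil => simp [IsSafe]
  | cons a v ih => simp [IsSafe, ih, and_assoc, add_assoc]

theorem isSafe_iff_getElem : IsSafe h t x w ↔
    ∀ (k : ℕ) (hk : k < w.length) (i : Fin 2), t i w[k] < x i + ((w.take k).map (h i)).sum := by
  induction w generalizing x with
  | nil => simp [IsSafe]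
  | cons a w ih =>
      rw [IsSafe, ih]
      constructor
      · rintro ⟨h₀, h₁⟩ (_ | k) hk i
        · simpa using h₀ i
        · simpa [add_assoc] using h₁ k (by simpa using hk) i
      · intro H
        refine ⟨fun i => by simpa using! H 0 (by simp) i, fun k hk i => ?_⟩
        simpa [add_assoc] using! H (k + 1) (by simpa using hk) i

/-- Along a run the accumulated hazing of each player is linear in the number of copies, hence least
at the first or at the last copy. This is why `Verifier.step` needs two checks whatever the
multiplicity. -/
theorem isSafe_replicate_succ {a : A} (m : ℕ) : IsSafe h t x (List.replicate (m + 1) a) ↔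
    (∀ i, t i a < x i) ∧ ∀ i, t i a < x i + m * h i a := by
  rw [isSafe_iff_getElem]
  constructor
  · intro H
    exact ⟨fun i => by simpa using H 0 (by simp) i, fun i => by simpa using H m (by simp) i⟩
  · rintro ⟨h₀, h₁⟩ k hk i
    have hkm : (k : ℚ) ≤ m := by
      rw [List.length_replicate] at hk
      exact_mod_cast Nat.lt_succ_iff.1 hk
    rw [List.length_replicate] at hk
    simp only [List.getElem_replicate, List.take_replicate, List.map_replicate,
      List.sum_replicate, nsmul_eq_mul, min_eq_left hk.le]
    rcases le_total 0 (h i a) with h₂ | h₂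
    · exact (h₀ i).trans_le (le_add_of_nonneg_right (by positivity))
    · exact (h₁ i).trans_le (add_le_add_right (mul_le_mul_of_nonpos_right hkm h₂) _)

end IsSafe

namespace HazingInstance

variable (I : HazingInstance)

/-- Safety of a sequence with respect to the costs and thresholds of an instance. -/
abbrev Safe (x : Fin 2 → ℚ) (w : List I.game.Pair) : Prop := IsSafe I.hazing I.threshold x w

/-- The goal threshold is the maximum of the requirements that the single goal entries put on the
hazing at the start of the pass. -/
theorem safe_goal {x : Fin 2 → ℚ} :
    I.Safe x (List.ofFn I.goal) ↔ ∀ i, I.goalThreshold i < x i := by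
  rw [Safe, isSafe_iff_getElem]
  have hsum : ∀ (i : Fin 2) (k : Fin I.r), (((List.ofFn I.goal).take k).map (I.hazing i)).sum
      = ∑ j ∈ Finset.Iio k, I.hazing i (I.goal j) := by
    intro i k
    rw [List.map_take, List.map_ofFn, List.sum_take_ofFn]
    congr 1
    ext j
    simp
  have hlt : ∀ i, I.goalThreshold i < x i ↔ ∀ k, I.threshold i (I.goal k)
      < x i + ∑ j ∈ Finset.Iio k, I.hazing i (I.goal j) := fun i =>
    (Finset.sup'_lt_iff _).trans (by simp only [Finset.mem_univ, true_implies, sub_lt_iff_lt_add])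
  simp only [hlt]
  constructor
  · intro H i k
    have := H k (by simp) i
    rw [hsum] at this
    simpa using this
  · intro H k hk i
    rw [List.length_ofFn] at hk
    have := H i ⟨k, hk⟩
    rw [← hsum] at this
    simpa using this

theorem isSolution_iff {w : List I.game.Pair} :
    I.IsSolution w ↔ I.totalHazing w ≤ I.bound ∧ I.Safe 0 (w ++ List.ofFn I.goal) := by
  rw [Safe, isSafe_append, ← Safe, ← Safe, safe_goal, Safe, isSafe_iff_getElem, IsSolution,
    IsMinHazingSolution, totalHazing]
  simp only [Pi.zero_apply, zero_add]
  tauto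

end HazingInstance

/-! ### Correctness of the verifier -/

namespace HazingInstance

variable (I : HazingInstance)

/-- The number of an action pair. -/
def index (a : I.game.Pair) : ℕ := (finProdFinEquiv a : Fin (I.game.rows * I.game.cols))

theorem index_lt (a : I.game.Pair) : I.index a < I.n := (finProdFinEquiv a).isLt

theorem index_eq (a : I.game.Pair) : I.index a = a.2 + I.game.cols * a.1 := rfl

theorem index_mod (a : I.game.Pair) : I.index a % I.game.cols = a.2 := by
  rw [index_eq, Nat.add_mul_mod_self_left, Nat.mod_eq_of_lt a.2.isLt]

theorem index_div (a : I.game.Pair) : I.index a / I.game.cols = a.1 := by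
  rw [index_eq, Nat.add_mul_div_left _ _ (a.2.pos), Nat.div_eq_of_lt a.2.isLt, zero_add]

theorem exists_index {k : ℕ} (hk : k < I.n) : ∃ a, I.index a = k :=
  ⟨finProdFinEquiv.symm ⟨k, hk⟩, by rw [index, Equiv.apply_symm_apply]⟩

theorem length_toIntegers : I.toIntegers.length = 2 * I.n + I.r + 5 := by
  simp [toIntegers, n, RestartGame.numPairs]
  omega

theorem rows_pos : 0 < I.game.rows := (I.goal ⟨0, I.r_pos⟩).1.pos

theorem cols_pos : 0 < I.game.cols := (I.goal ⟨0, I.r_pos⟩).2.pos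


/-- Reads an entry of the concatenated description of an instance, given the block that contains it.
-/
theorem getD_of_eq_append {l u v w : List ℤ} (hl : l = u ++ v ++ w) (k : ℕ) (hk : k < v.length)
    {p : ℕ} (hp : p = u.length + k) : l.getD p 0 = v[k] := by
  subst hl hp
  rw [List.append_assoc, List.getD_append_right _ _ _ _ (by omega), Nat.add_sub_cancel_left,
    List.getD_append _ _ _ _ hk, List.getD_eq_getElem]

theorem toIntegers_getD_zero : I.toIntegers.getD 0 0 = I.game.rows := rfl

theorem toIntegers_getD_one : I.toIntegers.getD 1 0 = I.game.cols := rfl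

theorem toIntegers_getD_payoff (i : Fin 2) (a : I.game.Pair) :
    I.toIntegers.getD (2 + i * I.n + I.index a) 0 = I.game.payoff i a := by
  have ha := I.index_lt a
  have h : finProdFinEquiv.symm ⟨I.index a, ha⟩ = a := Equiv.symm_apply_apply _ a
  refine (getD_of_eq_append (v := List.ofFn fun j => I.game.payoff i (finProdFinEquiv.symm j))
    (u := [(I.game.rows : ℤ), (I.game.cols : ℤ)] ++ if i = 0 then [] else
      List.ofFn fun j => I.game.payoff 0 (finProdFinEquiv.symm j))
    (w := (if i = 0 then List.ofFn fun j => I.game.payoff 1 (finProdFinEquiv.symm j) else []) ++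
      [(I.r : ℤ)] ++ List.ofFn (fun j => I.game.pairIndex (I.goal j)) ++
      [I.bound.num, (I.bound.den : ℤ)]) ?_ (I.index a) ?_ ?_).trans ?_
  · fin_cases i <;> simp [toIntegers]
  · rw [List.length_ofFn]
    exact ha
  · fin_cases i <;> simp [n, RestartGame.numPairs]
    omega
  · rw [List.getElem_ofFn]
    exact congrArg _ h

theorem toIntegers_getD_length : I.toIntegers.getD (2 + 2 * I.n) 0 = I.r := by
  refine getD_of_eq_append (v := [(I.r : ℤ)]) (by rw [toIntegers, List.append_assoc _ _ [_, _]]) 0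
    (by simp) ?_
  simp [n, RestartGame.numPairs]
  omega

theorem toIntegers_getD_goal (j : Fin I.r) :
    I.toIntegers.getD (2 + 2 * I.n + 1 + j) 0 = I.index (I.goal j) := by
  refine (getD_of_eq_append (by rw [toIntegers]) (j : ℕ) (by simp) ?_).trans ?_
  · simp [n, RestartGame.numPairs]
    omega
  · rw [List.getElem_ofFn]
    rfl

theorem toIntegers_getD_num : I.toIntegers.getD (2 + 2 * I.n + 1 + I.r) 0 = I.bound.num := by
  refine getD_of_eq_append (w := []) ((List.append_nil _).symm) 0 (by simp) ?_
  simp [n, RestartGame.numPairs]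
  omega

theorem toIntegers_getD_den : I.toIntegers.getD (2 + 2 * I.n + 2 + I.r) 0 = I.bound.den := by
  refine getD_of_eq_append (w := []) ((List.append_nil _).symm) 1 (by simp) ?_
  simp [n, RestartGame.numPairs]
  omega

/-- On a genuine instance the cap by the list length does not bite: the description is longer than
all dimensions and indices. The cap only keeps unary conversion polynomial. -/
theorem small_toIntegers {k m : ℕ} (h : I.toIntegers.getD k 0 = m) (hm : m ≤ 2 * I.n + I.r + 5) :
    Verifier.small I.toIntegers k = m := by
  rw [Verifier.small, h, length_toIntegers, Int.toNat_natCast, min_eq_left hm]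

theorem rows_le : I.game.rows ≤ I.n := Nat.le_mul_of_pos_right _ I.cols_pos

theorem cols_le : I.game.cols ≤ I.n := Nat.le_mul_of_pos_left _ I.rows_pos

theorem cols_toIntegers : Verifier.cols I.toIntegers = I.game.cols :=
  I.small_toIntegers I.toIntegers_getD_one (by have := I.cols_le; omega)

theorem pairs_toIntegers : Verifier.pairs I.toIntegers = I.n := by
  rw [Verifier.pairs, cols_toIntegers,
    I.small_toIntegers I.toIntegers_getD_zero (by have := I.rows_le; omega)]
  rfl

theorem pay_toIntegers (i : Fin 2) (a : I.game.Pair) :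
    Verifier.pay I.toIntegers i (I.index a) = I.game.payoff i a := by
  rw [Verifier.pay, pairs_toIntegers, toIntegers_getD_payoff]

theorem goalPos_toIntegers : Verifier.goalPos I.toIntegers = 2 + 2 * I.n := by
  rw [Verifier.goalPos, pairs_toIntegers]

theorem goalLen_toIntegers : Verifier.goalLen I.toIntegers = I.r := by
  rw [Verifier.goalLen, goalPos_toIntegers, toIntegers_getD_length]

theorem small_goalPos : Verifier.small I.toIntegers (Verifier.goalPos I.toIntegers) = I.r := by
  rw [goalPos_toIntegers]
  exact I.small_toIntegers I.toIntegers_getD_length (by omega)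

theorem goals_toIntegers :
    Verifier.goals I.toIntegers = (List.ofFn I.goal).map I.index := by
  rw [Verifier.goals, small_goalPos, goalPos_toIntegers, List.map_ofFn]
  refine List.ext_getElem (by simp) fun k h₁ h₂ => ?_
  have hk : k < I.r := by simpa using h₁
  simp only [List.getElem_map, List.getElem_range, List.getElem_ofFn, Function.comp_apply]
  exact I.small_toIntegers (I.toIntegers_getD_goal ⟨k, hk⟩)
    (by have := I.index_lt (I.goal ⟨k, hk⟩); omega)

theorem goalSum_toIntegers (i : Fin 2) :
    Verifier.goalSum I.toIntegers i = ∑ j, I.game.payoff i (I.goal j) := by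
  rw [Verifier.goalSum, goals_toIntegers, List.foldr_map]
  simp only [pay_toIntegers]
  rw [← List.sum_ofFn, ← Function.comp_def, ← List.map_ofFn, List.sum_eq_foldr, List.foldr_map]

theorem r_mul_goalValue (i : Fin 2) :
    (I.r : ℚ) * I.goalValue i = (Verifier.goalSum I.toIntegers i : ℤ) := by
  have hr : (I.r : ℚ) ≠ 0 := by exact_mod_cast I.r_pos.ne'
  rw [goalSum_toIntegers, goalValue, mul_div_cancel₀ _ hr]
  push_cast
  rfl

theorem cost_toIntegers (i : Fin 2) (a : I.game.Pair) :
    (Verifier.cost I.toIntegers i (I.index a) : ℚ) = I.r * I.hazing i a := by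
  rw [Verifier.cost, hazing, mul_sub, r_mul_goalValue, goalLen_toIntegers, pay_toIntegers]
  push_cast
  rfl

/-- Multiplication by `r` clears the denominators of the goal value, and a bound on the best
deviation is a bound on every deviation. -/
theorem threshold_lt_iff {i : Fin 2} {a : I.game.Pair} {x : ℚ} {H : ℤ} (hH : (H : ℚ) = I.r * x) :
    I.threshold i a < x ↔
      ∀ b, I.r * I.game.payoff i (I.game.deviate i b a) < H + Verifier.goalSum I.toIntegers i := by
  have hr : (0 : ℚ) < I.r := by exact_mod_cast I.r_pos
  have h₁ : I.threshold i a < x ↔ (I.r * I.game.deviationPayoff i a : ℤ)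
      < H + Verifier.goalSum I.toIntegers i := by
    rw [threshold, sub_lt_iff_lt_add, ← mul_lt_mul_iff_right₀ hr, mul_add, ← hH, r_mul_goalValue]
    exact_mod_cast Iff.rfl
  rw [h₁]
  constructor
  · intro h b
    refine lt_of_le_of_lt (mul_le_mul_of_nonneg_left ?_ (by positivity)) h
    exact Finset.le_sup' (fun b => I.game.payoff i (I.game.deviate i b a)) (Finset.mem_univ b)
  · intro h
    obtain ⟨b, -, hb⟩ := Finset.exists_mem_eq_sup' (I.game.action_nonempty i a)
      fun b => I.game.payoff i (I.game.deviate i b a)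
    rw [RestartGame.deviationPayoff, hb]
    exact h b

/-- In row-major order, the deviations of player `0` are the indices with the same remainder modulo
the number of columns, and those of player `1` are the indices with the same quotient. -/
theorem check_toIntegers {a : I.game.Pair} {x : Fin 2 → ℚ} {H : ℤ × ℤ}
    (h₀ : (H.1 : ℚ) = I.r * x 0) (h₁ : (H.2 : ℚ) = I.r * x 1) :
    Verifier.check I.toIntegers (I.index a) H = true ↔ ∀ i, I.threshold i a < x i := by
  rw [Fin.forall_fin_two, I.threshold_lt_iff h₀, I.threshold_lt_iff h₁, Verifier.check,
    List.all_eq_true]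
  simp only [List.mem_range, pairs_toIntegers, cols_toIntegers, goalLen_toIntegers, index_mod,
    index_div, Bool.and_eq_true, Bool.or_eq_true, Bool.not_eq_true', decide_eq_false_iff_not,
    decide_eq_true_eq]
  have h : ∀ P : ℕ → Prop, (∀ k < I.n, P k) ↔ ∀ a, P (I.index a) := fun P =>
    ⟨fun H a => H _ (I.index_lt a), fun H k hk => by
      obtain ⟨a, rfl⟩ := I.exists_index hk
      exact H a⟩
  rw [h]
  have hp := I.pay_toIntegers
  have hp₀ : ∀ a, Verifier.pay I.toIntegers 0 (I.index a) = I.game.payoff 0 a := hp 0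
  have hp₁ : ∀ a, Verifier.pay I.toIntegers 1 (I.index a) = I.game.payoff 1 a := hp 1
  simp only [index_mod, index_div, hp₀, hp₁]
  constructor
  · intro H'
    refine ⟨fun b => ?_, fun b => ?_⟩
    · exact (H' (b, a.2)).1.resolve_left (by simp)
    · exact (H' (a.1, b)).2.resolve_left (by simp)
  · rintro ⟨H₀, H₁⟩ ⟨b₀, b₁⟩
    refine ⟨or_iff_not_imp_left.2 fun hb => ?_, or_iff_not_imp_left.2 fun hb => ?_⟩
    · obtain rfl : b₁ = a.2 := Fin.ext (not_not.1 hb)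
      exact H₀ b₀
    · obtain rfl : b₀ = a.1 := Fin.ext (not_not.1 hb)
      exact H₁ b₁

/-- The verifier's form of a run. -/
def indexRun (a : I.game.Pair × ℕ) : ℕ × ℤ := (I.index a.1, a.2)

theorem step_toIntegers {x : Fin 2 → ℚ} {s : Bool × ℤ × ℤ} (a : I.game.Pair × ℕ)
    (h₀ : (s.2.1 : ℚ) = I.r * x 0) (h₁ : (s.2.2 : ℚ) = I.r * x 1) :
    ((Verifier.step I.toIntegers s (I.indexRun a)).1 = true ↔
      s.1 = true ∧ I.Safe x (List.replicate a.2 a.1)) ∧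
    ((Verifier.step I.toIntegers s (I.indexRun a)).2.1 : ℚ)
      = I.r * (x 0 + a.2 * I.hazing 0 a.1) ∧
    ((Verifier.step I.toIntegers s (I.indexRun a)).2.2 : ℚ)
      = I.r * (x 1 + a.2 * I.hazing 1 a.1) := by
  have hc₀ : (Verifier.cost I.toIntegers 0 (I.index a.1) : ℚ) = _ := I.cost_toIntegers 0 a.1
  have hc₁ : (Verifier.cost I.toIntegers 1 (I.index a.1) : ℚ) = _ := I.cost_toIntegers 1 a.1
  obtain ⟨a, _ | m⟩ := a
  · simp [Verifier.step, indexRun, IsSafe, h₀, h₁]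
  · have hm : ¬ ((m + 1 : ℕ) : ℤ) ≤ 0 := by omega
    rw [Verifier.step, indexRun, if_neg hm]
    refine ⟨?_, ?_, ?_⟩
    · rw [Bool.and_eq_true, Bool.and_eq_true, and_assoc, I.check_toIntegers h₀ h₁,
        I.check_toIntegers (x := fun i => x i + m * I.hazing i a), Safe, isSafe_replicate_succ]
      · push_cast
        rw [hc₀, h₀]
        ring
      · push_cast
        rw [hc₁, h₁]
        ring
    · push_cast
      rw [hc₀, h₀]
      ring
    · push_cast
      rw [hc₁, h₁]
      ring

theorem foldl_step_toIntegers (u : List (I.game.Pair × ℕ)) {x : Fin 2 → ℚ} {s : Bool × ℤ × ℤ}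
    (h₀ : (s.2.1 : ℚ) = I.r * x 0) (h₁ : (s.2.2 : ℚ) = I.r * x 1) :
    (((u.map I.indexRun).foldl (Verifier.step I.toIntegers) s).1 = true ↔
      s.1 = true ∧ I.Safe x (expandRuns u)) ∧
    (((u.map I.indexRun).foldl (Verifier.step I.toIntegers) s).2.1 : ℚ)
      = I.r * (x 0 + ((expandRuns u).map (I.hazing 0)).sum) ∧
    (((u.map I.indexRun).foldl (Verifier.step I.toIntegers) s).2.2 : ℚ)
      = I.r * (x 1 + ((expandRuns u).map (I.hazing 1)).sum) := by
  induction u generalizing x s with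
  | nil => simp [expandRuns, IsSafe, h₀, h₁]
  | cons a u ih =>
      obtain ⟨H, H₀, H₁⟩ := I.step_toIntegers a h₀ h₁
      have := ih (x := fun i => x i + a.2 * I.hazing i a.1) H₀ H₁
      rw [H] at this
      rw [List.map_cons, List.foldl_cons]
      have he : expandRuns (a :: u) = List.replicate a.2 a.1 ++ expandRuns u := rfl
      rw [he, Safe, isSafe_append]
      simpa [and_assoc, add_assoc] using this

theorem accept_toIntegers {M : List ℤ} {u : List (I.game.Pair × ℕ)}
    (hu : Verifier.runs I.toIntegers M = u.map I.indexRun) :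
    Verifier.accept I.toIntegers M = true ↔ I.IsSolution (expandRuns u) := by
  obtain ⟨H, H₀, H₁⟩ := I.foldl_step_toIntegers u (x := 0) (s := (true, 0, 0)) (by simp) (by simp)
  have hg : (Verifier.goals I.toIntegers).map (fun k => (k, (1 : ℤ)))
      = ((List.ofFn I.goal).map fun a => (a, 1)).map I.indexRun := by
    rw [goals_toIntegers, List.map_map, List.map_map]
    rfl
  have he : expandRuns ((List.ofFn I.goal).map fun a => (a, 1)) = List.ofFn I.goal := by
    rw [expandRuns, List.flatMap_map]
    exact List.flatMap_singleton' _
  -- The goal sequence is processed as runs of multiplicity one, starting from the hazing that the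
  -- certificate has accumulated.
  obtain ⟨H', -, -⟩ := I.foldl_step_toIntegers ((List.ofFn I.goal).map fun a => (a, 1))
    (x := fun i => (0 : Fin 2 → ℚ) i + ((expandRuns u).map (I.hazing i)).sum) H₀ H₁
  have hr : (0 : ℚ) < I.r := by exact_mod_cast I.r_pos
  have hd : (0 : ℚ) < I.bound.den := by exact_mod_cast I.bound.den_pos
  rw [Verifier.accept, hu, hg, Bool.and_eq_true, H', H, he, small_goalPos, goalPos_toIntegers,
    toIntegers_getD_num, toIntegers_getD_den, goalLen_toIntegers, isSolution_iff,
    show I.Safe 0 (_ ++ _) ↔ _ from isSafe_append, decide_eq_true_eq, totalHazing, ← @Int.cast_le ℚ]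
  push_cast
  rw [H₀, H₁]
  refine and_congr ?_ (by simp)
  rw [← mul_add, mul_comm _ (I.r : ℚ), mul_assoc, mul_le_mul_iff_right₀ hr, ← le_div_iff₀ hd, Rat.num_div_den, List.sum_map_add]
  simp

end HazingInstance

namespace Verifier

theorem exists_flatMap_pair (M : List ℤ) (h : M.length % 2 = 0) :
    ∃ u : List (ℤ × ℤ), M = u.flatMap fun a => [a.1, a.2] := by
  match M with
  | [] => exact ⟨[], rfl⟩
  | [_] => simp at h
  | a :: b :: M =>
      obtain ⟨u, hu⟩ := exists_flatMap_pair M (by simpa [add_assoc] using h)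
      exact ⟨(a, b) :: u, by simp [← hu]⟩

theorem length_flatMap_pair (u : List (ℤ × ℤ)) :
    (u.flatMap fun a => [a.1, a.2]).length = 2 * u.length := by
  simp [List.length_flatMap, mul_comm]

theorem runs_flatMap_pair (L : List ℤ) (u : List (ℤ × ℤ)) :
    runs L (u.flatMap fun a => [a.1, a.2]) = u.map fun a => (min a.1.toNat L.length, a.2) := by
  rw [runs, length_flatMap_pair, Nat.mul_div_cancel_left _ two_pos]
  induction u with
  | nil => rfl
  | cons a u ih =>
      rw [List.length_cons, List.range_succ_eq_map, List.map_cons, List.map_map, List.map_cons,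
        ← ih]
      rfl

end Verifier

/-! ### The verifier on an encoded instance and an arbitrary certificate -/

namespace HazingInstance

variable (I : HazingInstance)

theorem inputInstance_verifierInput (c : List HazingSymbol) :
    inputInstance (verifierInput encode (I, c)) = I.encode := by
  simp [inputInstance, verifierInput, List.flatMap_append, List.flatMap_map]

theorem inputCertificate_verifierInput (c : List HazingSymbol) :
    inputCertificate (verifierInput encode (I, c)) = c := by
  simp [inputCertificate, verifierInput, List.flatMap_append, List.flatMap_map]

theorem encodeRuns_eq (u : List (I.game.Pair × ℕ)) :
    (u.flatMap fun a => [I.game.pairIndex a.1, (a.2 : ℤ)])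
      = (u.map fun a => (I.game.pairIndex a.1, (a.2 : ℤ))).flatMap fun a => [a.1, a.2] := by
  rw [List.flatMap_map]

theorem index_le_length (a : I.game.Pair) : I.index a ≤ I.toIntegers.length := by
  have := I.index_lt a
  rw [length_toIntegers]
  omega

theorem runs_toIntegers (u : List (I.game.Pair × ℕ)) :
    Verifier.runs I.toIntegers (u.flatMap fun a => [I.game.pairIndex a.1, (a.2 : ℤ)])
      = u.map I.indexRun := by
  rw [encodeRuns_eq, Verifier.runs_flatMap_pair, List.map_map]
  refine List.map_congr_left fun a _ => ?_
  exact congrArg (·, (a.2 : ℤ)) (min_eq_left (I.index_le_length a.1))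

theorem valid_toIntegers (M : List ℤ) : Verifier.valid I.toIntegers M = true ↔
    ∃ u : List (I.game.Pair × ℕ), M = u.flatMap fun a => [I.game.pairIndex a.1, (a.2 : ℤ)] := by
  simp only [Verifier.valid, Bool.and_eq_true, decide_eq_true_eq, List.all_eq_true,
    pairs_toIntegers]
  constructor
  · rintro ⟨⟨h₀, h₁⟩, h₂⟩
    obtain ⟨v, rfl⟩ := Verifier.exists_flatMap_pair M h₀
    rw [Verifier.runs_flatMap_pair, List.forall_mem_map] at h₂
    have hv : v ∈ Set.range (List.map fun a : I.game.Pair × ℕ =>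
        (I.game.pairIndex a.1, (a.2 : ℤ))) := by
      rw [Set.range_list_map]
      intro a ha
      have ha₁ : 0 ≤ a.1 := h₁ _ (List.mem_flatMap.2 ⟨a, ha, by simp⟩)
      have ha₂ : 0 ≤ a.2 := h₁ _ (List.mem_flatMap.2 ⟨a, ha, by simp⟩)
      -- The cap exceeds `n`, so a capped number below `n` has not been changed by the cap.
      have hlt : a.1.toNat < I.n := by
        have := h₂ a ha
        rw [length_toIntegers] at this
        dsimp only at this
        omega
      obtain ⟨b, hb⟩ := I.exists_index hlt
      refine ⟨(b, a.2.toNat), Prod.ext ?_ (Int.toNat_of_nonneg ha₂)⟩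
      refine Eq.trans ?_ (Int.toNat_of_nonneg ha₁)
      exact congrArg Nat.cast hb
    obtain ⟨u, rfl⟩ := hv
    exact ⟨u, (I.encodeRuns_eq u).symm⟩
  · rintro ⟨u, rfl⟩
    refine ⟨⟨?_, ?_⟩, ?_⟩
    · rw [encodeRuns_eq, Verifier.length_flatMap_pair, Nat.mul_mod_right]
    · intro z hz
      obtain ⟨a, -, ha⟩ := List.mem_flatMap.1 hz
      rcases List.mem_pair.1 ha with rfl | rfl <;> exact Int.natCast_nonneg _
    · rw [runs_toIntegers, List.forall_mem_map]
      exact fun a _ => I.index_lt a.1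

theorem verify_verifierInput (c : List HazingSymbol) :
    Verifier.verify (verifierInput encode (I, c)) = true ↔ I.IsRunLengthWitness c := by
  rw [Verifier.verify, inputInstance_verifierInput, inputCertificate_verifierInput, encode,
    parseIntegers_encodeIntegers]
  simp only [Bool.and_eq_true, decide_eq_true_eq, valid_toIntegers]
  constructor
  · rintro ⟨⟨hc, u, hu⟩, ha⟩
    rw [hu, I.accept_toIntegers (I.runs_toIntegers u)] at ha
    exact ⟨u, by rw [RestartGame.encodeRuns, ← hu, hc], ha⟩
  · rintro ⟨u, rfl, hu⟩
    rw [RestartGame.encodeRuns, parseIntegers_encodeIntegers]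
    exact ⟨⟨rfl, u, rfl⟩, (I.accept_toIntegers (I.runs_toIntegers u)).2 hu⟩

theorem polyTimeDecidable_isRunLengthWitness :
    PolyTimeDecidable encode IsRunLengthWitness :=
  ⟨fun x => Verifier.verify (verifierInput encode x), verify_verifierInput,
    PolyFun.polyFun_verify.tm2ComputableInPolyTime _⟩

end HazingInstance

/-! ### Discounted sums of eventually periodic sequences -/

section Discounted

variable {f : ℕ → ℝ} {C β : ℝ}

theorem summable_pow_mul_of_bounded (hf : ∀ t, |f t| ≤ C) (h₀ : 0 ≤ β) (h₁ : β < 1) :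
    Summable fun t => β ^ t * f t :=
  Summable.of_norm_bounded ((summable_geometric_of_lt_one h₀ h₁).mul_right C) fun t => by
    rw [norm_mul, Real.norm_eq_abs, Real.norm_eq_abs, abs_of_nonneg (pow_nonneg h₀ t)]
    exact mul_le_mul_of_nonneg_left (hf t) (pow_nonneg h₀ t)

theorem tsum_pow_mul_eq (hf : ∀ t, |f t| ≤ C) (h₀ : 0 ≤ β) (h₁ : β < 1) (k : ℕ) :
    ∑' t, β ^ t * f t = ∑ t ∈ Finset.range k, β ^ t * f t + β ^ k * ∑' t, β ^ t * f (t + k) := by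
  rw [← (summable_pow_mul_of_bounded hf h₀ h₁).sum_add_tsum_nat_add k, ← tsum_mul_left]
  congr 2
  ext t
  ring

theorem tendsto_sum_pow_mul (f : ℕ → ℝ) (k : ℕ) :
    Tendsto (fun β : ℝ => ∑ t ∈ Finset.range k, β ^ t * f t) (𝓝[<] 1)
      (𝓝 (∑ t ∈ Finset.range k, f t)) := by
  have h : Continuous fun β : ℝ => ∑ t ∈ Finset.range k, β ^ t * f t := by fun_prop
  simpa using (h.tendsto 1).mono_left nhdsWithin_le_nhds

theorem eventually_discount : ∀ᶠ β : ℝ in 𝓝[<] 1, 0 ≤ β ∧ β < 1 := by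
  have h : ∀ᶠ β : ℝ in 𝓝[<] 1, (0 : ℝ) < β :=
    nhdsWithin_le_nhds (lt_mem_nhds one_pos)
  filter_upwards [h, self_mem_nhdsWithin] with β h₀ h₁ using ⟨h₀.le, h₁⟩

/-- The normalized discounted sum of an eventually periodic sequence tends to the mean over a
period. -/
theorem tendsto_one_sub_mul_tsum (hf : ∀ t, |f t| ≤ C) {r : ℕ} (hr : 0 < r) (N : ℕ)
    (hper : ∀ t, f (t + r + N) = f (t + N)) :
    Tendsto (fun β : ℝ => (1 - β) * ∑' t, β ^ t * f t) (𝓝[<] 1)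
      (𝓝 ((∑ t ∈ Finset.range r, f (t + N)) / r)) := by
  have hr' : (r : ℝ) ≠ 0 := by exact_mod_cast hr.ne'
  have h₁ := (tendsto_sum_pow_mul (fun t => f (t + N)) r).div (tendsto_sum_pow_mul (fun _ => 1) r)
    (by simpa using hr')
  have h₂ : Tendsto (fun β : ℝ => 1 - β) (𝓝[<] 1) (𝓝 0) := by
    have : Tendsto (fun β : ℝ => 1 - β) (𝓝 1) (𝓝 (1 - 1)) := by
      exact (continuous_const.sub continuous_id).tendsto 1
    simpa using this.mono_left nhdsWithin_le_nhds
  have h₃ : Tendsto (fun β : ℝ => β ^ N) (𝓝[<] 1) (𝓝 1) := by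
    simpa using ((continuous_pow N).tendsto (1 : ℝ)).mono_left nhdsWithin_le_nhds
  -- The first `N` terms vanish in the limit because of the factor `1 - β`. The periodic rest is a
  -- quotient of two finite sums over one period.
  have h₄ := (h₂.mul (tendsto_sum_pow_mul f N)).add (h₃.mul h₁)
  simp only [zero_mul, one_mul, zero_add, Finset.sum_const, Finset.card_range, nsmul_eq_mul,
    mul_one] at h₄
  refine h₄.congr' ?_
  filter_upwards [eventually_discount] with β hβ
  have hN : ∀ t, |f (t + N)| ≤ C := fun t => hf _
  -- Shifting by one period reproduces the tail, so it equals one period's sum plus `β ^ r` times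
  -- itself. The factor `1 - β ^ r` is cancelled by the geometric sum.
  have hp := tsum_pow_mul_eq hN hβ.1 hβ.2 r
  simp only [hper] at hp
  have hg : (∑ t ∈ Finset.range r, β ^ t) * (1 - β) = 1 - β ^ r := geom_sum_mul_neg β r
  have hpos : 0 < ∑ t ∈ Finset.range r, β ^ t := geom_sum_pos hβ.1 hr.ne'
  rw [tsum_pow_mul_eq hf hβ.1 hβ.2 N, mul_add, mul_left_comm]
  congr 2
  rw [Pi.div_apply, div_eq_iff hpos.ne', mul_right_comm, mul_comm (1 - β), hg]
  linarith

end Discounted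

namespace HazingInstance

variable (I : HazingInstance)

/-! ### Stable sequences satisfy the constraints -/

theorem sequence_add (w : List I.game.Pair) (t : ℕ) :
    I.sequence w (t + w.length) = I.goal ⟨t % I.r, Nat.mod_lt _ I.r_pos⟩ := by
  rw [sequence, dif_neg (by omega)]
  congr 2
  rw [Nat.add_sub_cancel]

theorem sequence_eq_getElem (w : List I.game.Pair) {k : ℕ}
    (hk : k < (w ++ List.ofFn I.goal).length) :
    I.sequence w k = (w ++ List.ofFn I.goal)[k] := by
  rcases lt_or_ge k w.length with h | h
  · rw [sequence, dif_pos h, List.getElem_append_left h]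
  · obtain ⟨j, rfl⟩ := Nat.exists_eq_add_of_le' h
    have hj : j < I.r := by
      rw [List.length_append, List.length_ofFn] at hk
      omega
    rw [sequence_add, List.getElem_append_right h, List.getElem_ofFn]
    congr 2
    simp [Nat.mod_eq_of_lt hj]

theorem tendsto_one_sub_mul_utility (w : List I.game.Pair) (i : Fin 2) :
    Tendsto (fun β => (1 - β) * I.game.utility β i (I.sequence w)) (𝓝[<] 1)
      (𝓝 (I.goalValue i : ℝ)) := by
  obtain ⟨C, hC⟩ := (Set.finite_range fun a : I.game.Pair =>
    |(I.game.payoff i a : ℝ)|).bddAbove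
  have := tendsto_one_sub_mul_tsum (f := fun t => (I.game.payoff i (I.sequence w t) : ℝ))
    (fun t => hC ⟨_, rfl⟩) I.r_pos w.length fun t => by simp [sequence_add]
  convert! this using 2
  rw [goalValue, Finset.sum_range]
  push_cast
  congr 1
  refine Finset.sum_congr rfl fun j _ => ?_
  rw [sequence_add]
  congr 4
  exact Fin.ext (Nat.mod_eq_of_lt j.isLt).symm

/-- The restarted tail is `β ^ (k + 1)` times the full utility. What remains of the utility has the
factor `1 - β ^ (k + 1)`, a geometric sum times `1 - β`, and contributes `k + 1` goal values in the
limit. -/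
theorem tendsto_utility_sub (w : List I.game.Pair) (i : Fin 2) (k : ℕ) (b : I.game.Action i) :
    Tendsto (fun β => I.game.utility β i (I.sequence w)
        - I.game.restartUtility β i (I.sequence w) k b) (𝓝[<] 1)
      (𝓝 ((k + 1) * (I.goalValue i : ℝ)
        - ∑ t ∈ Finset.range k, (I.game.payoff i (I.sequence w t) : ℝ)
        - I.game.payoff i (I.game.deviate i b (I.sequence w k)))) := by
  have h₁ := tendsto_sum_pow_mul (fun _ => 1) (k + 1)
  have h₂ : Tendsto (fun β : ℝ => β ^ k) (𝓝[<] 1) (𝓝 1) := by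
    simpa using ((continuous_pow k).tendsto (1 : ℝ)).mono_left nhdsWithin_le_nhds
  have h₃ := ((h₁.mul (I.tendsto_one_sub_mul_utility w i)).sub
    (tendsto_sum_pow_mul (fun t => (I.game.payoff i (I.sequence w t) : ℝ)) k)).sub
    (h₂.mul_const (I.game.payoff i (I.game.deviate i b (I.sequence w k)) : ℝ))
  simp only [mul_one, one_mul, Finset.sum_const, Finset.card_range, nsmul_eq_mul] at h₃
  push_cast at h₃
  refine h₃.congr fun β => ?_
  have hg : (∑ t ∈ Finset.range (k + 1), β ^ t) * (1 - β) = 1 - β ^ (k + 1) :=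
    geom_sum_mul_neg β (k + 1)
  have ht : ∑' t, β ^ (k + 1 + t) * (I.game.payoff i (I.sequence w t) : ℝ)
      = β ^ (k + 1) * I.game.utility β i (I.sequence w) := by
    rw [RestartGame.utility, ← tsum_mul_left]
    congr 1
    ext t
    ring
  rw [RestartGame.restartUtility, ht, ← mul_assoc, hg]
  ring

/-- Stability against a best deviation at time `k`. Of the `k + 1` goal values in the limit, `k`
combine with the payoffs to the accumulated hazing and one belongs to the threshold. -/
theorem safe_of_isStableHazing {w : List I.game.Pair} (hw : I.IsStableHazing w) :
    I.Safe 0 (w ++ List.ofFn I.goal) := by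
  rw [Safe, isSafe_iff_getElem]
  intro k hk i
  obtain ⟨b, -, hb⟩ := Finset.exists_mem_eq_sup' (I.game.action_nonempty i (I.sequence w k))
    fun b => I.game.payoff i (I.game.deviate i b (I.sequence w k))
  obtain ⟨L, hL, hlim⟩ := hw i k b
  have hL' := tendsto_nhds_unique hlim (I.tendsto_utility_sub w i k b)
  have hsum : (((w ++ List.ofFn I.goal).take k).map (I.hazing i)).sum
      = k * I.goalValue i - ∑ t ∈ Finset.range k, (I.game.payoff i (I.sequence w t) : ℚ) := by
    have h : ∀ m ≤ (w ++ List.ofFn I.goal).length,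
        (((w ++ List.ofFn I.goal).take m).map (I.hazing i)).sum
      = m * I.goalValue i - ∑ t ∈ Finset.range m, (I.game.payoff i (I.sequence w t) : ℚ) := by
      intro m
      induction m with
      | zero => simp
      | succ m ih =>
          intro hm
          rw [List.take_succ_eq_append_getElem hm, List.map_append, List.sum_append,
            ih (Nat.le_of_lt hm), Finset.sum_range_succ, sequence_eq_getElem I w hm]
          simp [hazing]
          ring
    exact h k hk.le
  rw [← sequence_eq_getElem I w hk, hsum, threshold, RestartGame.deviationPayoff, hb]
  have : (0 : ℝ) < ((k * I.goalValue i - ∑ t ∈ Finset.range k,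
      (I.game.payoff i (I.sequence w t) : ℚ) - (I.game.payoff i (I.game.deviate i b
        (I.sequence w k)) - I.goalValue i) : ℚ) : ℝ) := by
    push_cast
    linarith
  have := Rat.cast_pos.1 this
  simp only [Pi.zero_apply, zero_add]
  linarith

end HazingInstance

/-! ### Short witnesses -/

section Regroup

variable {A : Type*} {h t : Fin 2 → A → ℚ} {x y : Fin 2 → ℚ} {w : List A} {a : A}

theorem sum_map_filter_ne [DecidableEq A] (f : A → ℚ) (a : A) (w : List A) :
    (w.count a : ℚ) * f a + ((w.filter (· ≠ a)).map f).sum = (w.map f).sum := by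
  induction w with
  | nil => simp
  | cons b w ih =>
      by_cases hb : b = a
      · subst hb
        rw [List.count_cons_self, List.filter_cons_of_neg (by simp), List.map_cons, List.sum_cons,
          ← ih]
        push_cast
        ring
      · rw [List.count_cons_of_ne hb, List.filter_cons_of_pos (by simpa using hb), List.map_cons,
          List.sum_cons, List.map_cons, List.sum_cons, ← ih]
        ring

/-- Copies of an action pair with nonnegative costs can be moved to the front. -/
theorem IsSafe.filter_ne [DecidableEq A] (hw : IsSafe h t x w) (ha : ∀ i, 0 ≤ h i a)
    (hy : ∀ i, x i + w.count a * h i a ≤ y i) : IsSafe h t y (w.filter (· ≠ a)) := by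
  induction w generalizing x y with
  | nil => trivial
  | cons b w ih =>
      by_cases hb : b = a
      · subst hb
        rw [List.filter_cons_of_neg (by simp)]
        refine ih hw.2 fun i => le_of_eq_of_le ?_ (hy i)
        rw [List.count_cons_self]
        push_cast
        ring
      · rw [List.count_cons_of_ne hb] at hy
        rw [List.filter_cons_of_pos (by simpa using hb)]
        refine ⟨fun i => (hw.1 i).trans_le (le_trans ?_ (hy i)), ih hw.2 fun i => ?_⟩
        · exact le_add_of_nonneg_right (mul_nonneg (Nat.cast_nonneg _) (ha i))
        · linarith [hy i]

theorem expandRuns_cons (p : A × ℕ) (u : List (A × ℕ)) :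
    expandRuns (p :: u) = List.replicate p.2 p.1 ++ expandRuns u := rfl

/-- A safe sequence can be rearranged into few runs. -/
theorem IsSafe.exists_runs [DecidableEq A] (hw : IsSafe h t x w)
    (hh : ∀ a, h 0 a + h 1 a = 0 ∨ 1 ≤ h 0 a + h 1 a) :
    ∃ u : List (A × ℕ), IsSafe h t x (expandRuns u) ∧
      (∀ i, ((expandRuns u).map (h i)).sum = (w.map (h i)).sum) ∧
      u.length ≤ w.countP (fun a => decide (h 0 a < 0 ∨ h 1 a < 0)) + w.toFinset.card ∧
      ∀ p ∈ u, (p.2 : ℚ) ≤ 1 + (w.map fun a => h 0 a + h 1 a).sum := by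
  have hpos : ∀ a, 0 ≤ h 0 a + h 1 a := fun a => by rcases hh a with h | h <;> linarith
  have hsum : ∀ w : List A, 0 ≤ (w.map fun a => h 0 a + h 1 a).sum := fun w =>
    List.sum_nonneg (by simpa using fun a _ => hpos a)
  -- For the induction only pairs without a negative cost are counted once each; negative entries
  -- are counted by `countP`.
  suffices H : ∀ (N : ℕ) (w : List A) (x : Fin 2 → ℚ), w.length ≤ N → IsSafe h t x w →
      ∃ u : List (A × ℕ), IsSafe h t x (expandRuns u) ∧
      (∀ i, ((expandRuns u).map (h i)).sum = (w.map (h i)).sum) ∧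
      u.length ≤ w.countP (fun a => decide (h 0 a < 0 ∨ h 1 a < 0)) +
        (w.toFinset.filter fun a => ¬ (h 0 a < 0 ∨ h 1 a < 0)).card ∧
      ∀ p ∈ u, (p.2 : ℚ) ≤ 1 + (w.map fun a => h 0 a + h 1 a).sum by
    obtain ⟨u, h₀, h₁, h₂, h₃⟩ := H w.length w x le_rfl hw
    exact ⟨u, h₀, h₁, h₂.trans (Nat.add_le_add_left (Finset.card_filter_le _ _) _), h₃⟩
  intro N
  induction N with
  | zero =>
      intro w x hN _
      obtain rfl := List.length_eq_zero_iff.1 (Nat.le_zero.1 hN)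
      exact ⟨[], trivial, fun _ => rfl, Nat.zero_le _, by simp⟩
  | succ N ih =>
      rintro (_ | ⟨a, w⟩) x hN hw
      · exact ⟨[], trivial, fun _ => rfl, Nat.zero_le _, by simp⟩
      rw [List.length_cons, Nat.succ_le_succ_iff] at hN
      by_cases hn : h 0 a < 0 ∨ h 1 a < 0
      -- A negative entry stays where it is, as a run of its own.
      · obtain ⟨u, h₀, h₁, h₂, h₃⟩ := ih w _ hN hw.2
        refine ⟨(a, 1) :: u, ⟨hw.1, h₀⟩, fun i => ?_, ?_, ?_⟩
        · simpa [expandRuns_cons] using h₁ i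
        · rw [List.countP_cons_of_pos (by simpa using hn), List.length_cons]
          have : (w.toFinset.filter fun a => ¬ (h 0 a < 0 ∨ h 1 a < 0)).card
              ≤ ((a :: w).toFinset.filter fun a => ¬ (h 0 a < 0 ∨ h 1 a < 0)).card :=
            Finset.card_le_card (Finset.filter_subset_filter _ (by simp))
          omega
        · rw [List.forall_mem_cons, List.map_cons, List.sum_cons]
          refine ⟨?_, fun p hp => ?_⟩
          · have := hsum w
            have := hpos a
            simp only [Nat.cast_one]
            linarith
          · linarith [h₃ p hp, hpos a]
      · have hfN : (w.filter (· ≠ a)).length ≤ N := (List.length_filter_le _ _).trans hN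
        have hn' : ∀ i, 0 ≤ h i a := by
          rw [Fin.forall_fin_two]
          simpa using hn
        have hms := sum_map_filter_ne (fun a => h 0 a + h 1 a) a w
        have hcnt : ∀ m : ℕ, m * (h 0 a + h 1 a) = (w.count a : ℚ) * (h 0 a + h 1 a) →
            ∀ i, (m : ℚ) * h i a = w.count a * h i a := by
          intro m hm
          rcases (hpos a).eq_or_lt with hz | hz
          · have h₀ := hn' 0
            have h₁ := hn' 1
            rw [Fin.forall_fin_two, show h 0 a = 0 by linarith, show h 1 a = 0 by linarith]
            simp
          · intro i
            rw [mul_right_cancel₀ hz.ne' hm]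
        -- The number of later copies to keep. If the costs add up to zero, both vanish and no copy
        -- is needed; otherwise each copy costs at least one, so the total hazing bounds their
        -- number.
        obtain ⟨m, hm, hm'⟩ : ∃ m : ℕ, m * (h 0 a + h 1 a) = (w.count a : ℚ) * (h 0 a + h 1 a) ∧
            (m : ℚ) ≤ w.count a * (h 0 a + h 1 a) := by
          rcases hh a with hz | hz
          · exact ⟨0, by simp [hz]⟩
          · exact ⟨w.count a, rfl, le_mul_of_one_le_right (Nat.cast_nonneg _) hz⟩
        have hmi := hcnt m hm
        have hsafe : IsSafe h t (fun i => x i + ((List.replicate (m + 1) a).map (h i)).sum)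
            (w.filter (· ≠ a)) := by
          refine hw.2.filter_ne hn' fun i => le_of_eq ?_
          rw [List.map_replicate, List.sum_replicate, nsmul_eq_mul, ← hmi i]
          push_cast
          ring
        obtain ⟨u, h₀, h₁, h₂, h₃⟩ := ih _ _ hfN hsafe
        refine ⟨(a, m + 1) :: u, ?_, fun i => ?_, ?_, ?_⟩
        · rw [expandRuns_cons, isSafe_append, isSafe_replicate_succ]
          exact ⟨⟨hw.1, fun i => (hw.1 i).trans_le
            (le_add_of_nonneg_right (mul_nonneg (Nat.cast_nonneg _) (hn' i)))⟩, h₀⟩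
        · rw [expandRuns_cons, List.map_append, List.sum_append, h₁, List.map_replicate,
            List.sum_replicate, nsmul_eq_mul, List.map_cons, List.sum_cons,
            ← sum_map_filter_ne (h i) a w, ← hmi i]
          push_cast
          ring
        · rw [List.countP_cons_of_neg (by simpa using hn), List.length_cons]
          have h₄ : (w.filter (· ≠ a)).countP (fun a => decide (h 0 a < 0 ∨ h 1 a < 0))
              ≤ w.countP (fun a => decide (h 0 a < 0 ∨ h 1 a < 0)) :=
            List.filter_sublist.countP_le
          -- The pair `a` no longer occurs in the rest, which pays for its run.
          have h₅ : ((w.filter (· ≠ a)).toFinset.filter fun a => ¬ (h 0 a < 0 ∨ h 1 a < 0)).card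
              < ((a :: w).toFinset.filter fun a => ¬ (h 0 a < 0 ∨ h 1 a < 0)).card := by
            refine Finset.card_lt_card ⟨fun b hb => ?_, fun hs => ?_⟩
            · simp only [Finset.mem_filter, List.mem_toFinset, List.mem_filter] at hb
              simp only [Finset.mem_filter, List.mem_toFinset]
              exact ⟨List.mem_cons_of_mem _ hb.1.1, hb.2⟩
            · have := hs (Finset.mem_filter.2 ⟨List.mem_toFinset.2 List.mem_cons_self, hn⟩)
              simp at this
          omega
        · rw [List.forall_mem_cons, List.map_cons, List.sum_cons, ← hms]
          refine ⟨?_, fun p hp => ?_⟩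
          · have := hsum (w.filter (· ≠ a))
            have := hpos a
            push_cast
            linarith
          · have : (0 : ℚ) ≤ w.count a * (h 0 a + h 1 a) :=
              mul_nonneg (Nat.cast_nonneg _) (hpos a)
            linarith [h₃ p hp, hpos a]

end Regroup

namespace HazingInstance

variable (I : HazingInstance)

/-- All goal entries have the same welfare, so the two goal values add up to this integer although
each may have denominator `r`. Maximality gives the sign. -/
theorem exists_hazing_add_eq (hI : I.IsWelfareMaximal) (a : I.game.Pair) :
    ∃ z : ℕ, I.hazing 0 a + I.hazing 1 a = z := by
  set g := I.goal ⟨0, I.r_pos⟩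
  have hr : (I.r : ℚ) ≠ 0 := by exact_mod_cast I.r_pos.ne'
  have hg : ∀ j, (I.game.payoff 0 (I.goal j) : ℚ) + I.game.payoff 1 (I.goal j)
      = I.game.payoff 0 g + I.game.payoff 1 g := fun j => by
    exact_mod_cast le_antisymm (hI _ (I.goal j)) (hI j g)
  have hv : I.goalValue 0 + I.goalValue 1 = I.game.payoff 0 g + I.game.payoff 1 g := by
    rw [goalValue, goalValue, ← add_div, ← Finset.sum_add_distrib, Finset.sum_congr rfl
      fun j _ => hg j, Finset.sum_const, Finset.card_univ, Fintype.card_fin, nsmul_eq_mul,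
      mul_div_cancel_left₀ _ hr]
  have h := hI ⟨0, I.r_pos⟩ a
  obtain ⟨z, hz⟩ := Int.eq_ofNat_of_zero_le (sub_nonneg.2 h)
  refine ⟨z, ?_⟩
  have hz' : ((I.game.payoff 0 g + I.game.payoff 1 g -
    (I.game.payoff 0 a + I.game.payoff 1 a) : ℤ) : ℚ) = z := by
    rw [hz]
    rfl
  rw [← hz', hazing, hazing]
  push_cast
  linarith

theorem hazing_add_nonneg (hI : I.IsWelfareMaximal) (a : I.game.Pair) :
    0 ≤ I.hazing 0 a + I.hazing 1 a := by
  obtain ⟨z, hz⟩ := I.exists_hazing_add_eq hI a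
  rw [hz]
  positivity

theorem totalHazing_nonneg (hI : I.IsWelfareMaximal) (w : List I.game.Pair) :
    0 ≤ I.totalHazing w :=
  List.sum_nonneg fun x hx => by
    obtain ⟨a, -, rfl⟩ := List.mem_map.1 hx
    exact I.hazing_add_nonneg hI a

theorem totalHazing_append (v w : List I.game.Pair) :
    I.totalHazing (v ++ w) = I.totalHazing v + I.totalHazing w := by
  simp [totalHazing]

theorem totalHazing_eq (w : List I.game.Pair) :
    I.totalHazing w = (w.map (I.hazing 0)).sum + (w.map (I.hazing 1)).sum :=
  List.sum_map_add

/-- Restarting without changing one's action is a deviation too. Hence the hazing stays positive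
after an action pair that was played safely. -/
theorem neg_hazing_le_threshold (i : Fin 2) (a : I.game.Pair) :
    -I.hazing i a ≤ I.threshold i a := by
  have h : I.game.payoff i a ≤ I.game.deviationPayoff i a := by
    match i with
    | 0 =>
      exact Finset.le_sup' (fun b : I.game.Action 0 => I.game.payoff 0 (I.game.deviate 0 b a))
        (Finset.mem_univ a.1)
    | 1 =>
      exact Finset.le_sup' (fun b : I.game.Action 1 => I.game.payoff 1 (I.game.deviate 1 b a))
        (Finset.mem_univ a.2)
  have h' : (I.game.payoff i a : ℚ) ≤ I.game.deviationPayoff i a := by exact_mod_cast h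
  rw [hazing, threshold]
  linarith

/-- While a safe sequence is played, the accumulated hazing is nonnegative. -/
theorem Safe.sum_nonneg {x : Fin 2 → ℚ} {w : List I.game.Pair} (hw : I.Safe x w) (i : Fin 2)
    (hx : 0 ≤ x i) : 0 ≤ x i + (w.map (I.hazing i)).sum := by
  induction w generalizing x with
  | nil => simpa using hx
  | cons a w ih =>
      have := ih hw.2 (by linarith [hw.1 i, I.neg_hazing_le_threshold i a])
      simpa [add_assoc] using this

/-- The accumulated hazing, times the length of the goal sequence. -/
def scaledHazing (i : Fin 2) (w : List I.game.Pair) : ℤ :=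
  (w.map fun a => Verifier.cost I.toIntegers i (I.index a)).sum

theorem cast_scaledHazing (i : Fin 2) (w : List I.game.Pair) :
    (I.scaledHazing i w : ℚ) = I.r * (w.map (I.hazing i)).sum := by
  rw [scaledHazing]
  induction w with
  | nil => simp
  | cons a w ih => simp [cost_toIntegers, mul_add] at ih ⊢; exact ih

/-- A shortest safe sequence of bounded total hazing does not repeat a state. -/
theorem exists_safe_length_le (hI : I.IsWelfareMaximal) {g w : List I.game.Pair} {q : ℕ}
    (hw : I.Safe 0 (w ++ g)) (hq : I.totalHazing w ≤ q) :
    ∃ w', I.Safe 0 (w' ++ g) ∧ I.totalHazing w' ≤ I.totalHazing w ∧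
      w'.length ≤ (I.r * q + 1) ^ 2 := by
  classical
  have hex : ∃ N, ∃ w', I.Safe 0 (w' ++ g) ∧ I.totalHazing w' ≤ I.totalHazing w ∧
      w'.length = N := ⟨_, w, hw, le_rfl, rfl⟩
  obtain ⟨w', hw', htot, hlen⟩ := Nat.find_spec hex
  refine ⟨w', hw', htot, ?_⟩
  have hr : (0 : ℚ) < I.r := by exact_mod_cast I.r_pos
  -- The states lie in a square grid: safety keeps both coordinates nonnegative, and since total
  -- hazing never decreases, the bound `q` holds for every prefix.
  have hmem : ∀ (k : ℕ) (i : Fin 2),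
      I.scaledHazing i (w'.take k) ∈ Finset.Icc (0 : ℤ) (I.r * q) := by
    intro k
    have hsafe : I.Safe 0 (w'.take k) := by
      rw [← List.take_append_drop k w', List.append_assoc] at hw'
      exact (isSafe_append.1 hw').1
    have hn : ∀ i, 0 ≤ ((w'.take k).map (I.hazing i)).sum := fun i => by
      simpa using Safe.sum_nonneg I hsafe i le_rfl
    have ht : ((w'.take k).map (I.hazing 0)).sum + ((w'.take k).map (I.hazing 1)).sum ≤ q := by
      rw [← totalHazing_eq]
      refine le_trans ?_ (htot.trans hq)
      conv_rhs => rw [← List.take_append_drop k w', totalHazing_append]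
      exact le_add_of_nonneg_right (I.totalHazing_nonneg hI _)
    intro i
    have hle : ((w'.take k).map (I.hazing i)).sum ≤ q := by
      have h₀ := hn 0
      have h₁ := hn 1
      revert i
      rw [Fin.forall_fin_two]
      constructor <;> linarith
    rw [Finset.mem_Icc, ← @Int.cast_le ℚ, ← @Int.cast_le ℚ, cast_scaledHazing]
    push_cast
    exact ⟨mul_nonneg hr.le (hn i), mul_le_mul_of_nonneg_left hle hr.le⟩
  have hinj : Set.InjOn (fun k => (I.scaledHazing 0 (w'.take k), I.scaledHazing 1 (w'.take k)))
      (Finset.range (w'.length + 1)) := by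
    -- Removing the part between two equal states keeps safety and total hazing, against the
    -- minimality of the length.
    have hlt : ∀ j k, j < k → k ≤ w'.length →
        ¬ ∀ i, I.scaledHazing i (w'.take j) = I.scaledHazing i (w'.take k) := by
      intro j k hjk hk heq
      have hsum : ∀ i, ((w'.take j).map (I.hazing i)).sum = ((w'.take k).map (I.hazing i)).sum :=
        fun i => mul_left_cancel₀ hr.ne' (by rw [← cast_scaledHazing, ← cast_scaledHazing, heq])
      refine Nat.find_min hex (m := j + (w'.length - k)) (by omega)
        ⟨w'.take j ++ w'.drop k, ?_, le_trans (le_of_eq ?_) htot, by simp; omega⟩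
      · have h₁ := hw'
        have h₂ := hw'
        rw [← List.take_append_drop j w', List.append_assoc] at h₁
        rw [← List.take_append_drop k w', List.append_assoc] at h₂
        rw [List.append_assoc]
        refine isSafe_append.2 ⟨(isSafe_append.1 h₁).1, ?_⟩
        simp only [hsum]
        exact (isSafe_append.1 h₂).2
      · conv_rhs => rw [← List.take_append_drop k w', totalHazing_append]
        rw [totalHazing_append, totalHazing_eq, hsum, hsum, ← totalHazing_eq]
    intro j hj k hk hjk
    rw [Finset.coe_range, Set.mem_Iio] at hj hk
    have heq : ∀ i, I.scaledHazing i (w'.take j) = I.scaledHazing i (w'.take k) := by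
      rw [Fin.forall_fin_two]
      exact Prod.ext_iff.1 hjk
    rcases lt_trichotomy j k with h | h | h
    · exact absurd heq (hlt j k h (by omega))
    · exact h
    · exact absurd (fun i => (heq i).symm) (hlt k j h (by omega))
  have hcard := Finset.card_le_card_of_injOn _ (t := Finset.Icc (0 : ℤ) (I.r * q) ×ˢ
    Finset.Icc (0 : ℤ) (I.r * q)) (fun k _ => Finset.mem_product.2 ⟨hmem k 0, hmem k 1⟩) hinj
  have h₁ : (Finset.Icc (0 : ℤ) (I.r * q)).card = I.r * q + 1 := by
    rw [Int.card_Icc]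
    omega
  rw [Finset.card_range, Finset.card_product, h₁, ← sq] at hcard
  omega

/-! ### The length of codes -/

theorem length_encodeInteger (m : ℕ) : (encodeInteger m).length = m.size + 1 := by
  rw [encodeInteger, if_neg (by omega)]
  simp [Nat.size_eq_bits_len]

theorem length_encodeRuns_le {u : List (I.game.Pair × ℕ)} {K m : ℕ} (hn : I.n ≤ K)
    (hm : ∀ p ∈ u, p.2 < 2 ^ m) : (I.game.encodeRuns u).length ≤ u.length * (K + m + 2) := by
  rw [RestartGame.encodeRuns, encodeIntegers, List.flatMap_assoc, List.length_flatMap]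
  refine (List.sum_le_card_nsmul _ (K + m + 2) fun x hx => ?_).trans (by simp)
  obtain ⟨p, hp, rfl⟩ := List.mem_map.1 hx
  have h₁ : (I.index p.1).size ≤ K :=
    Nat.size_le.2 (((I.index_lt p.1).trans_le hn).trans Nat.lt_two_pow_self)
  have h₂ : p.2.size ≤ m := Nat.size_le.2 (hm p hp)
  have h₃ : I.game.pairIndex p.1 = (I.index p.1 : ℤ) := rfl
  rw [h₃, List.flatMap_cons, List.flatMap_cons, List.flatMap_nil, List.append_nil,
    List.length_append, length_encodeInteger, length_encodeInteger]
  omega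

theorem length_encodeInteger_le_encode {z : ℤ} (hz : z ∈ I.toIntegers) :
    (encodeInteger z).length ≤ I.encode.length := by
  rw [encode, encodeIntegers, List.length_flatMap]
  exact List.le_sum_of_mem (List.mem_map_of_mem hz)

theorem length_toIntegers_le_encode : I.toIntegers.length ≤ I.encode.length := by
  rw [encode, encodeIntegers, List.length_flatMap]
  refine (by simp : I.toIntegers.length = (I.toIntegers.map fun _ => 1).sum).le.trans ?_
  refine List.sum_le_sum fun z _ => ?_
  simp [encodeInteger]
  omega

/-- The numerator is written out in the code, and the denominator is at least one. -/
theorem bound_lt : I.bound < 2 ^ I.encode.length := by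
  have h₁ : (encodeInteger I.bound.num).length ≤ I.encode.length :=
    I.length_encodeInteger_le_encode (by simp [toIntegers])
  have h₂ : I.bound.num.natAbs.size ≤ I.encode.length := by
    refine le_trans ?_ h₁
    rw [encodeInteger, ← Nat.size_eq_bits_len]
    simp
    omega
  have h₃ : I.bound ≤ (I.bound.num.natAbs : ℕ) := by
    have hd : (1 : ℚ) ≤ I.bound.den := by exact_mod_cast I.bound.den_pos
    have : (I.bound.num : ℚ) ≤ (I.bound.num.natAbs : ℕ) := by
      rw [← Int.cast_natCast, Int.cast_le]
      exact Int.le_natAbs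
    conv_lhs => rw [← Rat.num_div_den I.bound]
    rw [div_le_iff₀ (by linarith)]
    exact this.trans (le_mul_of_one_le_right (Nat.cast_nonneg _) hd)
  refine h₃.trans_lt ?_
  exact_mod_cast Nat.size_le.1 h₂

/-! ### Existence of short witnesses -/

theorem isYes_of_isRunLengthWitness {c : List HazingSymbol} (h : I.IsRunLengthWitness c) :
    I.IsYes := by
  obtain ⟨u, -, hu⟩ := h
  exact ⟨_, hu⟩

theorem exists_runs_of_hasStableOfHazingLE (hI : I.IsWelfareMaximal) {q : ℕ} (hy : I.IsYes)
    (h : I.HasStableOfHazingLE q) : ∃ u : List (I.game.Pair × ℕ), I.IsSolution (expandRuns u) ∧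
      u.length ≤ (I.r * q + 1) ^ 2 ∧ ∀ p ∈ u, p.2 = 1 := by
  obtain ⟨w, hw, hB, hq⟩ : ∃ w, I.Safe 0 (w ++ List.ofFn I.goal) ∧ I.totalHazing w ≤ I.bound ∧
      I.totalHazing w ≤ q := by
    obtain ⟨w₀, hw₀⟩ := hy
    obtain ⟨w₁, hw₁, hq⟩ := h
    rw [isSolution_iff] at hw₀
    -- If the bound is at most `q`, any solution has small hazing; otherwise the given stable
    -- sequence already respects the bound.
    rcases le_total I.bound q with hB | hB
    · exact ⟨w₀, hw₀.2, hw₀.1, hw₀.1.trans hB⟩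
    · exact ⟨w₁, I.safe_of_isStableHazing hw₁, hq.trans hB, hq⟩
  obtain ⟨w', hw', htot, hlen⟩ := I.exists_safe_length_le hI hw hq
  have he : expandRuns (w'.map fun a => (a, 1)) = w' := by
    rw [expandRuns, List.flatMap_map]
    exact List.flatMap_singleton' _
  refine ⟨w'.map fun a => (a, 1), ?_, by simpa using hlen, List.forall_mem_map.2 fun _ _ => rfl⟩
  rw [he, isSolution_iff]
  exact ⟨htot.trans hB, hw'⟩

theorem exists_runs_of_hasStableOfNegativesLE (hI : I.IsWelfareMaximal) {q : ℕ}
    (h : I.HasStableOfNegativesLE q) : ∃ u : List (I.game.Pair × ℕ),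
      I.IsSolution (expandRuns u) ∧ u.length ≤ q + I.n ∧ ∀ p ∈ u, (p.2 : ℚ) ≤ 1 + I.bound := by
  obtain ⟨w, hw, hB, hq⟩ := h
  have hsafe := isSafe_append.1 (I.safe_of_isStableHazing hw)
  obtain ⟨u, h₀, h₁, h₂, h₃⟩ := hsafe.1.exists_runs fun a => by
    obtain ⟨_ | z, hz⟩ := I.exists_hazing_add_eq hI a
    · exact Or.inl (by simpa using hz)
    · refine Or.inr ?_
      rw [hz]
      exact_mod_cast Nat.succ_pos z
  refine ⟨u, ?_, h₂.trans (Nat.add_le_add hq ?_), fun p hp => (h₃ p hp).trans ?_⟩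
  · rw [isSolution_iff, totalHazing_eq, h₁, h₁, ← totalHazing_eq]
    refine ⟨hB, isSafe_append.2 ⟨h₀, ?_⟩⟩
    simp only [h₁]
    exact hsafe.2
  · refine (Finset.card_le_univ _).trans (le_of_eq ?_)
    simp [n, RestartGame.numPairs]
  · exact add_le_add_right hB 1

theorem exists_short_witness (hI : I.IsWelfareMaximal) {q : ℕ} (hy : I.IsYes)
    (h : I.HasStableOfHazingLE q ∨ I.HasStableOfNegativesLE q) : ∃ c,
      c.length ≤ ((I.encode.length * q + 1) ^ 2 + q + I.encode.length)
        * (2 * I.encode.length + 3) ∧ I.IsRunLengthWitness c := by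
  have hlen := I.length_toIntegers_le_encode
  rw [length_toIntegers] at hlen
  have hr : (I.r * q + 1) ^ 2 ≤ (I.encode.length * q + 1) ^ 2 := by
    gcongr
    omega
  obtain ⟨u, hu, hl, hm⟩ : ∃ u : List (I.game.Pair × ℕ), I.IsSolution (expandRuns u) ∧
      u.length ≤ (I.encode.length * q + 1) ^ 2 + q + I.encode.length ∧
      ∀ p ∈ u, p.2 < 2 ^ (I.encode.length + 1) := by
    rcases h with h | h
    · obtain ⟨u, hu, hl, hm⟩ := I.exists_runs_of_hasStableOfHazingLE hI hy h
      refine ⟨u, hu, by omega, fun p hp => ?_⟩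
      rw [hm p hp]
      exact Nat.one_lt_two_pow (Nat.succ_ne_zero _)
    · obtain ⟨u, hu, hl, hm⟩ := I.exists_runs_of_hasStableOfNegativesLE hI h
      refine ⟨u, hu, by omega, fun p hp => ?_⟩
      have h₁ := hm p hp
      have h₂ := I.bound_lt
      -- Multiplicities are at most `1 + B`, which is less than `1 + 2 ^ N` and so than `2 ^ (N +
      -- 1)`, where `N` is the length of the code of the instance.
      have h₃ : (1 : ℚ) ≤ 2 ^ I.encode.length := one_le_pow₀ one_le_two
      have : (p.2 : ℚ) < 2 ^ (I.encode.length + 1) := by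
        rw [pow_succ]
        linarith
      exact_mod_cast this
  refine ⟨_, ?_, u, rfl, hu⟩
  refine (I.length_encodeRuns_le (K := I.encode.length) (by omega) hm).trans ?_
  exact Nat.mul_le_mul hl (by omega)

/-- Soundness needs no length bound, since a witness contains a solution. For completeness, `r` and
`n` are at most the length of the instance code, because the tables and the goal sequence are
written out. -/
theorem isNPRelationOn_isRunLengthWitness {C : Set HazingInstance} {p : Polynomial ℕ}
    (hwelfare : ∀ I ∈ C, I.IsWelfareMaximal)
    (hC : ∀ I ∈ C, I.IsYes →
      I.HasStableOfHazingLE (p.eval I.n) ∨ I.HasStableOfNegativesLE (p.eval I.n)) :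
    IsNPRelationOn encode C {I | I.IsYes} IsRunLengthWitness := by
  refine ⟨polyTimeDecidable_isRunLengthWitness, ((Polynomial.X * p + 1) ^ 2 + p + Polynomial.X) *
    (2 * Polynomial.X + 3), fun I hI => ⟨fun hy => ?_, fun ⟨c, _, hc⟩ =>
      I.isYes_of_isRunLengthWitness hc⟩⟩
  obtain ⟨c, hc, hw⟩ := I.exists_short_witness (hwelfare I hI) hy (hC I hI hy)
  refine ⟨c, hc.trans ?_, hw⟩
  have hlen := I.length_toIntegers_le_encode
  rw [length_toIntegers] at hlen
  have hp : p.eval I.n ≤ p.eval I.encode.length := Polynomial.eval_mono_nat p (by omega)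
  simp only [Polynomial.eval_mul, Polynomial.eval_add, Polynomial.eval_pow, Polynomial.eval_X,
    Polynomial.eval_one, Polynomial.eval_ofNat]
  gcongr

end HazingInstance

theorem mainTheorem5 (C : Set HazingInstance) (p : Polynomial ℕ)
    (hwelfare : ∀ I ∈ C, I.IsWelfareMaximal)
    (hr : ∀ I ∈ C, I.r ≤ p.eval I.n)
    (hC : ∀ I ∈ C, I.IsYes →
      I.HasStableOfHazingLE (p.eval I.n) ∨ I.HasStableOfNegativesLE (p.eval I.n)) :
    InNPOn HazingInstance.encode C {I | I.IsYes} ∧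
    ((∀ I ∈ C, I.IsYes → I.HasStableOfNegativesLE (p.eval I.n)) →
      IsNPRelationOn HazingInstance.encode C {I | I.IsYes} HazingInstance.IsRunLengthWitness) :=
  ⟨⟨_, HazingInstance.isNPRelationOn_isRunLengthWitness hwelfare hC⟩, fun h =>
    HazingInstance.isNPRelationOn_isRunLengthWitness hwelfare fun I hI hy => Or.inr (h I hI hy)⟩
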